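/- **Setting.** Let $n\ge 2$, let $F_n$ be the free group on $x_1,\dots,x_n$, $H=H_1(F_n;\mathbb R)$ with basis $X_i=[x_i]$, $H^*=\mathrm{Hom}(H,\mathbb R)$, $\widehat T=\prod_{m\ge0}H^{\otimes m}=\mathbb R\langle\langle X_1,\dots,X_n\rangle\rangle$ and $\widehat T_k=\prod_{m\ge k}H^{\otimes m}$. Let $\Theta_n$ be the set of Magnus expansions, i.e. of homomorphisms $\theta:F_n\to 1+\widehat T_1$ with $\theta(\gamma)\equiv 1+[\gamma]$ modulo $\widehat T_2$. It is a projective limit of finite-dimensional manifolds through the global coordinates $\theta\mapsto(\theta(x_i)-1-X_i)_i\in\widehat T_2^{\,n}$; smooth forms on $\Theta_n$ are those pulled back from finitely many coordinates. The group $\mathrm{Aut}(F_n)$ acts on $\Theta_n$ by $\varphi\cdot\theta=|\varphi|\circ\theta\circ\varphi^{-1}$, where $|\varphi|$ is induced by the action of $\varphi$ on $H$, and it acts on $H^*\otimes H^{\otimes m}$ through $|\varphi|$. Let $IA(\widehat T)$ be the group of filtration-preserving algebra automorphisms of $\widehat T$ inducing the identity on $H=\widehat T_1/\widehat T_2$;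 it acts freely and transitively on $\Theta_n$ by $U\cdot\theta=U\circ\theta$. Its Lie algebra consists of the filtration-preserving derivations $u$ with $u(\widehat T_1)\subset\widehat T_2$, and restriction to $H$ identifies it with $\prod_{p\ge1}H^*\otimes H^{\otimes(p+1)}$. The Maurer–Cartan form $\eta=\sum_{p\ge1}\eta_p$, $\eta_p\in\Omega^1(\Theta_n)\otimes H^*\otimes H^{\otimes(p+1)}$, is the inverse of the trivialization $u\mapsto\frac{d}{dt}\big|_{t=0}\exp(tu)\circ\theta$ of the tangent spaces. For $p\ge1$ let $K_{p+1}$ be the Stasheff associahedron. Its cells are the meaningful parenthesizations of the word $1\,2\cdots p+1$, the outermost pair of parentheses included; if $\deg w$ is the number of pairs, the cell $w$ has dimension $p-\deg w$. Let $\tilde S_p$ be the set of oriented cells. For $a,b\ge0$, $q\ge1$, $a+b\ge1$, let $\partial_{a,q,b}:K_{a+b+1}\times K_{q+1}\to K_{a+b+q+1}$ be the face map that replaces the letter $a+1$ by $q+1$ letters in parentheses; $\partial_{a,q,b}(w\times K_{q+1})$ carries the product orientation. The standard orientations satisfy $$\partial K_{p+1}=\sum_{s=1}^{p-1}\sum_{k=0}^{p-s}(-1)^{(s+1)(p+k)+k+1}\,\partial_{k,s,p-k-s}(K_{p-s+1}\times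 K_{s+1}).$$ **Proposition.** There is exactly one family of maps $Y_p$, $p\ge1$, from $\tilde S_p$ to forms on $\Theta_n$ with values in tensors, such that $$Y_p(\pm K_{p+1})=\pm\eta_p,\qquad Y_{a+b+q}\big(\partial_{a,q,b}(w\times K_{q+1})\big)=(-1)^{a+(q+1)b+\deg w}\,(1^{\otimes a}\otimes\eta_q\otimes1^{\otimes b})\,Y_{a+b}(w)$$ for all $a,b\ge0$, $q\ge1$ with $a+b\ge1$ and all $w\in\tilde S_{a+b}$; the product on the right is the wedge product of forms combined with composition of linear maps. In other words, this recursive definition of $Y$ does not depend on the choice of innermost pairs of parentheses. For every $p\ge1$, $Y_p$ is a cellular cochain of total degree $p$ of the double complex $$C^*\big(K_{p+1};(\Omega^*(\Theta_n)\otimes H^*\otimes H^{\otimes(p+1)})^{\mathrm{Aut}(F_n)}\big),$$ that is, $Y_p(-w)=-Y_p(w)$, and $Y_p(w)$ is a smooth $\mathrm{Aut}(F_n)$-invariant form of degree $\deg w$ with values in $H^*\otimes H^{\otimes(p+1)}$. Moreover $$d\big(Y_p(w)\big)=(\delta Y_p)(w)=Y_p(\partial w)\qquad\text{for all }w\in\tilde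 S_p,$$ so that $Y_p$ is a $p$-cocycle of the double complex, for the total differential $(-1)^r(d+\delta)$ on cochains with values in $r$-forms. -/

import Mathlib

namespace MagnusForms

noncomputable section

/-! ### The completed tensor algebra `T̂ = ∏ H^{⊗ m} = ℝ⟨⟨X_1, …, X_n⟩⟩` -/

/-- Noncommutative formal power series in `X_1, …, X_n`: a series is the family of its coefficients,
indexed by words. The classes `X_i = [x_i]` form a basis of `H = H_1(F_n; ℝ)`, so the words of
length `m` form a basis of `H^{⊗ m}`, and `Series n` is the completed tensor algebra
`∏_{m ≥ 0} H^{⊗ m}`. -/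
def Series (n : ℕ) : Type := List (Fin n) → ℝ

namespace Series

variable {n : ℕ}

instance : AddCommGroup (Series n) := inferInstanceAs (AddCommGroup (List (Fin n) → ℝ))

instance : Module ℝ (Series n) := inferInstanceAs (Module ℝ (List (Fin n) → ℝ))

@[ext] theorem ext {f g : Series n} (h : ∀ w, f w = g w) : f = g := funext h

@[simp] theorem zero_apply (w : List (Fin n)) : (0 : Series n) w = 0 := rfl
@[simp] theorem add_apply (f g : Series n) (w : List (Fin n)) : (f + g) w = f w + g w := rfl
@[simp] theorem neg_apply (f : Series n) (w : List (Fin n)) : (-f) w = -f w := rfl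
@[simp] theorem sub_apply (f g : Series n) (w : List (Fin n)) : (f - g) w = f w - g w := rfl
@[simp] theorem smul_apply (c : ℝ) (f : Series n) (w : List (Fin n)) : (c • f) w = c * f w := rfl

/-- The series `y` such that `f = f_∅ + ∑ a, X_a * y_a`, where `f_∅` is the constant term. -/
def tail (a : Fin n) (f : Series n) : Series n := fun w => f (a :: w)

@[simp] theorem tail_apply (a : Fin n) (f : Series n) (w : List (Fin n)) :
    tail a f w = f (a :: w) := rfl

/-- The product of series; see `mul_apply` for the formula
`(f * g)_w = ∑_{w = u v} f_u g_v`. -/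
def mulCoeff : List (Fin n) → Series n → Series n → ℝ
  | [], f, g => f [] * g []
  | a :: w, f, g => f [] * g (a :: w) + mulCoeff w (tail a f) g

instance : Mul (Series n) := ⟨fun f g w => mulCoeff w f g⟩

instance : One (Series n) := ⟨fun w => if w = [] then 1 else 0⟩

theorem one_apply (w : List (Fin n)) : (1 : Series n) w = if w = [] then 1 else 0 := rfl
@[simp] theorem one_nil : (1 : Series n) [] = 1 := rfl
@[simp] theorem one_cons (a : Fin n) (w : List (Fin n)) : (1 : Series n) (a :: w) = 0 := rfl
@[simp] theorem mul_nil (f g : Series n) : (f * g) [] = f [] * g [] := rfl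
@[simp] theorem mul_cons (f g : Series n) (a : Fin n) (w : List (Fin n)) :
    (f * g) (a :: w) = f [] * g (a :: w) + (tail a f * g) w := rfl

theorem mul_apply (f g : Series n) (w : List (Fin n)) :
    (f * g) w = ∑ k ∈ Finset.range (w.length + 1), f (w.take k) * g (w.drop k) := by
  induction w generalizing f with
  | nil => simp
  | cons a w ih =>
    rw [mul_cons, ih, List.length_cons, Finset.sum_range_succ' _ (w.length + 1), add_comm]
    simp

@[simp] theorem tail_add (a : Fin n) (f g : Series n) : tail a (f + g) = tail a f + tail a g := rfl
@[simp] theorem tail_smul (a : Fin n) (c : ℝ) (f : Series n) : tail a (c • f) = c • tail a f := rfl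
@[simp] theorem tail_one (a : Fin n) : tail a (1 : Series n) = 0 := by ext w; simp

theorem tail_mul (a : Fin n) (f g : Series n) :
    tail a (f * g) = f [] • tail a g + tail a f * g := by ext w; simp

theorem mul_add' (f g h : Series n) : f * (g + h) = f * g + f * h := by
  ext w
  induction w generalizing f with
  | nil => simp [mul_add]
  | cons a w ih => simp only [mul_cons, add_apply] at ih ⊢; rw [ih]; ring

theorem add_mul' (f g h : Series n) : (f + g) * h = f * h + g * h := by
  ext w
  induction w generalizing f g with
  | nil => simp [add_mul]
  | cons a w ih =>
    simp only [mul_cons, add_apply, tail_add] at ih ⊢; rw [ih]; ring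

theorem smul_mul' (c : ℝ) (f g : Series n) : (c • f) * g = c • (f * g) := by
  ext w
  induction w generalizing f with
  | nil => simp [mul_assoc]
  | cons a w ih =>
    simp only [mul_cons, smul_apply, tail_smul] at ih ⊢; rw [ih]; ring

theorem mul_smul' (c : ℝ) (f g : Series n) : f * (c • g) = c • (f * g) := by
  ext w
  induction w generalizing f with
  | nil => simp; ring
  | cons a w ih =>
    simp only [mul_cons, smul_apply] at ih ⊢; rw [ih]; ring

theorem zero_mul' (f : Series n) : 0 * f = 0 := by
  simpa using smul_mul' 0 f f

theorem mul_zero' (f : Series n) : f * 0 = 0 := by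
  simpa using mul_smul' 0 f f

theorem mul_assoc' (f g h : Series n) : f * g * h = f * (g * h) := by
  ext w
  induction w generalizing f with
  | nil => simp [mul_assoc]
  | cons a w ih =>
    simp only [mul_cons, tail_mul, add_mul', add_apply, smul_mul', smul_apply, mul_nil, ih]
    ring

theorem one_mul' (f : Series n) : 1 * f = f := by
  ext w
  cases w with
  | nil => simp
  | cons a w => simp [zero_mul']

theorem mul_one' (f : Series n) : f * 1 = f := by
  ext w
  induction w generalizing f with
  | nil => simp
  | cons a w ih => simp [ih]

instance : Ring (Series n) :=
  { (inferInstance : AddCommGroup (Series n)), (inferInstance : Mul (Series n)),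
    (inferInstance : One (Series n)) with
    left_distrib := mul_add'
    right_distrib := add_mul'
    zero_mul := zero_mul'
    mul_zero := mul_zero'
    mul_assoc := mul_assoc'
    one_mul := one_mul'
    mul_one := mul_one' }

theorem sum_apply {ι : Type*} (s : Finset ι) (f : ι → Series n) (w : List (Fin n)) :
    (∑ i ∈ s, f i) w = ∑ i ∈ s, f i w := by
  classical
  induction s using Finset.induction_on with
  | empty => simp
  | insert i s hi ih => rw [Finset.sum_insert hi, Finset.sum_insert hi, add_apply, ih]

/-- The variable `X_i`, i.e. the class of `x_i` in `H = H^{⊗ 1}`. -/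
def X (i : Fin n) : Series n := fun w => if w = [i] then 1 else 0

/-- The filtration `T̂_m = ∏_{k ≥ m} H^{⊗ k}`. -/
def filt (n m : ℕ) : Submodule ℝ (Series n) where
  carrier := {f | ∀ w, w.length < m → f w = 0}
  add_mem' := by
    intro f g hf hg w hw
    simp [hf w hw, hg w hw]
  zero_mem' := by intro w _; rfl
  smul_mem' := by
    intro c f hf w hw
    simp [hf w hw]

theorem mem_filt {m : ℕ} {f : Series n} : f ∈ filt n m ↔ ∀ w, w.length < m → f w = 0 := Iff.rfl

theorem filt_anti {k m : ℕ} (h : k ≤ m) : filt n m ≤ filt n k :=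
  fun _ hf w hw => hf w (hw.trans_le h)

theorem tail_mem_filt {m : ℕ} {f : Series n} (hf : f ∈ filt n (m + 1)) (a : Fin n) :
    tail a f ∈ filt n m := fun w hw => hf (a :: w) (by simpa using hw)

theorem mul_mem_filt {k m : ℕ} {f g : Series n} (hf : f ∈ filt n k) (hg : g ∈ filt n m) :
    f * g ∈ filt n (k + m) := by
  intro w hw
  rw [mul_apply]
  refine Finset.sum_eq_zero fun j hj => ?_
  have hj' : j ≤ w.length := by simpa [Nat.lt_succ_iff] using hj
  by_cases h : j < k
  · rw [hf _ (by simp; omega), zero_mul]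
  · rw [hg _ (by simp; omega), mul_zero]

theorem pow_mem_filt {f : Series n} (hf : f ∈ filt n 1) (k : ℕ) : f ^ k ∈ filt n k := by
  induction k with
  | zero => intro w hw; simp at hw
  | succ k ih => rw [pow_succ]; exact mul_mem_filt ih hf

/-- A series with constant term `1` has a right inverse. -/
theorem exists_mul_eq_one {f : Series n} (hf : f [] = 1) :
    ∃ g : Series n, g [] = 1 ∧ f * g = 1 := by
  set x : Series n := 1 - f with hx
  have hx1 : x ∈ filt n 1 := by
    intro w hw
    have : w = [] := List.length_eq_zero_iff.mp (by omega)
    subst this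
    simp [hx, hf]
  let g : Series n := fun w => (∑ k ∈ Finset.range (w.length + 1), x ^ k) w
  have key : f * g = 1 := by
    ext w
    have h1 : (f * ∑ k ∈ Finset.range (w.length + 1), x ^ k) = 1 - x ^ (w.length + 1) := by
      have : f = 1 - x := by simp [hx]
      rw [this, mul_neg_geom_sum]
    have h2 : (f * g) w
        = (f * ∑ k ∈ Finset.range (w.length + 1), x ^ k) w := by
      rw [mul_apply, mul_apply]
      refine Finset.sum_congr rfl fun j hj => ?_
      congr 1
      have hsum : ∀ (N M : ℕ) (u : List (Fin n)), u.length < N → N ≤ M →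
          (∑ k ∈ Finset.range N, x ^ k) u = (∑ k ∈ Finset.range M, x ^ k) u := by
        intro N M u hu hNM
        have hmem : (∑ k ∈ Finset.Ico N M, x ^ k) ∈ filt n N :=
          Submodule.sum_mem _ fun k hk =>
            filt_anti (Finset.mem_Ico.mp hk).1 (pow_mem_filt hx1 k)
        rw [← Finset.sum_range_add_sum_Ico _ hNM, add_apply, hmem u hu, add_zero]
      exact hsum _ _ _ (Nat.lt_succ_self _) (by simp)
    rw [h2, h1, sub_apply, pow_mem_filt hx1 _ w (Nat.lt_succ_self _), sub_zero]
  exact ⟨g, by simp [g], key⟩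

theorem isUnit_of_nil_eq_one {f : Series n} (hf : f [] = 1) : IsUnit f := by
  obtain ⟨g, hg, hfg⟩ := exists_mul_eq_one hf
  obtain ⟨h, _, hgh⟩ := exists_mul_eq_one hg
  have : f = h := by
    calc f = f * (g * h) := by rw [hgh, mul_one]
      _ = h := by rw [← mul_assoc, hfg, one_mul]
  exact ⟨⟨f, g, hfg, by rw [this, hgh]⟩, rfl⟩

end Series

/-! ### The free group, its real homology, and Magnus expansions -/

/-- The class `[γ] ∈ H = F_n^{ab} ⊗ ℝ`, in the basis `X_1, …, X_n`; a homomorphism. -/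
def homologyHom (n : ℕ) : FreeGroup (Fin n) →* Multiplicative (Fin n → ℝ) :=
  FreeGroup.lift fun i => Multiplicative.ofAdd (Pi.single i 1)

/-- The class `[γ] ∈ H = F_n^{ab} ⊗ ℝ`, in the basis `X_1, …, X_n`. -/
def homologyClass {n : ℕ} (γ : FreeGroup (Fin n)) : Fin n → ℝ :=
  Multiplicative.toAdd (homologyHom n γ)

section homologyClass

variable {n : ℕ}

@[simp] theorem homologyClass_one : homologyClass (1 : FreeGroup (Fin n)) = 0 := by
  simp [homologyClass]

@[simp] theorem homologyClass_mul (γ δ : FreeGroup (Fin n)) :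
    homologyClass (γ * δ) = homologyClass γ + homologyClass δ := by
  simp [homologyClass]

@[simp] theorem homologyClass_inv (γ : FreeGroup (Fin n)) :
    homologyClass γ⁻¹ = -homologyClass γ := by
  simp [homologyClass]

@[simp] theorem homologyClass_of (i : Fin n) :
    homologyClass (FreeGroup.of i) = Pi.single i 1 := by
  simp [homologyClass, homologyHom]

end homologyClass

/-- A real-valued Magnus expansion of `F_n`: a homomorphism `θ : F_n → 1 + T̂_1` with
`θ(γ) ≡ 1 + [γ]` modulo `T̂_2`. -/
structure MagnusExpansion (n : ℕ) where
  toHom : FreeGroup (Fin n) →* Series n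
  apply_nil : ∀ γ, toHom γ [] = 1
  apply_singleton : ∀ γ a, toHom γ [a] = homologyClass γ a

namespace MagnusExpansion

variable {n : ℕ}

instance : CoeFun (MagnusExpansion n) fun _ => FreeGroup (Fin n) → Series n := ⟨fun θ => θ.toHom⟩

/-- The coordinates on the set of Magnus expansions: the coefficients of `θ(x_i)` at
the words of length at least `2`. -/
abbrev Index (n : ℕ) : Type := Fin n × {w : List (Fin n) // 2 ≤ w.length}

/-- The model space `T̂_2 ^ n = Hom(H, T̂_2)`, which is also the tangent space of the space of
Magnus expansions at each of its points. -/
abbrev Tangent (n : ℕ) : Type := Index n → ℝ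

/-- The element `∑_w v_{i, w} w` of `T̂_2`. -/
def tangentSeries (v : Tangent n) (i : Fin n) : Series n :=
  fun w => if h : 2 ≤ w.length then v (i, ⟨w, h⟩) else 0

theorem tangentSeries_mem (v : Tangent n) (i : Fin n) : tangentSeries v i ∈ Series.filt n 2 :=
  fun w hw => by simp [tangentSeries, not_le.mpr hw]

theorem ext_generators {θ θ' : MagnusExpansion n}
    (h : ∀ i, θ (FreeGroup.of i) = θ' (FreeGroup.of i)) : θ = θ' := by
  have : θ.toHom = θ'.toHom := FreeGroup.ext_hom _ _ h
  cases θ; cases θ'; cases this; rfl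

/-- The Magnus expansion with `θ(x_i) = 1 + X_i + v_i`, for arbitrary `v_i ∈ T̂_2`. -/
def ofTangent (v : Tangent n) : MagnusExpansion n :=
  let y : Fin n → Series n := fun i => 1 + Series.X i + tangentSeries v i
  have hy0 : ∀ i, y i [] = 1 := fun i => by simp [y, Series.X, tangentSeries]
  have hy1 : ∀ i a, y i [a] = (Pi.single i 1 : Fin n → ℝ) a := fun i a => by
    simp [y, Series.X, tangentSeries, Pi.single_apply]
  let Φ : FreeGroup (Fin n) →* Series n :=
    (Units.coeHom (Series n)).comp
      (FreeGroup.lift fun i => (Series.isUnit_of_nil_eq_one (hy0 i)).unit)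
  have hΦ : ∀ i, Φ (FreeGroup.of i) = y i := fun i => by simp [Φ]
  have key : ∀ γ, Φ γ [] = 1 ∧ ∀ a, Φ γ [a] = homologyClass γ a := fun γ => by
    induction γ using FreeGroup.induction_on with
    | C1 => simp
    | of i => simp [hΦ, hy0, hy1]
    | inv_of i ih =>
      have h : Φ (FreeGroup.of i) * Φ (FreeGroup.of i)⁻¹ = 1 := by rw [← map_mul]; simp
      have h0 : Φ (FreeGroup.of i)⁻¹ [] = 1 := by
        have := congrArg (fun f : Series n => f []) h
        simpa [ih.1] using this
      refine ⟨h0, fun a => ?_⟩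
      have := congrArg (fun f : Series n => f [a]) h
      simp only [Series.mul_cons, Series.mul_nil, Series.tail_apply, ih.1, ih.2, h0,
        Series.one_cons, one_mul, mul_one] at this
      rw [homologyClass_inv, Pi.neg_apply]
      linarith
    | mul γ δ hγ hδ =>
      refine ⟨by simp [hγ.1, hδ.1], fun a => ?_⟩
      simp [hγ.1, hδ.1, hγ.2, hδ.2, add_comm]
  { toHom := Φ
    apply_nil := fun γ => (key γ).1
    apply_singleton := fun γ => (key γ).2 }

theorem ofTangent_of (v : Tangent n) (i : Fin n) :
    ofTangent v (FreeGroup.of i) = 1 + Series.X i + tangentSeries v i := by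
  simp [ofTangent]

/-- The global chart of the space `Θ_n` of Magnus expansions: `θ` is determined by the components in
`T̂_2` of the series `θ(x_i)`, which are arbitrary. It makes `Θ_n` the projective limit of the
affine spaces of Magnus expansions modulo `T̂_{m}`. -/
def chart (n : ℕ) : MagnusExpansion n ≃ Tangent n where
  toFun θ := fun c => θ (FreeGroup.of c.1) c.2.1
  invFun := ofTangent
  left_inv θ := by
    refine ext_generators fun i => ?_
    rw [ofTangent_of]
    ext w
    match w with
    | [] => simp [Series.X, tangentSeries, θ.apply_nil]
    | [a] => simp [Series.X, tangentSeries, θ.apply_singleton, Pi.single_apply]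
    | a :: b :: w => simp [Series.X, tangentSeries]
  right_inv v := by
    funext ⟨i, w, hw⟩
    match w, hw with
    | a :: b :: w, hw => simp [ofTangent_of, Series.X, tangentSeries]


end MagnusExpansion

/-! ### The action of `Aut(F_n)` -/

section action

variable {n : ℕ}

/-- The matrix of the map `|φ| ∈ GL(H)` induced by `φ ∈ Aut(F_n)`, in the basis `X_1, …, X_n`. -/
def homologyMatrix (φ : MulAut (FreeGroup (Fin n))) : Matrix (Fin n) (Fin n) ℝ :=
  fun a b => homologyClass (φ (FreeGroup.of b)) a

theorem homologyClass_map (φ : MulAut (FreeGroup (Fin n))) (γ : FreeGroup (Fin n)) (a : Fin n) :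
    homologyClass (φ γ) a = ∑ b, homologyMatrix φ a b * homologyClass γ b := by
  induction γ using FreeGroup.induction_on with
  | C1 => simp
  | of i => simp [homologyMatrix, Pi.single_apply]
  | inv_of i ih => simpa using ih
  | mul γ δ hγ hδ => simp [hγ, hδ, mul_add, Finset.sum_add_distrib]

/-- Coefficient of the image of a series under the substitution `X_b ↦ ∑ a, M a b X_a`. -/
def substCoeff (M : Matrix (Fin n) (Fin n) ℝ) : List (Fin n) → Series n → ℝ
  | [], z => z []
  | a :: w, z => ∑ b, M a b * substCoeff M w (Series.tail b z)

/-- The endomorphism of the completed tensor algebra induced by a linear endomorphism of `H`, i.e.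
`M ^ {⊗ m}` on `H ^ {⊗ m}`: the substitution `X_b ↦ ∑ a, M a b X_a`. -/
def subst (M : Matrix (Fin n) (Fin n) ℝ) (z : Series n) : Series n := fun w => substCoeff M w z

@[simp] theorem subst_nil (M : Matrix (Fin n) (Fin n) ℝ) (z : Series n) :
    subst M z [] = z [] := rfl

@[simp] theorem subst_cons (M : Matrix (Fin n) (Fin n) ℝ) (z : Series n) (a : Fin n)
    (w : List (Fin n)) : subst M z (a :: w) = ∑ b, M a b * subst M (Series.tail b z) w := rfl

theorem subst_add (M : Matrix (Fin n) (Fin n) ℝ) (y z : Series n) :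
    subst M (y + z) = subst M y + subst M z := by
  ext w
  induction w generalizing y z with
  | nil => simp
  | cons a w ih =>
    simp only [Series.add_apply] at ih
    simp [ih, mul_add, Finset.sum_add_distrib]

theorem subst_smul (M : Matrix (Fin n) (Fin n) ℝ) (c : ℝ) (z : Series n) :
    subst M (c • z) = c • subst M z := by
  ext w
  induction w generalizing z with
  | nil => simp
  | cons a w ih =>
    simp only [Series.smul_apply] at ih
    simp [ih, Finset.mul_sum, mul_left_comm]

theorem subst_one (M : Matrix (Fin n) (Fin n) ℝ) : subst M 1 = 1 := by
  have h0 : subst M 0 = 0 := by simpa using subst_smul M 0 0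
  ext w
  cases w with
  | nil => simp
  | cons a w => simp [h0]

theorem subst_mul (M : Matrix (Fin n) (Fin n) ℝ) (y z : Series n) :
    subst M (y * z) = subst M y * subst M z := by
  ext w
  induction w generalizing y with
  | nil => simp
  | cons a w ih =>
    have htail : Series.tail a (subst M y) = ∑ b, M a b • subst M (Series.tail b y) := by
      ext w
      simp [Series.sum_apply]
    simp only [subst_cons, Series.tail_mul, subst_add, subst_smul, Series.add_apply,
      Series.smul_apply, ih, Series.mul_cons, subst_nil, htail, Finset.sum_mul,
      Series.smul_mul', Series.sum_apply, mul_add, Finset.sum_add_distrib, Finset.mul_sum]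
    congr 1
    exact Finset.sum_congr rfl fun b _ => by ring

/-- The algebra endomorphism of the completed tensor algebra induced by a matrix. -/
def substHom (M : Matrix (Fin n) (Fin n) ℝ) : Series n →* Series n where
  toFun := subst M
  map_one' := subst_one M
  map_mul' := subst_mul M

/-- The action of `Aut(F_n)` on Magnus expansions: `φ · θ = |φ| ∘ θ ∘ φ⁻¹`. -/
def MagnusExpansion.act (φ : MulAut (FreeGroup (Fin n))) (θ : MagnusExpansion n) :
    MagnusExpansion n where
  toHom := (substHom (homologyMatrix φ)).comp (θ.toHom.comp (φ⁻¹ : MulAut _).toMonoidHom)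
  apply_nil γ := by
    simp [substHom, θ.apply_nil]
  apply_singleton γ a := by
    have h := homologyClass_map φ ((φ⁻¹ : MulAut _) γ) a
    rw [MulAut.apply_inv_self] at h
    simp [substHom, θ.apply_singleton, h]

end action

/-! ### The Lie algebra of `IA(T̂)` and the Maurer–Cartan form -/

section lie

variable {n : ℕ}

/-- The Lie algebra of the group `IA(T̂)` of filtration-preserving algebra automorphisms that
induce the identity on `H = T̂_1 / T̂_2`: the filtration-preserving linear endomorphisms `u`
of `T̂` with `u(T̂_1) ⊆ T̂_2` that are derivations. -/
def lieIA (n : ℕ) : Submodule ℝ (Module.End ℝ (Series n)) where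
  carrier := {u | (∀ m, 1 ≤ m → ∀ z ∈ Series.filt n m, u z ∈ Series.filt n m) ∧
    (∀ z ∈ Series.filt n 1, u z ∈ Series.filt n 2) ∧ ∀ y z, u (y * z) = u y * z + y * u z}
  add_mem' := by
    rintro u v ⟨h1, h2, h3⟩ ⟨k1, k2, k3⟩
    refine ⟨fun m hm z hz => ?_, fun z hz => ?_, fun y z => ?_⟩
    · exact Submodule.add_mem _ (h1 m hm z hz) (k1 m hm z hz)
    · exact Submodule.add_mem _ (h2 z hz) (k2 z hz)
    · simp only [LinearMap.add_apply, h3, k3, add_mul, mul_add]; abel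
  zero_mem' := ⟨fun _ _ _ _ => Submodule.zero_mem _, fun _ _ => Submodule.zero_mem _, by simp⟩
  smul_mem' := by
    rintro c u ⟨h1, h2, h3⟩
    refine ⟨fun m hm z hz => ?_, fun z hz => ?_, fun y z => ?_⟩
    · exact Submodule.smul_mem _ _ (h1 m hm z hz)
    · exact Submodule.smul_mem _ _ (h2 z hz)
    · simp only [LinearMap.smul_apply, h3, smul_add, Series.smul_mul', Series.mul_smul']

/-- The exponential `exp(u) = ∑ k, u ^ k / k!` of an endomorphism `u` of `T̂` that raises the
degree: the coefficient at a word of length `m` only involves the terms with `k ≤ m`. -/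
def expSeries (u : Module.End ℝ (Series n)) (z : Series n) : Series n :=
  fun w => ∑ k ∈ Finset.range (w.length + 1), ((k.factorial : ℝ))⁻¹ * (u ^ k) z w

theorem hasDerivAt_expSeries (u : Module.End ℝ (Series n)) (z : Series n) (w : List (Fin n))
    (hw : w ≠ []) : HasDerivAt (fun t : ℝ => expSeries (t • u) z w) (u z w) 0 := by
  have h : ∀ k ∈ Finset.range (w.length + 1),
      HasDerivAt (fun t : ℝ => ((k.factorial : ℝ))⁻¹ * ((t • u) ^ k) z w)
        (if k = 1 then u z w else 0) 0 := by
    intro k _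
    have hfun : (fun t : ℝ => ((k.factorial : ℝ))⁻¹ * ((t • u) ^ k) z w)
        = fun t : ℝ => t ^ k * (((k.factorial : ℝ))⁻¹ * (u ^ k) z w) := by
      funext t
      rw [smul_pow, LinearMap.smul_apply, Series.smul_apply]
      ring
    rw [hfun]
    have := (hasDerivAt_pow k (0 : ℝ)).mul_const (((k.factorial : ℝ))⁻¹ * (u ^ k) z w)
    refine this.congr_deriv ?_
    match k with
    | 0 => simp
    | 1 => simp
    | k + 2 => simp
  have := HasDerivAt.fun_sum h
  refine this.congr_deriv ?_
  have : 0 < w.length := List.length_pos_iff.mpr hw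
  rw [Finset.sum_ite_eq']
  simp [this]

/-- The infinitesimal action of the Lie algebra of `IA(T̂)` on Magnus expansions:
the tangent vector at `t = 0` of the curve `exp(t u) ∘ θ`. -/
def infinitesimalAction (θ : MagnusExpansion n) : lieIA n →ₗ[ℝ] MagnusExpansion.Tangent n where
  toFun u := fun c => deriv (fun t : ℝ => expSeries (t • u.1) (θ (FreeGroup.of c.1)) c.2.1) 0
  map_add' u v := by
    funext c
    have hc : c.2.1 ≠ [] := List.length_pos_iff.mp (by have := c.2.2; omega)
    simp only [(hasDerivAt_expSeries _ _ _ hc).deriv, Pi.add_apply]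
    rfl
  map_smul' r u := by
    funext c
    have hc : c.2.1 ≠ [] := List.length_pos_iff.mp (by have := c.2.2; omega)
    simp only [(hasDerivAt_expSeries _ _ _ hc).deriv, Pi.smul_apply]
    rfl

theorem infinitesimalAction_apply (θ : MagnusExpansion n) (u : lieIA n)
    (c : MagnusExpansion.Index n) :
    infinitesimalAction θ u c = u.1 (θ (FreeGroup.of c.1)) c.2.1 := by
  have hc : c.2.1 ≠ [] := List.length_pos_iff.mp (by have := c.2.2; omega)
  exact (hasDerivAt_expSeries _ _ _ hc).deriv

namespace Series

theorem X_mem_filt (i : Fin n) : X i ∈ filt n 1 := by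
  intro w hw
  have : w = [] := List.length_eq_zero_iff.mp (by omega)
  simp [X, this]

theorem tail_X (a i : Fin n) : tail a (X i) = (if a = i then 1 else 0 : ℝ) • (1 : Series n) := by
  ext w
  by_cases h : a = i <;> simp [X, one_apply, h]

theorem X_mul_cons (i : Fin n) (f : Series n) (a : Fin n) (w : List (Fin n)) :
    (X i * f) (a :: w) = if a = i then f w else 0 := by
  rw [mul_cons, tail_X, smul_mul', one_mul]
  by_cases h : a = i <;> simp [X, h]

/-- `z = z_∅ + ∑ i, X_i z_i`. -/
theorem eq_add_sum_X_mul_tail (z : Series n) :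
    z = z [] • (1 : Series n) + ∑ i, X i * tail i z := by
  ext w
  cases w with
  | nil => simp [sum_apply, X]
  | cons a w => simp [sum_apply, X_mul_cons, -mul_cons]

end Series

theorem lieIA_apply_one (u : lieIA n) : u.1 1 = 0 := by
  have := u.2.2.2 1 1
  simpa using this

theorem lieIA_apply (u : lieIA n) (z : Series n) :
    u.1 z = ∑ i, (u.1 (Series.X i) * Series.tail i z + Series.X i * u.1 (Series.tail i z)) := by
  conv_lhs => rw [Series.eq_add_sum_X_mul_tail z]
  rw [map_add, map_smul, lieIA_apply_one, smul_zero, zero_add, map_sum]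
  exact Finset.sum_congr rfl fun i _ => u.2.2.2 _ _

/-- If `u(H) ⊆ T̂_{k+1}` then `u(T̂_m) ⊆ T̂_{m+k}`. -/
theorem lieIA_apply_mem (u : lieIA n) {k : ℕ}
    (hu : ∀ i, u.1 (Series.X i) ∈ Series.filt n (k + 1)) (m : ℕ) {z : Series n}
    (hz : z ∈ Series.filt n m) : u.1 z ∈ Series.filt n (m + k) := by
  intro w hw
  induction w generalizing m z with
  | nil =>
    rw [lieIA_apply, Series.sum_apply]
    refine Finset.sum_eq_zero fun i _ => ?_
    simp [hu i [] (by simp), Series.X]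
  | cons a w ih =>
    rw [lieIA_apply, Series.sum_apply]
    refine Finset.sum_eq_zero fun i _ => ?_
    have htail : Series.tail i z ∈ Series.filt n (m - 1) := by
      intro w hw
      exact hz _ (by simp; omega)
    rw [Series.add_apply, Series.mul_mem_filt (hu i) htail _ (by omega), zero_add,
      Series.X_mul_cons, ih (m - 1) htail (by simp at hw; omega)]
    simp

theorem infinitesimalAction_injective (θ : MagnusExpansion n) :
    Function.Injective (infinitesimalAction θ) := by
  rw [injective_iff_map_eq_zero]
  intro u hu
  have h0 : ∀ i w, 2 ≤ w.length → u.1 (θ (FreeGroup.of i)) w = 0 := by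
    intro i w hw
    rw [← infinitesimalAction_apply θ u (i, ⟨w, hw⟩), hu]; rfl
  have hθ : ∀ i, θ (FreeGroup.of i) =
      1 + Series.X i + MagnusExpansion.tangentSeries (MagnusExpansion.chart n θ) i := by
    intro i
    rw [← MagnusExpansion.ofTangent_of]
    exact congrArg (fun θ : MagnusExpansion n => θ (FreeGroup.of i))
      ((MagnusExpansion.chart n).symm_apply_apply θ).symm
  have hstep : ∀ k i, u.1 (Series.X i) ∈ Series.filt n (k + 2) := by
    intro k
    induction k with
    | zero => exact fun i => u.2.2.1 _ (Series.X_mem_filt i)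
    | succ k ih =>
      intro i w hw
      by_cases hw2 : w.length < 2
      · exact u.2.2.1 _ (Series.X_mem_filt i) w hw2
      · have h1 := h0 i w (by omega)
        have h2 := lieIA_apply_mem u (k := k + 1) ih 2
          (MagnusExpansion.tangentSeries_mem (MagnusExpansion.chart n θ) i) w (by omega)
        rw [hθ, map_add, map_add, lieIA_apply_one, zero_add, Series.add_apply, h2, add_zero] at h1
        exact h1
  apply Subtype.ext
  ext z w
  have := lieIA_apply_mem u (k := w.length + 1) (hstep w.length) 0 (z := z)
    (fun w hw => absurd hw (Nat.not_lt_zero _)) w (by omega)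
  simpa using this

/-- Coefficient of the image of a series under the derivation with `X_i ↦ h_i`. -/
def derivCoeff (h : Fin n → Series n) : List (Fin n) → Series n → ℝ
  | [], _ => 0
  | a :: w, z => (∑ i, h i * Series.tail i z) (a :: w) + derivCoeff h w (Series.tail a z)

theorem derivCoeff_add (h : Fin n → Series n) (w : List (Fin n)) (y z : Series n) :
    derivCoeff h w (y + z) = derivCoeff h w y + derivCoeff h w z := by
  induction w generalizing y z with
  | nil => simp [derivCoeff]
  | cons a w ih =>
    simp only [derivCoeff, Series.tail_add, mul_add, Finset.sum_add_distrib, Series.add_apply, ih]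
    ring

theorem derivCoeff_smul (h : Fin n → Series n) (w : List (Fin n)) (c : ℝ) (z : Series n) :
    derivCoeff h w (c • z) = c * derivCoeff h w z := by
  induction w generalizing z with
  | nil => simp [derivCoeff]
  | cons a w ih =>
    simp only [derivCoeff, Series.tail_smul, Series.mul_smul', ← Finset.smul_sum,
      Series.smul_apply, ih]
    ring

theorem derivCoeff_sub (g h : Fin n → Series n) (w : List (Fin n)) (z : Series n) :
    derivCoeff (g - h) w z = derivCoeff g w z - derivCoeff h w z := by
  induction w generalizing z with
  | nil => simp [derivCoeff]
  | cons a w ih =>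
    simp only [derivCoeff, Pi.sub_apply, sub_mul, Finset.sum_sub_distrib, Series.sub_apply, ih]
    ring

/-- The derivation of `T̂` with `X_i ↦ h_i`. -/
def derivEnd (h : Fin n → Series n) : Module.End ℝ (Series n) where
  toFun z := fun w => derivCoeff h w z
  map_add' y z := by ext w; exact derivCoeff_add h w y z
  map_smul' c z := by ext w; exact derivCoeff_smul h w c z

theorem derivEnd_nil (h : Fin n → Series n) (z : Series n) : derivEnd h z [] = 0 := rfl

theorem derivEnd_cons (h : Fin n → Series n) (z : Series n) (a : Fin n) (w : List (Fin n)) :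
    derivEnd h z (a :: w)
      = (∑ i, h i * Series.tail i z) (a :: w) + derivEnd h (Series.tail a z) w := rfl

theorem derivEnd_sub (g h : Fin n → Series n) (z : Series n) :
    derivEnd (g - h) z = derivEnd g z - derivEnd h z := by
  ext w; exact derivCoeff_sub g h w z

theorem derivEnd_mem {h : Fin n → Series n} {k : ℕ} (hh : ∀ i, h i ∈ Series.filt n (k + 1))
    (m : ℕ) {z : Series n} (hz : z ∈ Series.filt n m) :
    derivEnd h z ∈ Series.filt n (m + k) := by
  intro w hw
  induction w generalizing m z with
  | nil => rfl
  | cons a w ih =>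
    have htail : ∀ i, Series.tail i z ∈ Series.filt n (m - 1) := by
      intro i w hw
      exact hz _ (by simp; omega)
    rw [derivEnd_cons, ih (m - 1) (htail a) (by simp at hw; omega), add_zero, Series.sum_apply]
    exact Finset.sum_eq_zero fun i _ => Series.mul_mem_filt (hh i) (htail i) _ (by omega)

theorem derivEnd_mul {h : Fin n → Series n} (hh : ∀ i, h i [] = 0) (y z : Series n) :
    derivEnd h (y * z) = derivEnd h y * z + y * derivEnd h z := by
  ext w
  induction w generalizing y with
  | nil => simp [derivEnd_nil]
  | cons a w ih =>
    have htail : Series.tail a (derivEnd h y)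
        = Series.tail a (∑ i, h i * Series.tail i y) + derivEnd h (Series.tail a y) := by
      ext w; rfl
    have hS0 : (∑ i, h i * Series.tail i y) [] = 0 := by simp [Series.sum_apply, hh]
    have hS : ∑ i, h i * Series.tail i (y * z)
        = y [] • (∑ i, h i * Series.tail i z) + (∑ i, h i * Series.tail i y) * z := by
      simp only [Series.tail_mul, mul_add, Series.mul_smul', Finset.sum_add_distrib,
        Finset.smul_sum, Finset.sum_mul, mul_assoc]
    rw [derivEnd_cons, hS, Series.tail_mul, map_add, map_smul, Series.add_apply,
      Series.add_apply, ih, Series.add_apply, Series.add_apply, Series.mul_cons,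
      Series.mul_cons, Series.mul_cons, htail, add_mul, Series.add_apply, hS0, derivEnd_nil,
      derivEnd_cons, Series.smul_apply, Series.smul_apply]
    ring

theorem derivEnd_one (h : Fin n → Series n) : derivEnd h 1 = 0 := by
  ext w
  cases w with
  | nil => rfl
  | cons a w => simp [derivEnd_cons]

theorem derivEnd_X {h : Fin n → Series n} (hh : ∀ i, h i [] = 0) (i : Fin n) :
    derivEnd h (Series.X i) = h i := by
  ext w
  cases w with
  | nil => exact (hh i).symm
  | cons a w =>
    rw [derivEnd_cons, Series.tail_X, map_smul, derivEnd_one]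
    have : ∀ j, (h j * Series.tail j (Series.X i)) (a :: w) = if j = i then h i (a :: w) else 0 := by
      intro j
      rw [Series.tail_X, Series.mul_smul', mul_one, Series.smul_apply]
      by_cases hj : j = i
      · simp [hj]
      · simp [hj]
    simp [Series.sum_apply, this, -Series.mul_cons]

theorem derivEnd_mem_lieIA {h : Fin n → Series n} (hh : ∀ i, h i ∈ Series.filt n 2) :
    derivEnd h ∈ lieIA n := by
  refine ⟨fun m _ z hz => ?_, fun z hz => derivEnd_mem (k := 1) hh 1 hz, ?_⟩
  · exact Series.filt_anti (Nat.le_succ m) (derivEnd_mem (k := 1) hh m hz)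
  · exact derivEnd_mul fun i => hh i [] (by simp)

/-- Given `t_i, y_i ∈ T̂_2` there are `h_i ∈ T̂_2` with `h_i + D_h(y_i) = t_i`. -/
theorem exists_add_derivEnd_eq (t y : Fin n → Series n) (ht : ∀ i, t i ∈ Series.filt n 2)
    (hy : ∀ i, y i ∈ Series.filt n 2) :
    ∃ h : Fin n → Series n, (∀ i, h i ∈ Series.filt n 2) ∧ ∀ i, h i + derivEnd h (y i) = t i := by
  let H : ℕ → Fin n → Series n :=
    fun k => Nat.rec (0 : Fin n → Series n) (fun _ g i => t i - derivEnd g (y i)) k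
  have H0 : H 0 = 0 := rfl
  have HS : ∀ k i, H (k + 1) i = t i - derivEnd (H k) (y i) := fun _ _ => rfl
  have hstep : ∀ k i, (H (k + 1) - H k) i ∈ Series.filt n (k + 2) := by
    intro k
    induction k with
    | zero =>
      intro i
      have h1 : derivEnd (H 0) (y i) = 0 := by
        rw [H0]
        simpa using derivEnd_sub (0 : Fin n → Series n) 0 (y i)
      rw [Pi.sub_apply, HS, h1, H0]
      simpa using ht i
    | succ k ih =>
      intro i
      have h1 : (H (k + 1 + 1) - H (k + 1)) i = -derivEnd (H (k + 1) - H k) (y i) := by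
        rw [Pi.sub_apply, HS (k + 1), HS k, derivEnd_sub]; abel
      rw [h1]
      refine Submodule.neg_mem _ ?_
      have := derivEnd_mem (k := k + 1) ih 2 (hy i)
      exact Series.filt_anti (by omega) this
  have hdiff : ∀ k l, k ≤ l → ∀ i, (H l - H k) i ∈ Series.filt n (k + 2) := by
    intro k l hkl
    induction l, hkl using Nat.le_induction with
    | base => intro i; simp
    | succ l hkl ih =>
      intro i
      have : (H (l + 1) - H k) i = (H (l + 1) - H l) i + (H l - H k) i := by simp
      rw [this]
      exact Submodule.add_mem _ (Series.filt_anti (by omega) (hstep l i)) (ih i)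
  let h : Fin n → Series n := fun i w => H w.length i w
  have hH : ∀ k i, (h - H k) i ∈ Series.filt n (k + 2) := by
    intro k i w hw
    rw [Pi.sub_apply, Series.sub_apply]
    change H w.length i w - H k i w = 0
    rcases le_total w.length k with hle | hle
    · have := hdiff _ _ hle i w (by omega)
      rw [Pi.sub_apply, Series.sub_apply] at this
      linarith
    · have := hdiff _ _ hle i w (by omega)
      rwa [Pi.sub_apply, Series.sub_apply] at this
  refine ⟨h, fun i => ?_, fun i => ?_⟩
  · have := hH 0 i
    simpa [H0] using this
  · ext w
    have h1 := hH (w.length + 1) i w (by omega)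
    have h2 := derivEnd_mem (k := w.length + 1) (hH w.length) 2 (hy i) w (by omega)
    rw [derivEnd_sub, Series.sub_apply] at h2
    rw [Pi.sub_apply, Series.sub_apply, HS, Series.sub_apply] at h1
    rw [Series.add_apply]
    linarith

theorem infinitesimalAction_surjective (θ : MagnusExpansion n) :
    Function.Surjective (infinitesimalAction θ) := by
  intro v
  obtain ⟨h, hh, hsol⟩ := exists_add_derivEnd_eq (MagnusExpansion.tangentSeries v)
    (MagnusExpansion.tangentSeries (MagnusExpansion.chart n θ))
    (MagnusExpansion.tangentSeries_mem v) (MagnusExpansion.tangentSeries_mem _)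
  refine ⟨⟨derivEnd h, derivEnd_mem_lieIA hh⟩, ?_⟩
  funext ⟨i, w, hw⟩
  have hθ : θ (FreeGroup.of i) =
      1 + Series.X i + MagnusExpansion.tangentSeries (MagnusExpansion.chart n θ) i := by
    rw [← MagnusExpansion.ofTangent_of]
    exact congrArg (fun θ : MagnusExpansion n => θ (FreeGroup.of i))
      ((MagnusExpansion.chart n).symm_apply_apply θ).symm
  rw [infinitesimalAction_apply]
  change derivEnd h (θ (FreeGroup.of i)) w = _
  rw [hθ, map_add, map_add, derivEnd_one, zero_add,
    derivEnd_X (fun i => hh i [] (by simp)), hsol]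
  simp [MagnusExpansion.tangentSeries, hw]

/-- The Maurer–Cartan form `η` of the action of `IA(T̂)` on the space of Magnus expansions: at each
point, the inverse of the trivialization `u ↦ d/dt exp(t u) ∘ θ` of the tangent space. -/
def maurerCartan (θ : MagnusExpansion n) : MagnusExpansion.Tangent n ≃ₗ[ℝ] lieIA n :=
  (LinearEquiv.ofBijective (infinitesimalAction θ)
    ⟨infinitesimalAction_injective θ, infinitesimalAction_surjective θ⟩).symm

end lie

/-! ### Differential forms on the space of Magnus expansions -/

section forms



variable {n : ℕ}

open MagnusExpansion (Index Tangent chart)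

/-- A (not necessarily smooth) scalar differential form of degree `q` on the space of Magnus
expansions, all of whose tangent spaces are identified with `Tangent n` by the global chart. -/
abbrev Form (n q : ℕ) : Type := MagnusExpansion n → Tangent n [⋀^Fin q]→ₗ[ℝ] ℝ

/-- Smooth forms. The space of Magnus expansions is the projective limit of finite-dimensional
manifolds, so its smooth forms are the pullbacks of smooth forms along the projections to finitely
many of the coordinates. -/
def IsSmooth {q : ℕ} (ω : Form n q) : Prop :=
  ∃ (s : Finset (Index n)) (β : (s → ℝ) → (s → ℝ) [⋀^Fin q]→L[ℝ] ℝ), ContDiff ℝ ((⊤ : ℕ∞) : WithTop ℕ∞) β ∧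
    ∀ θ v, ω θ v = β (fun c => chart n θ c) (fun k c => v k c)

open Classical in
/-- The derivative `v ↦ ∂_v ω` of a form in the global chart (`0` if it does not exist). -/
def formDeriv {q : ℕ} (ω : Form n q) (θ : MagnusExpansion n) :
    Tangent n →ₗ[ℝ] Tangent n [⋀^Fin q]→ₗ[ℝ] ℝ :=
  if h : ∃ L : Tangent n →ₗ[ℝ] Tangent n [⋀^Fin q]→ₗ[ℝ] ℝ, ∀ v u,
      HasLineDerivAt ℝ (fun x => ω ((chart n).symm x) u) (L v u) (chart n θ) v
  then h.choose else 0

/-- The exterior derivative,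
`(dω)(v_0, …, v_q) = ∑ k, (-1) ^ k ∂_{v_k} ω (v_0, …, v_{k-1}, v_{k+1}, …, v_q)`. -/
def formD {q : ℕ} (ω : Form n q) : Form n (q + 1) :=
  fun θ => AlternatingMap.alternatizeUncurryFin (formDeriv ω θ)

/-- On a smooth form, the exterior derivative is the pullback of the usual exterior derivative. -/
theorem formD_eq_extDeriv {q : ℕ} {ω : Form n q} {s : Finset (Index n)}
    {β : (s → ℝ) → (s → ℝ) [⋀^Fin q]→L[ℝ] ℝ} (hβ : ContDiff ℝ ((⊤ : ℕ∞) : WithTop ℕ∞) β)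
    (hω : ∀ θ v, ω θ v = β (fun c => chart n θ c) (fun k c => v k c))
    (θ : MagnusExpansion n) (v : Fin (q + 1) → Tangent n) :
    formD ω θ v = extDeriv β (fun c => chart n θ c) (fun k c => v k c) := by
  let π : Tangent n →ₗ[ℝ] (s → ℝ) := LinearMap.funLeft ℝ ℝ (Subtype.val : s → Index n)
  have hd : DifferentiableAt ℝ β (π (chart n θ)) := hβ.differentiable (by simp) _
  let L : Tangent n →ₗ[ℝ] Tangent n [⋀^Fin q]→ₗ[ℝ] ℝ :=
    { toFun := fun v => ((fderiv ℝ β (π (chart n θ)) (π v)).toAlternatingMap).compLinearMap π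
      map_add' := fun v w => by ext u; simp
      map_smul' := fun c v => by ext u; simp }
  have hL : ∀ v u, HasLineDerivAt ℝ (fun x => ω ((chart n).symm x) u) (L v u) (chart n θ) v := by
    intro v u
    have hfun : (fun x => ω ((chart n).symm x) u) = fun x => β (π x) (fun k => π (u k)) := by
      funext x
      rw [hω, Equiv.apply_symm_apply]; rfl
    have h1 : HasLineDerivAt ℝ β (fderiv ℝ β (π (chart n θ)) (π v)) (π (chart n θ)) (π v) :=
      hd.hasFDerivAt.hasLineDerivAt _
    have h2 : HasDerivAt (fun t : ℝ => β (π (chart n θ) + t • π v))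
      (fderiv ℝ β (π (chart n θ)) (π v)) 0 := h1
    rw [hfun]
    change HasDerivAt (fun t : ℝ => β (π (chart n θ + t • v)) (fun k => π (u k))) _ 0
    have h3 := (ContinuousAlternatingMap.apply ℝ (s → ℝ) ℝ (fun k => π (u k))).hasFDerivAt
      |>.comp_hasDerivAt (0 : ℝ) h2
    simpa [L, Function.comp_def] using h3
  have hex : ∃ L : Tangent n →ₗ[ℝ] Tangent n [⋀^Fin q]→ₗ[ℝ] ℝ, ∀ v u,
      HasLineDerivAt ℝ (fun x => ω ((chart n).symm x) u) (L v u) (chart n θ) v := ⟨L, hL⟩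
  have hform : formDeriv ω θ = L := by
    rw [formDeriv, dif_pos hex]
    ext v u
    exact (hex.choose_spec v u).unique (hL v u)
  rw [formD, hform, AlternatingMap.alternatizeUncurryFin_apply,
    extDeriv, ContinuousAlternatingMap.alternatizeUncurryFin_apply]
  rfl

/-- The wedge product of a `1`-form and a `q`-form:
`(α ∧ ω)(v_0, …, v_q) = ∑ k, (-1) ^ k α(v_k) ω(v_0, …, v_{k-1}, v_{k+1}, …, v_q)`. -/
def wedge {q : ℕ} (α : Form n 1) (ω : Form n q) : Form n (q + 1) := fun θ =>
  AlternatingMap.alternatizeUncurryFin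
    (LinearMap.smulRight ((AlternatingMap.ofSubsingleton ℝ (Tangent n) ℝ (0 : Fin 1)).symm (α θ))
      (ω θ))

/-- Inhomogeneous forms with values in `Hom(H, T̂)`: `ω i w q` is the coefficient at the word `w`,
in degree `q`, of the value at `X_i`. The forms with values in `H^* ⊗ H ^ {⊗ m}` are
those whose coefficients at words of length other than `m` vanish. -/
abbrev TensorForm (n : ℕ) : Type := Fin n → List (Fin n) → (q : ℕ) → Form n q

/-- The exterior derivative of a tensor-valued form. -/
def tensorD (ω : TensorForm n) : TensorForm n := fun i w q =>
  match q with
  | 0 => 0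
  | q + 1 => formD (ω i w q)

/-- The component `η_p`, with values in `H^* ⊗ H ^ {⊗ (p + 1)} = Hom(H, H ^ {⊗ (p + 1)})`, of the
Maurer–Cartan form. -/
def eta (n p : ℕ) (i : Fin n) (w : List (Fin n)) : Form n 1 := fun θ =>
  AlternatingMap.ofSubsingleton ℝ (Tangent n) ℝ (0 : Fin 1)
    { toFun := fun v => if w.length = p + 1 then (maurerCartan θ v).1 (Series.X i) w else 0
      map_add' := fun u v => by split_ifs <;> simp
      map_smul' := fun c v => by split_ifs <;> simp }

/-- The Maurer–Cartan component `η_p` as an inhomogeneous form, concentrated in degree `1`. -/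
def etaTensor (n p : ℕ) : TensorForm n := fun i w q =>
  match q with
  | 1 => eta n p i w
  | _ => 0

/-- The product `(1 ^ {⊗ a} ⊗ η_p ⊗ 1 ^ {⊗ b}) ω` for a form `ω` with values in
`H^* ⊗ H ^ {⊗ (a + 1 + b)}`: wedge product of forms and composition of linear maps. The
coefficient at a word `u₁ u₂ u₃` with `u₁, u₂, u₃` of length `a, p + 1, b` is
`∑ j, (η_p)_{j, u₂} ∧ ω_{u₁ j u₃}`. -/
def insertEta (a p b : ℕ) (ω : TensorForm n) : TensorForm n := fun i w q =>
  match q with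
  | 0 => 0
  | q + 1 =>
    if w.length = a + (p + 1) + b then
      ∑ j, wedge (eta n p j ((w.drop a).take (p + 1)))
        (ω i (w.take a ++ j :: w.drop (a + (p + 1))) q)
    else 0

/-- The differential at `θ` of the diffeomorphism `θ ↦ φ · θ`. -/
def actDeriv (φ : MulAut (FreeGroup (Fin n))) (θ : MagnusExpansion n) (v : Tangent n) :
    Tangent n :=
  fun c => lineDeriv ℝ (fun x => chart n (MagnusExpansion.act φ ((chart n).symm x)) c)
    (chart n θ) v

/-- `Aut(F_n)`-invariance of a tensor-valued form: `L_φ^* ω = φ ∘ ω` for every `φ`, where `L_φ` is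
the action on Magnus expansions, and `φ` acts on `Hom(H, T̂)` by `u ↦ |φ| ∘ u ∘ |φ|⁻¹`. -/
def IsInvariant (ω : TensorForm n) : Prop :=
  ∀ (φ : MulAut (FreeGroup (Fin n))) (θ : MagnusExpansion n) (q : ℕ) (v : Fin q → Tangent n)
    (i : Fin n) (w : List (Fin n)),
    ω i w q (MagnusExpansion.act φ θ) (fun k => actDeriv φ θ (v k)) =
      ∑ j, homologyMatrix φ⁻¹ j i * subst (homologyMatrix φ) (fun u => ω j u q θ v) w

/-- Membership in `(Ω^*(Θ_n) ⊗ H^* ⊗ H ^ {⊗ (p + 1)}) ^ {Aut(F_n)}`. -/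
structure IsInvariantForm (p : ℕ) (ω : TensorForm n) : Prop where
  length_eq : ∀ i w q, w.length ≠ p + 1 → ω i w q = 0
  smooth : ∀ i w q, IsSmooth (ω i w q)
  invariant : IsInvariant ω

end forms

/-! ### The cells of the Stasheff associahedron -/

section cells

/-- The pair `(l, r)` stands for a pair of parentheses around the letters `l, l + 1, …, r`. The
letters of the word are numbered `0, 1, …, p`. A set `B` of pairs is a meaningful way of inserting
one set of parentheses into the word if it contains the outermost pair, if each pair encloses at
least two letters, and if any two pairs are disjoint or nested. -/
def IsCell (p : ℕ) (B : Finset (ℕ × ℕ)) : Prop :=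
  (0, p) ∈ B ∧ (∀ I ∈ B, I.1 < I.2 ∧ I.2 ≤ p) ∧
    ∀ I ∈ B, ∀ J ∈ B, I.2 < J.1 ∨ J.2 < I.1 ∨ (I.1 ≤ J.1 ∧ J.2 ≤ I.2) ∨ (J.1 ≤ I.1 ∧ I.2 ≤ J.2)

instance (p : ℕ) (B : Finset (ℕ × ℕ)) : Decidable (IsCell p B) := by
  unfold IsCell; infer_instance

/-- For a pair of parentheses `I` in `B` with `m + 1` factors, the `m` places between consecutive
factors: the place `x` is the one between the letters `x` and `x + 1`. So the closed cell of `B`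
is the product over `I ∈ B` of the associahedra `K_{m + 1}` with `m = (gaps B I).card`. -/
def gaps (B : Finset (ℕ × ℕ)) (I : ℕ × ℕ) : Finset ℕ :=
  (Finset.Ico I.1 I.2).filter fun x =>
    ∀ J ∈ B, J ≠ I → I.1 ≤ J.1 → J.2 ≤ I.2 → ¬(J.1 ≤ x ∧ x < J.2)

/-- The dimension `m - 1` of the factor `K_{m + 1}` belonging to `I`. -/
def factorDim (B : Finset (ℕ × ℕ)) (I : ℕ × ℕ) : ℕ := (gaps B I).card - 1

/-- The order of the pairs of parentheses by the position of the opening parenthesis. -/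
def Before (I J : ℕ × ℕ) : Prop := I.1 < J.1 ∨ (I.1 = J.1 ∧ J.2 < I.2)

instance (I J : ℕ × ℕ) : Decidable (Before I J) := by unfold Before; infer_instance

/-- Oriented cells of `K_{p + 1}`: a cell and a sign. The sign `1` stands for the orientation of the
product of the associahedra belonging to the pairs of parentheses, each of them with its
standard orientation, and taken in the order `Before`. -/
abbrev OrientedCell (p : ℕ) : Type := {B : Finset (ℕ × ℕ) // IsCell p B} × ℤˣ

/-- The cell with the opposite orientation. -/
def OrientedCell.opposite {p : ℕ} (w : OrientedCell p) : OrientedCell p := (w.1, -w.2)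

/-- The number of pairs of parentheses; the dimension of the cell is `p - degree`. -/
def OrientedCell.degree {p : ℕ} (w : OrientedCell p) : ℕ := w.1.1.card

/-- The top cell `± K_{p + 1}`. -/
def topCell (p : ℕ) (hp : 1 ≤ p) (ε : ℤˣ) : OrientedCell p :=
  (⟨{(0, p)}, by simp [IsCell]; omega⟩, ε)

/-- The position of a pair of parentheses after the letter `a` was replaced by `q + 1` letters. -/
def shiftPair (a q : ℕ) (I : ℕ × ℕ) : ℕ × ℕ :=
  (if I.1 ≤ a then I.1 else I.1 + q, if I.2 < a then I.2 else I.2 + q)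

/-- The parenthesization obtained by replacing the letter `a` by `q + 1` letters in parentheses. -/
def insertPair (a q : ℕ) (B : Finset (ℕ × ℕ)) : Finset (ℕ × ℕ) :=
  insert (a, a + q) (B.image (shiftPair a q))

theorem isCell_insertPair {a b q : ℕ} (hq : 1 ≤ q) {B : Finset (ℕ × ℕ)} (hB : IsCell (a + b) B) :
    IsCell (a + b + q) (insertPair a q B) := by
  obtain ⟨h0, h1, h2⟩ := hB
  refine ⟨?_, ?_, ?_⟩
  · refine Finset.mem_insert_of_mem (Finset.mem_image.mpr ⟨_, h0, ?_⟩)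
    simp [shiftPair]
  · intro I hI
    rcases Finset.mem_insert.mp hI with rfl | hI
    · simp only; omega
    · obtain ⟨J, hJ, rfl⟩ := Finset.mem_image.mp hI
      have := h1 J hJ
      simp only [shiftPair]; split_ifs <;> omega
  · intro I hI I' hI'
    rcases Finset.mem_insert.mp hI with rfl | hI <;> rcases Finset.mem_insert.mp hI' with rfl | hI'
    · simp
    · obtain ⟨J, hJ, rfl⟩ := Finset.mem_image.mp hI'
      have := h1 J hJ
      simp only [shiftPair]; split_ifs <;> omega
    · obtain ⟨J, hJ, rfl⟩ := Finset.mem_image.mp hI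
      have := h1 J hJ
      simp only [shiftPair]; split_ifs <;> omega
    · obtain ⟨J, hJ, rfl⟩ := Finset.mem_image.mp hI
      obtain ⟨J', hJ', rfl⟩ := Finset.mem_image.mp hI'
      have := h1 J hJ
      have := h1 J' hJ'
      have := h2 J hJ J' hJ'
      simp only [shiftPair]; split_ifs <;> omega

/-- The image `∂_{a, q, b}(w × K_{q + 1})` of the product orientation under the face map
`∂_{a, q, b} : K_{a + b + 1} × K_{q + 1} → K_{a + b + q + 1}`. The new factor `K_{q + 1}`, of
dimension `q - 1`, is the last one; the sign moves it to its place in the order `Before`. -/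
def faceCell (a q b : ℕ) (hq : 1 ≤ q) (w : OrientedCell (a + b)) : OrientedCell (a + b + q) :=
  (⟨insertPair a q w.1.1, isCell_insertPair hq w.1.2⟩,
    w.2 * (-1) ^ ((q - 1) * ∑ L ∈ (insertPair a q w.1.1).filter (fun L => Before (a, a + q) L),
      factorDim (insertPair a q w.1.1) L))

/-- The pairs of parentheses that can be added to the cell `B` of `K_{p + 1}` directly inside its
pair `J`, i.e. the facets of the factor belonging to `J`. -/
def newPairs (p : ℕ) (B : Finset (ℕ × ℕ)) (J : ℕ × ℕ) : Finset (ℕ × ℕ) :=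
  (Finset.Icc J.1 J.2 ×ˢ Finset.Icc J.1 J.2).filter fun I =>
    I ∉ B ∧ IsCell p (insert I B) ∧ ∀ L ∈ B, L.1 ≤ I.1 → I.2 ≤ L.2 → L.1 ≤ J.1 ∧ J.2 ≤ L.2

/-- The incidence number of the cell `insert I B` in the boundary of the cell `B`, where
`I ∈ newPairs p B J`. Let `K_{m + 1}` be the factor belonging to `J`, and let `I` enclose `s + 1` of
its factors, after the first `k`. The first summand of the exponent is the
Leibniz sign, the second one is the sign of `∂_{k, s, m-k-s}(K_{m-s+1} × K_{s+1})` in the boundary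
`∂K_{m+1} = ∑ (-1)^{(s+1)(m+k)+k+1} ∂_{k, s, m-k-s}(K_{m-s+1} × K_{s+1})`, and the third one moves
`K_{s+1}` from its place directly after `K_{m-s+1}` to its place in the order `Before`. -/
def incidence (B : Finset (ℕ × ℕ)) (J I : ℕ × ℕ) : ℤˣ :=
  let m := (gaps B J).card
  let k := ((gaps B J).filter fun x => x < I.1).card
  let s := ((gaps B J).filter fun x => I.1 ≤ x ∧ x < I.2).card
  (-1) ^ ((∑ L ∈ B.filter (fun L => Before L J), factorDim B L) +
    ((s + 1) * (m + k) + k + 1) +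
    (s - 1) * ∑ L ∈ B.filter (fun L => Before J L ∧ Before L I), factorDim B L)

/-- The cellular coboundary `(δf)(w) = f(∂w)` of a cochain on the oriented cells. -/
def coboundary {p : ℕ} {A : Type*} [AddCommMonoid A] (f : OrientedCell p → A)
    (w : OrientedCell p) : A :=
  ∑ J ∈ w.1.1, ∑ I ∈ (newPairs p w.1.1 J).attach,
    f (⟨insert I.1 w.1.1, (Finset.mem_filter.mp I.2).2.2.1⟩, w.2 * incidence w.1.1 J I.1)

end cells

/-! ### The cochain `Y` and the double complex -/

section assembly

variable {n : ℕ}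

/-- The recursive rule that assembles the Maurer–Cartan components along parenthesizations. The
second clause is imposed for every presentation of an oriented cell as a face
`∂_{a, q, b}(w × K_{q + 1})`, i.e. for every choice of an innermost pair of parentheses. -/
structure IsAssembly (Y : (p : ℕ) → OrientedCell p → TensorForm n) : Prop where
  top : ∀ (p : ℕ) (hp : 1 ≤ p),
    Y p (topCell p hp 1) = etaTensor n p ∧ Y p (topCell p hp (-1)) = -etaTensor n p
  face : ∀ (a q b : ℕ) (hq : 1 ≤ q) (w : OrientedCell (a + b)),
    Y (a + b + q) (faceCell a q b hq w) =
      (-1 : ℝ) ^ (a + (q + 1) * b + w.degree) • insertEta a q b (Y (a + b) w)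

/-- The cochains of total degree `m` of the double complex
`C^*(K_{p + 1}; (Ω^*(Θ_n) ⊗ H^* ⊗ H ^ {⊗ (p + 1)}) ^ {Aut(F_n)})`: the values on a cell of
dimension `p - degree w` are forms of degree `m - (p - degree w)`. -/
structure IsTotalCochain (p m : ℕ) (f : OrientedCell p → TensorForm n) : Prop where
  opposite : ∀ w, f w.opposite = -f w
  degree : ∀ w i u q, p + q ≠ m + w.degree → f w i u q = 0
  mem : ∀ w, IsInvariantForm p (f w)

/-- The total differential of the double complex: the commuting differentials `d` and `δ` of
`C^j(K_{p + 1}; Ω^q)` are assembled to `D = (-1) ^ q (d + δ)`, so that `D ∘ D = 0`. Note that `d`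
ends in form degree `q` if it starts in form degree `q - 1`. -/
def totalD {p : ℕ} (f : OrientedCell p → TensorForm n) : OrientedCell p → TensorForm n :=
  fun w i u q => (-1 : ℝ) ^ q • (coboundary f w i u q - tensorD (f w) i u q)

end assembly

end

end MagnusForms

/-! The Maurer–Cartan form is characterised by `η_θ(v)(θ(x_i)) = v_i`, a constant in the chart.
Differentiating this identity and antisymmetrising gives `dη = η ∧ η` (`maurerCartan_equation`). In
components, `dη_q` is the sum of the `(1^{⊗k} ⊗ η_s ⊗ 1^{⊗t}) η_{q-s}` over `k + s + t = q`, `1 ≤ s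
< q` (`formD_eta`): one summand for each facet of `K_{q+1}`. So `dY = δY` on top cells, once the
signs of the assembly rule are compared with those of the boundary formula.

For the other cells the pairs of parentheses are ordered by their opening position. The last pair is
innermost, and removing it presents the cell as a face whose product orientation is already the
standard one (`IsLastFace`). This removal defines `Y` (`assemble`), proves its uniqueness and serves
as the induction principle `IsCell.induction`. For any other innermost pair the rule is the theorem
`assemble_insertPair`: 1-forms inserted at distinct letters anticommute (`insertEta_comm`), and the
resulting sign is absorbed by the reordering of the factors of the cell.

In the induction for `dY = δY` (`tensorD_assemble`), the Leibniz rule `tensorD_insertEta` produces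
two groups of terms. Differentiating the inserted `η_q` gives the facets of the last factor
(`newPairs_last`, `incidence_last`). Differentiating the rest gives, by induction, the facets of the
other factors (`newPairs_insertPair_shiftPair`, `incidence_shiftPair`). In the second group the new
pair may come after the inserted one, which is why the rule for arbitrary innermost pairs is needed.

Smoothness holds because `maurerCartanForm_eq` computes the coefficients of `η` recursively from
coordinates and coefficients at shorter words. Invariance holds because the action of `Aut(F_n)`
conjugates `η` by `|φ|` (`maurerCartan_actDeriv`) and composition of tensors is natural under `|φ|`
(`sum_subst_mul_subst_append`). -/

namespace MagnusForms

section

open MagnusExpansion (Index Tangent chart)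

/-! ### Alternating forms obtained by antisymmetrising two extra slots. -/

section alternating

variable {E : Type*} [AddCommGroup E] [Module ℝ E] {q : ℕ}

/-- The alternating form obtained from a bilinear map with values in alternating forms. -/
noncomputable def alternatizeTwo (B : E →ₗ[ℝ] E →ₗ[ℝ] E [⋀^Fin q]→ₗ[ℝ] ℝ) :
    E [⋀^Fin (q + 2)]→ₗ[ℝ] ℝ :=
  AlternatingMap.alternatizeUncurryFin (AlternatingMap.alternatizeUncurryFinLM ∘ₗ B)

theorem alternatizeTwo_add (B C : E →ₗ[ℝ] E →ₗ[ℝ] E [⋀^Fin q]→ₗ[ℝ] ℝ) :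
    alternatizeTwo (B + C) = alternatizeTwo B + alternatizeTwo C := by
  simp [alternatizeTwo, LinearMap.comp_add]

theorem sum_alternating_apply {ι : Type*} (s : Finset ι) (f : ι → E [⋀^Fin q]→ₗ[ℝ] ℝ)
    (v : Fin q → E) : (∑ i ∈ s, f i) v = ∑ i ∈ s, f i v := by
  classical
  induction s using Finset.induction_on with
  | empty => simp
  | insert i s hi ih => simp [Finset.sum_insert hi, ih]

theorem alternatizeTwo_sum {ι : Type*} (s : Finset ι)
    (B : ι → E →ₗ[ℝ] E →ₗ[ℝ] E [⋀^Fin q]→ₗ[ℝ] ℝ) :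
    alternatizeTwo (∑ i ∈ s, B i) = ∑ i ∈ s, alternatizeTwo (B i) := by
  classical
  induction s using Finset.induction_on with
  | empty =>
    ext v
    simp [alternatizeTwo, AlternatingMap.alternatizeUncurryFin_apply]
  | insert i s hi ih => rw [Finset.sum_insert hi, Finset.sum_insert hi, alternatizeTwo_add, ih]

/-- The difference `B - C` is symmetric in its two arguments, and alternatizing a symmetric map
twice gives zero, as in the proof of `d² = 0`. Anticommutativity of wedge products and the Leibniz
rule both reduce to this. -/
theorem alternatizeTwo_congr {B C : E →ₗ[ℝ] E →ₗ[ℝ] E [⋀^Fin q]→ₗ[ℝ] ℝ}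
    (h : ∀ x y, B x y - B y x = C x y - C y x) : alternatizeTwo B = alternatizeTwo C := by
  have hs : ∀ x y, (B + (-1 : ℝ) • C) x y = (B + (-1 : ℝ) • C) y x := fun x y => by
    ext v
    have := congrArg (fun f : E [⋀^Fin q]→ₗ[ℝ] ℝ => f v) (h x y)
    simp only [AlternatingMap.sub_apply] at this
    simp only [LinearMap.add_apply, LinearMap.smul_apply, AlternatingMap.add_apply,
      AlternatingMap.smul_apply, smul_eq_mul]
    linarith
  have h0 := AlternatingMap.alternatizeUncurryFin_alternatizeUncurryFinLM_comp_of_symmetric hs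
  have h1 : B = (B + (-1 : ℝ) • C) + C := by ext x y v; simp
  rw [h1, alternatizeTwo_add, alternatizeTwo, h0, zero_add]

/-- The wedge product of a linear form and an alternating form. -/
noncomputable def wedgeForm (a : E →ₗ[ℝ] ℝ) (ω : E [⋀^Fin q]→ₗ[ℝ] ℝ) :
    E [⋀^Fin (q + 1)]→ₗ[ℝ] ℝ :=
  AlternatingMap.alternatizeUncurryFin (a.smulRight ω)

theorem wedgeForm_apply (a : E →ₗ[ℝ] ℝ) (ω : E [⋀^Fin q]→ₗ[ℝ] ℝ) (v : Fin (q + 1) → E) :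
    wedgeForm a ω v = ∑ k : Fin (q + 1), (-1) ^ (k : ℕ) * (a (v k) * ω (k.removeNth v)) := by
  simp only [wedgeForm, AlternatingMap.alternatizeUncurryFin_apply, LinearMap.smulRight_apply,
    AlternatingMap.smul_apply, smul_eq_mul]
  exact Finset.sum_congr rfl fun k _ => by
    rw [← Int.cast_smul_eq_zsmul ℝ]; simp

theorem wedgeForm_wedgeForm (a b : E →ₗ[ℝ] ℝ) (ω : E [⋀^Fin q]→ₗ[ℝ] ℝ) :
    wedgeForm a (wedgeForm b ω) = alternatizeTwo (a.smulRight (b.smulRight ω)) := by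
  unfold wedgeForm alternatizeTwo
  congr 1
  ext x v
  simp

theorem wedgeForm_anticomm (a b : E →ₗ[ℝ] ℝ) (ω : E [⋀^Fin q]→ₗ[ℝ] ℝ) :
    wedgeForm a (wedgeForm b ω) = -wedgeForm b (wedgeForm a ω) := by
  have h : -wedgeForm b (wedgeForm a ω) = alternatizeTwo ((-b).smulRight (a.smulRight ω)) := by
    rw [← wedgeForm_wedgeForm]
    ext v
    simp [wedgeForm_apply]
  rw [h, wedgeForm_wedgeForm]
  refine alternatizeTwo_congr fun x y => ?_
  ext v
  simp
  ring

end alternating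

/-! ### Wedge products and derivatives of forms on the space of Magnus expansions. -/

variable {n : ℕ}

/-- A `1`-form at a point, as a linear form. -/
noncomputable def Form.linear (α : Form n 1) (θ : MagnusExpansion n) : Tangent n →ₗ[ℝ] ℝ :=
  (AlternatingMap.ofSubsingleton ℝ (Tangent n) ℝ (0 : Fin 1)).symm (α θ)

theorem wedge_eq_wedgeForm {q : ℕ} (α : Form n 1) (ω : Form n q) (θ : MagnusExpansion n) :
    wedge α ω θ = wedgeForm (α.linear θ) (ω θ) := rfl

theorem wedge_apply {q : ℕ} (α : Form n 1) (ω : Form n q) (θ : MagnusExpansion n)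
    (v : Fin (q + 1) → Tangent n) :
    wedge α ω θ v =
      ∑ k : Fin (q + 1), (-1) ^ (k : ℕ) * (α θ (fun _ => v k) * ω θ (k.removeNth v)) := by
  rw [wedge_eq_wedgeForm, wedgeForm_apply]; rfl

theorem wedge_add_right {q : ℕ} (α : Form n 1) (ω ψ : Form n q) :
    wedge α (ω + ψ) = wedge α ω + wedge α ψ := by
  ext θ v
  simp [wedge_apply, mul_add, Finset.sum_add_distrib]

theorem wedge_smul_right {q : ℕ} (c : ℝ) (α : Form n 1) (ω : Form n q) :
    wedge α (c • ω) = c • wedge α ω := by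
  ext θ v
  simp only [wedge_apply, Pi.smul_apply, AlternatingMap.smul_apply, smul_eq_mul, Finset.mul_sum]
  exact Finset.sum_congr rfl fun k _ => by ring

theorem wedge_zero_right {q : ℕ} (α : Form n 1) : wedge α (0 : Form n q) = 0 := by
  simpa using wedge_smul_right 0 α (0 : Form n q)

theorem wedge_sum_right {q : ℕ} {ι : Type*} (s : Finset ι) (α : Form n 1) (ω : ι → Form n q) :
    wedge α (∑ i ∈ s, ω i) = ∑ i ∈ s, wedge α (ω i) := by
  classical
  induction s using Finset.induction_on with
  | empty => simp [wedge_zero_right]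
  | insert i s hi ih => rw [Finset.sum_insert hi, Finset.sum_insert hi, wedge_add_right, ih]

theorem wedge_anticomm {q : ℕ} (α β : Form n 1) (ω : Form n q) :
    wedge α (wedge β ω) = -wedge β (wedge α ω) := by
  funext θ
  exact wedgeForm_anticomm (α.linear θ) (β.linear θ) (ω θ)

/-- `L` is the derivative of the form `ω` at `θ` in the global chart. -/
def HasFormDeriv {q : ℕ} (ω : Form n q) (θ : MagnusExpansion n)
    (L : Tangent n →ₗ[ℝ] Tangent n [⋀^Fin q]→ₗ[ℝ] ℝ) : Prop :=
  ∀ v u, HasLineDerivAt ℝ (fun x => ω ((chart n).symm x) u) (L v u) (chart n θ) v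

section derivative

variable {q : ℕ} {ω ψ : Form n q} {θ : MagnusExpansion n}
  {L K : Tangent n →ₗ[ℝ] Tangent n [⋀^Fin q]→ₗ[ℝ] ℝ}

/-- Line derivatives are unique, so the choice made in `formDeriv` does not matter and explicit
derivatives can be used instead. -/
theorem HasFormDeriv.formDeriv (h : HasFormDeriv ω θ L) : formDeriv ω θ = L := by
  have hex : ∃ L : Tangent n →ₗ[ℝ] Tangent n [⋀^Fin q]→ₗ[ℝ] ℝ, ∀ v u,
      HasLineDerivAt ℝ (fun x => ω ((chart n).symm x) u) (L v u) (chart n θ) v := ⟨L, h⟩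
  rw [MagnusForms.formDeriv, dif_pos hex]
  ext v u
  exact (hex.choose_spec v u).unique (h v u)

theorem HasFormDeriv.formD (h : HasFormDeriv ω θ L) :
    formD ω θ = AlternatingMap.alternatizeUncurryFin L := by
  rw [MagnusForms.formD, h.formDeriv]

theorem HasFormDeriv.add (h : HasFormDeriv ω θ L) (k : HasFormDeriv ψ θ K) :
    HasFormDeriv (ω + ψ) θ (L + K) := fun v u => HasDerivAt.add (h v u) (k v u)

theorem HasFormDeriv.const_smul (c : ℝ) (h : HasFormDeriv ω θ L) :
    HasFormDeriv (c • ω) θ (c • L) := fun v u => HasDerivAt.const_smul c (h v u)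

theorem hasFormDeriv_zero : HasFormDeriv (0 : Form n q) θ 0 := fun v u => by
  simpa using! hasDerivAt_const (0 : ℝ) (0 : ℝ)

theorem formD_zero : formD (0 : Form n q) = 0 := by
  funext θ
  rw [(hasFormDeriv_zero (θ := θ)).formD]
  ext v
  simp [AlternatingMap.alternatizeUncurryFin_apply]

theorem HasFormDeriv.sum {ι : Type*} {s : Finset ι} {ω : ι → Form n q}
    {L : ι → Tangent n →ₗ[ℝ] Tangent n [⋀^Fin q]→ₗ[ℝ] ℝ}
    (h : ∀ i ∈ s, HasFormDeriv (ω i) θ (L i)) :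
    HasFormDeriv (∑ i ∈ s, ω i) θ (∑ i ∈ s, L i) := by
  classical
  induction s using Finset.induction_on with
  | empty => simpa using hasFormDeriv_zero
  | insert i s hi ih =>
    rw [Finset.sum_insert hi, Finset.sum_insert hi]
    exact (h i (by simp)).add (ih fun j hj => h j (by simp [hj]))

/-- The bilinear map `v, u ↦ (∂_v α)(u) ω + α(u) ∂_v ω`. -/
noncomputable def wedgeDeriv (α : Tangent n →ₗ[ℝ] ℝ)
    (A : Tangent n →ₗ[ℝ] Tangent n [⋀^Fin 1]→ₗ[ℝ] ℝ) (ω : Tangent n [⋀^Fin q]→ₗ[ℝ] ℝ) (L : Tangent n →ₗ[ℝ] Tangent n [⋀^Fin q]→ₗ[ℝ] ℝ) :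
    Tangent n →ₗ[ℝ] Tangent n →ₗ[ℝ] Tangent n [⋀^Fin q]→ₗ[ℝ] ℝ :=
  LinearMap.mk₂ ℝ (fun v u =>
      (AlternatingMap.ofSubsingleton ℝ (Tangent n) ℝ (0 : Fin 1)).symm (A v) u • ω + α u • L v)
    (fun v v' u => by
      ext w
      have : (AlternatingMap.ofSubsingleton ℝ (Tangent n) ℝ (0 : Fin 1)).symm (A (v + v')) u =
        A v (fun _ => u) + A v' (fun _ => u) := by rw [map_add]; rfl
      rw [this, map_add]
      simp only [AlternatingMap.add_apply, AlternatingMap.smul_apply, smul_eq_mul,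
        AlternatingMap.ofSubsingleton_symm_apply_apply]
      ring)
    (fun c v u => by
      ext w
      have : (AlternatingMap.ofSubsingleton ℝ (Tangent n) ℝ (0 : Fin 1)).symm (A (c • v)) u =
        c * A v (fun _ => u) := by rw [map_smul]; rfl
      rw [this, map_smul]
      simp only [AlternatingMap.add_apply, AlternatingMap.smul_apply, smul_eq_mul,
        AlternatingMap.ofSubsingleton_symm_apply_apply]
      ring)
    (fun v u u' => by
      ext w
      simp only [map_add, AlternatingMap.add_apply, AlternatingMap.smul_apply, smul_eq_mul]
      ring)
    (fun c v u => by
      ext w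
      simp only [map_smul, AlternatingMap.add_apply, AlternatingMap.smul_apply, smul_eq_mul]
      ring)

theorem HasFormDeriv.wedge {α : Form n 1} {A : Tangent n →ₗ[ℝ] Tangent n [⋀^Fin 1]→ₗ[ℝ] ℝ}
    (hα : HasFormDeriv α θ A) (hω : HasFormDeriv ω θ L) :
    HasFormDeriv (wedge α ω) θ (AlternatingMap.alternatizeUncurryFinLM ∘ₗ
      wedgeDeriv (α.linear θ) A (ω θ) L) := by
  intro v u
  have hterm : ∀ k : Fin (q + 1), HasLineDerivAt ℝ (fun x => (-1 : ℝ) ^ (k : ℕ) *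
      (α ((chart n).symm x) (fun _ => u k) * ω ((chart n).symm x) (k.removeNth u)))
      ((-1) ^ (k : ℕ) * (A v (fun _ => u k) * ω θ (k.removeNth u) +
        α θ (fun _ => u k) * L v (k.removeNth u))) (chart n θ) v := by
    intro k
    have := ((hα v fun _ => u k).mul (hω v (k.removeNth u))).const_mul ((-1 : ℝ) ^ (k : ℕ))
    simpa using! this
  have hsum := HasDerivAt.fun_sum fun k (_ : k ∈ Finset.univ) => hterm k
  have e1 : (fun x => MagnusForms.wedge α ω ((chart n).symm x) u) = fun x =>
      ∑ k : Fin (q + 1), (-1 : ℝ) ^ (k : ℕ) *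
      (α ((chart n).symm x) (fun _ => u k) * ω ((chart n).symm x) (k.removeNth u)) := by
    funext x
    exact wedge_apply _ _ _ _
  rw [e1]
  refine HasDerivAt.congr_deriv hsum ?_
  rw [LinearMap.comp_apply, AlternatingMap.alternatizeUncurryFinLM_apply,
    AlternatingMap.alternatizeUncurryFin_apply]
  refine Finset.sum_congr rfl fun k _ => ?_
  rw [← Int.cast_smul_eq_zsmul ℝ]
  simp only [wedgeDeriv, LinearMap.mk₂_apply, AlternatingMap.add_apply, AlternatingMap.smul_apply,
    smul_eq_mul, Int.cast_pow, Int.cast_neg, Int.cast_one]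
  rfl

/-- The Leibniz rule for `d(α ∧ ω)`, when `dα = ∑ i, β_i ∧ γ_i`. -/
theorem formD_wedge {α : Form n 1} {A : Tangent n →ₗ[ℝ] Tangent n [⋀^Fin 1]→ₗ[ℝ] ℝ}
    (hα : HasFormDeriv α θ A) (hω : HasFormDeriv ω θ L) {ι : Type*} (s : Finset ι)
    (β γ : ι → Form n 1)
    (h : ∀ v u, A v (fun _ => u) - A u (fun _ => v) = ∑ i ∈ s,
      (β i θ (fun _ => v) * γ i θ (fun _ => u) - β i θ (fun _ => u) * γ i θ (fun _ => v))) :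
    MagnusForms.formD (MagnusForms.wedge α ω) θ =
      ∑ i ∈ s, MagnusForms.wedge (β i) (MagnusForms.wedge (γ i) ω) θ
        - MagnusForms.wedge α (MagnusForms.formD ω) θ := by
  rw [(hα.wedge hω).formD]
  have e1 : ∑ i ∈ s, MagnusForms.wedge (β i) (MagnusForms.wedge (γ i) ω) θ
      = alternatizeTwo (∑ i ∈ s, ((β i).linear θ).smulRight (((γ i).linear θ).smulRight (ω θ))) := by
    rw [alternatizeTwo_sum]
    exact Finset.sum_congr rfl fun i _ => wedgeForm_wedgeForm _ _ _
  have e2 : - MagnusForms.wedge α (MagnusForms.formD ω) θ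
      = alternatizeTwo ((-α.linear θ).smulRight L) := by
    rw [wedge_eq_wedgeForm, hω.formD]
    ext w
    simp [wedgeForm_apply, alternatizeTwo, AlternatingMap.alternatizeUncurryFin_apply (n := q + 1)]
  rw [sub_eq_add_neg, e1, e2, ← alternatizeTwo_add]
  -- Only the part antisymmetric in `v, u` counts. Hence `A` enters only through `A v u - A u v`,
  -- that is `dα`, and exchanging the slots of `α(u) ∂_v ω` accounts for the minus sign before `α ∧
  -- dω`.
  refine alternatizeTwo_congr fun v u => ?_
  ext w
  have h1 := h v u
  have h2 := congrArg (fun c => c * ω θ w) h1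
  simp only [sub_mul, Finset.sum_mul] at h2
  have a1 : ∀ v u, wedgeDeriv (α.linear θ) A (ω θ) L v u w =
      A v (fun _ => u) * ω θ w + α.linear θ u * L v w := fun v u => rfl
  simp only [AlternatingMap.sub_apply, LinearMap.add_apply, AlternatingMap.add_apply,
    LinearMap.sum_apply, sum_alternating_apply, LinearMap.neg_apply,  LinearMap.smulRight_apply,
    AlternatingMap.smul_apply, LinearMap.smul_apply, smul_eq_mul, a1]
  have h3 : ∀ v u, ∑ i ∈ s, (β i).linear θ v * ((γ i).linear θ u * ω θ w)
    = ∑ i ∈ s, β i θ (fun _ => v) * γ i θ (fun _ => u) * ω θ w := fun v u =>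
      Finset.sum_congr rfl fun i _ => (mul_assoc _ _ _).symm
  rw [h3, h3]
  rw [Finset.sum_sub_distrib] at h2
  linarith

end derivative

end

/-! ### Calculus of forms that are smooth in finitely many coordinates. -/

section

open MagnusExpansion (Index Tangent chart)

variable {n q : ℕ}

/-- Smoothness of a form in the coordinates belonging to the finite set `s`. -/
def IsSmoothOn (s : Finset (Index n)) (ω : Form n q) : Prop :=
  ∃ β : (s → ℝ) → (s → ℝ) [⋀^Fin q]→L[ℝ] ℝ, ContDiff ℝ ((⊤ : ℕ∞) : WithTop ℕ∞) β ∧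
    ∀ θ v, ω θ v = β (fun c => chart n θ c) (fun k c => v k c)

theorem isSmooth_iff {ω : Form n q} : IsSmooth ω ↔ ∃ s, IsSmoothOn s ω := Iff.rfl

/-- Pull back along the projection forgetting the extra coordinates. Two smooth forms can then be
written in the union of their coordinate sets, where sums and products are taken. -/
theorem IsSmoothOn.mono {s t : Finset (Index n)} (hst : s ⊆ t) {ω : Form n q}
    (h : IsSmoothOn s ω) : IsSmoothOn t ω := by
  obtain ⟨β, hβ, hω⟩ := h
  let r : (t → ℝ) →L[ℝ] (s → ℝ) :=
    ContinuousLinearMap.pi fun c => ContinuousLinearMap.proj ⟨c.1, hst c.2⟩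
  refine ⟨fun x => (β (r x)).compContinuousLinearMap r, ?_, fun θ v => ?_⟩
  · exact (ContinuousAlternatingMap.compContinuousLinearMapCLM (F := ℝ) (ι := Fin q) r).contDiff.comp
      (hβ.comp r.contDiff)
  · rw [hω]; rfl

theorem IsSmooth.exists_common {q' : ℕ} {ω : Form n q} {ψ : Form n q'} (h : IsSmooth ω)
    (k : IsSmooth ψ) : ∃ s, IsSmoothOn s ω ∧ IsSmoothOn s ψ := by
  classical
  obtain ⟨s, h⟩ := isSmooth_iff.mp h
  obtain ⟨t, k⟩ := isSmooth_iff.mp k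
  exact ⟨s ∪ t, h.mono Finset.subset_union_left, k.mono Finset.subset_union_right⟩

theorem isSmooth_zero : IsSmooth (0 : Form n q) :=
  ⟨∅, fun _ => 0, contDiff_const, fun _ _ => rfl⟩

theorem IsSmooth.add {ω ψ : Form n q} (h : IsSmooth ω) (k : IsSmooth ψ) : IsSmooth (ω + ψ) := by
  obtain ⟨s, ⟨β, hβ, hω⟩, γ, hγ, hψ⟩ := h.exists_common k
  exact ⟨s, β + γ, hβ.add hγ, fun θ v => by simp [hω, hψ]⟩

theorem IsSmooth.const_smul (c : ℝ) {ω : Form n q} (h : IsSmooth ω) : IsSmooth (c • ω) := by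
  obtain ⟨s, β, hβ, hω⟩ := h
  exact ⟨s, c • β, hβ.const_smul c, fun θ v => by simp [hω]⟩

theorem IsSmooth.sum {ι : Type*} {s : Finset ι} {ω : ι → Form n q}
    (h : ∀ i ∈ s, IsSmooth (ω i)) : IsSmooth (∑ i ∈ s, ω i) := by
  classical
  induction s using Finset.induction_on with
  | empty => simpa using isSmooth_zero
  | insert i s hi ih =>
    rw [Finset.sum_insert hi]
    exact (h i (by simp)).add (ih fun j hj => h j (by simp [hj]))

/-- The product of a form and a coordinate function. -/
noncomputable def coordMul (c : Index n) (ω : Form n q) : Form n q := fun θ => chart n θ c • ω θ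

theorem IsSmooth.coordMul (c : Index n) {ω : Form n q} (h : IsSmooth ω) :
    IsSmooth (coordMul c ω) := by
  classical
  obtain ⟨s, h⟩ := isSmooth_iff.mp h
  obtain ⟨β, hβ, hω⟩ := h.mono (Finset.subset_insert c s)
  refine ⟨insert c s, fun x => x ⟨c, by simp⟩ • β x, ?_, fun θ v => ?_⟩
  · exact (contDiff_apply ℝ ℝ _).smul hβ
  · simp [MagnusForms.coordMul, hω]

/-- The differential of a coordinate function. -/
noncomputable def coordForm (c : Index n) : Form n 1 := fun _ =>
  AlternatingMap.ofSubsingleton ℝ (Tangent n) ℝ (0 : Fin 1) (LinearMap.proj c)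

theorem isSmooth_coordForm (c : Index n) : IsSmooth (coordForm c) := by
  refine ⟨{c}, fun _ => ContinuousAlternatingMap.ofSubsingleton ℝ _ ℝ (0 : Fin 1)
    (ContinuousLinearMap.proj ⟨c, by simp⟩), contDiff_const, fun θ v => ?_⟩
  simp [coordForm]

theorem IsSmooth.wedge {α : Form n 1} {ω : Form n q} (h : IsSmooth α) (k : IsSmooth ω) :
    IsSmooth (wedge α ω) := by
  obtain ⟨s, ⟨β, hβ, hα⟩, γ, hγ, hω⟩ := h.exists_common k
  refine ⟨s, fun x => ContinuousAlternatingMap.alternatizeUncurryFinCLM ℝ (s → ℝ) ℝ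
    (((ContinuousAlternatingMap.ofSubsingletonLIE (𝕜 := ℝ) (E := s → ℝ) (F := ℝ) (0 : Fin 1)).symm
      (β x)).smulRight (γ x)), ?_, fun θ v => ?_⟩
  · have h1 : ContDiff ℝ ((⊤ : ℕ∞) : WithTop ℕ∞) fun x =>
        (ContinuousAlternatingMap.ofSubsingletonLIE (𝕜 := ℝ) (E := s → ℝ) (F := ℝ) (0 : Fin 1)).symm
          (β x) :=
      (LinearIsometryEquiv.contDiff (𝕜 := ℝ) (E := (s → ℝ) [⋀^Fin 1]→L[ℝ] ℝ) (F := (s → ℝ) →L[ℝ] ℝ)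
        (ContinuousAlternatingMap.ofSubsingletonLIE (𝕜 := ℝ) (0 : Fin 1)).symm).comp hβ
    have h2 := ContinuousLinearMap.contDiff (𝕜 := ℝ) (n := ((⊤ : ℕ∞) : WithTop ℕ∞))
      (E := (s → ℝ) →L[ℝ] (s → ℝ) [⋀^Fin q]→L[ℝ] ℝ) (F := (s → ℝ) [⋀^Fin (q + 1)]→L[ℝ] ℝ)
      (ContinuousAlternatingMap.alternatizeUncurryFinCLM ℝ (s → ℝ) ℝ)
    exact h2.comp (h1.smulRight hγ)
  · rw [wedge_apply]
    simp only [ContinuousAlternatingMap.alternatizeUncurryFinCLM_apply,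
      ContinuousAlternatingMap.alternatizeUncurryFin_apply]
    refine Finset.sum_congr rfl fun k _ => ?_
    rw [← Int.cast_smul_eq_zsmul ℝ]
    simp only [hα, hω, ContinuousLinearMap.smulRight_apply, ContinuousAlternatingMap.smul_apply,
      smul_eq_mul, Int.cast_pow, Int.cast_neg, Int.cast_one]
    rfl

/-- The form factors through the linear projection `π` to a finite-dimensional space, where the
Fréchet derivative of `β` supplies all line derivatives. -/
theorem IsSmooth.exists_hasFormDeriv {ω : Form n q} (h : IsSmooth ω) (θ : MagnusExpansion n) :
    ∃ L, HasFormDeriv ω θ L := by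
  obtain ⟨s, β, hβ, hω⟩ := h
  let π : Tangent n →ₗ[ℝ] (s → ℝ) := LinearMap.funLeft ℝ ℝ (Subtype.val : s → Index n)
  have hd : DifferentiableAt ℝ β (π (chart n θ)) := hβ.differentiable (by simp) _
  refine ⟨{ toFun := fun v => ((fderiv ℝ β (π (chart n θ)) (π v)).toAlternatingMap).compLinearMap π
            map_add' := fun v w => by ext u; simp
            map_smul' := fun c v => by ext u; simp }, fun v u => ?_⟩
  have hfun : (fun x => ω ((chart n).symm x) u) = fun x => β (π x) (fun k => π (u k)) := by
    funext x
    rw [hω, Equiv.apply_symm_apply]; rfl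
  have h2 : HasDerivAt (fun t : ℝ => β (π (chart n θ) + t • π v))
    (fderiv ℝ β (π (chart n θ)) (π v)) 0 := hd.hasFDerivAt.hasLineDerivAt _
  rw [hfun]
  change HasDerivAt (fun t : ℝ => β (π (chart n θ + t • v)) (fun k => π (u k))) _ 0
  have h3 := (ContinuousAlternatingMap.apply ℝ (s → ℝ) ℝ (fun k => π (u k))).hasFDerivAt
    |>.comp_hasDerivAt (0 : ℝ) h2
  simpa [Function.comp_def] using! h3

theorem formD_sum {ι : Type*} {s : Finset ι} {ω : ι → Form n q} (h : ∀ i ∈ s, IsSmooth (ω i)) :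
    formD (∑ i ∈ s, ω i) = ∑ i ∈ s, formD (ω i) := by
  funext θ
  choose! L hL using fun i (hi : i ∈ s) => (h i hi).exists_hasFormDeriv θ
  rw [(HasFormDeriv.sum fun i hi => hL i hi).formD, Finset.sum_apply,
    ← AlternatingMap.alternatizeUncurryFinLM_apply, map_sum]
  exact Finset.sum_congr rfl fun i hi => (hL i hi).formD.symm

theorem formD_const_smul (c : ℝ) {ω : Form n q} (h : IsSmooth ω) :
    formD (c • ω) = c • formD ω := by
  funext θ
  obtain ⟨L, hL⟩ := h.exists_hasFormDeriv θ
  rw [(hL.const_smul c).formD, Pi.smul_apply, hL.formD, AlternatingMap.alternatizeUncurryFin_smul]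

end

/-! ### The Maurer–Cartan form: recursion, smoothness, structure equation. -/

section

open MagnusExpansion (Index Tangent chart)

variable {n : ℕ}

/-- The Leibniz rule on words: a derivation replaces one letter `j` by `h j`, so the coefficient at
`w` sums over all ways to single out a segment of `s` letters after the first `k` as the part coming
from `h j`. -/
theorem derivEnd_apply (h : Fin n → Series n) (z : Series n) (w : List (Fin n)) :
    derivEnd h z w = ∑ k ∈ Finset.range w.length, ∑ s ∈ Finset.range (w.length - k + 1),
      ∑ j, h j ((w.drop k).take s) * z (w.take k ++ j :: w.drop (k + s)) := by
  induction w generalizing z with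
  | nil => simp [derivEnd_nil]
  | cons a w ih =>
    rw [derivEnd_cons, ih, List.length_cons, Finset.sum_range_succ', add_comm, Series.sum_apply]
    congr 1
    · refine Finset.sum_congr rfl fun k _ => ?_
      rw [Nat.add_sub_add_right]
      refine Finset.sum_congr rfl fun s _ => Finset.sum_congr rfl fun j _ => ?_
      rw [add_right_comm k 1 s]
      rfl
    · rw [Finset.sum_comm]
      refine Finset.sum_congr rfl fun j _ => ?_
      rw [Series.mul_apply, List.length_cons]
      simp

theorem lieIA_eq_derivEnd (u : lieIA n) : u.1 = derivEnd fun i => u.1 (Series.X i) := by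
  ext z w
  induction w generalizing z with
  | nil =>
    have := lieIA_apply_mem u (k := 0)
      (fun i => Series.filt_anti (by omega) (u.2.2.1 _ (Series.X_mem_filt i))) 0 (z := z)
      (fun w hw => absurd hw (Nat.not_lt_zero _))
    rw [lieIA_apply, Series.sum_apply, derivEnd_nil]
    refine Finset.sum_eq_zero fun i _ => ?_
    simp [u.2.2.1 _ (Series.X_mem_filt i) [] (by simp), Series.X]
  | cons a w ih =>
    rw [lieIA_apply, Series.sum_apply, derivEnd_cons, Series.sum_apply, ← ih]
    simp only [Series.add_apply, Series.X_mul_cons, Finset.sum_add_distrib]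
    simp

theorem commutator_mem_lieIA (u v : lieIA n) : u.1 * v.1 - v.1 * u.1 ∈ lieIA n := by
  obtain ⟨u, hu1, hu2, hu3⟩ := u
  obtain ⟨v, hv1, hv2, hv3⟩ := v
  refine ⟨fun m hm z hz => ?_, fun z hz => ?_, fun y z => ?_⟩
  · exact Submodule.sub_mem _ (hu1 m hm _ (hv1 m hm z hz)) (hv1 m hm _ (hu1 m hm z hz))
  · exact Submodule.sub_mem _ (hu1 2 (by omega) _ (hv2 z hz)) (hv1 2 (by omega) _ (hu2 z hz))
  · simp only [LinearMap.sub_apply, Module.End.mul_apply, hu3, hv3, map_add, sub_mul, mul_sub]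
    abel

namespace MagnusExpansion

theorem of_eq (θ : MagnusExpansion n) (i : Fin n) :
    θ (FreeGroup.of i) = 1 + Series.X i + tangentSeries (chart n θ) i := by
  rw [← ofTangent_of]
  exact congrArg (fun θ : MagnusExpansion n => θ (FreeGroup.of i))
    ((chart n).symm_apply_apply θ).symm

end MagnusExpansion

open MagnusExpansion (tangentSeries)

theorem infinitesimalAction_maurerCartan (θ : MagnusExpansion n) (v : Tangent n) :
    infinitesimalAction θ (maurerCartan θ v) = v :=
  (maurerCartan θ).symm_apply_apply v

theorem maurerCartan_infinitesimalAction (θ : MagnusExpansion n) (u : lieIA n) :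
    maurerCartan θ (infinitesimalAction θ u) = u :=
  (maurerCartan θ).apply_symm_apply u

theorem tangentSeries_eq_zero_of_lt (v : Tangent n) (i : Fin n) {w : List (Fin n)}
    (hw : w.length < 2) : tangentSeries v i w = 0 := MagnusExpansion.tangentSeries_mem v i w hw

/-- At words of length at least `2` this is the definition of `η` as an inverse. At shorter words,
which are not coordinates, both sides vanish because `η` raises the degree. -/
theorem maurerCartan_apply_of (θ : MagnusExpansion n) (v : Tangent n) (i : Fin n) :
    (maurerCartan θ v).1 (θ (FreeGroup.of i)) = tangentSeries v i := by
  ext w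
  by_cases hw : 2 ≤ w.length
  · have := congrFun (infinitesimalAction_maurerCartan θ v) (i, ⟨w, hw⟩)
    rw [infinitesimalAction_apply] at this
    rw [this]
    simp [tangentSeries, hw]
  · rw [tangentSeries_eq_zero_of_lt]
    rotate_left
    · omega
    rw [θ.of_eq, map_add, map_add, lieIA_apply_one, zero_add, Series.add_apply,
      (maurerCartan θ v).2.2.1 _ (Series.X_mem_filt i) w (by omega),
      (maurerCartan θ v).2.1 2 (by omega) _ (MagnusExpansion.tangentSeries_mem _ i) w (by omega),
      add_zero]

/-- The coefficient at the word `w` of the value at `X_i` of the Maurer–Cartan form. -/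
noncomputable def maurerCartanForm (i : Fin n) (w : List (Fin n)) : Form n 1 := fun θ =>
  AlternatingMap.ofSubsingleton ℝ (Tangent n) ℝ (0 : Fin 1)
    { toFun := fun v => (maurerCartan θ v).1 (Series.X i) w
      map_add' := fun u v => by simp
      map_smul' := fun c v => by simp }

theorem maurerCartanForm_apply (i : Fin n) (w : List (Fin n)) (θ : MagnusExpansion n)
    (v : Fin 1 → Tangent n) :
    maurerCartanForm i w θ v = (maurerCartan θ (v 0)).1 (Series.X i) w := rfl

theorem eta_eq (p : ℕ) (i : Fin n) (w : List (Fin n)) :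
    eta n p i w = if w.length = p + 1 then maurerCartanForm i w else 0 := by
  ext θ v
  split_ifs with h
  · simp [eta, maurerCartanForm, h]
  · simp [eta, h]

theorem maurerCartanForm_eq_zero (i : Fin n) (w : List (Fin n)) (hw : w.length < 2) :
    maurerCartanForm i w = 0 := by
  ext θ v
  exact (maurerCartan θ (v 0)).2.2.1 _ (Series.X_mem_filt i) w hw

/-- Expanding `θ(x_i)` as `1 + X_i` plus a series in `T̂_2` turns the characterisation of `η` into
an equation that determines its values on `H` degree by degree. -/
theorem maurerCartan_X_add (θ : MagnusExpansion n) (v : Tangent n) (i : Fin n) :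
    (maurerCartan θ v).1 (Series.X i) +
      derivEnd (fun j => (maurerCartan θ v).1 (Series.X j)) (tangentSeries (chart n θ) i) =
    tangentSeries v i := by
  rw [← maurerCartan_apply_of θ v i, θ.of_eq, map_add, map_add, lieIA_apply_one, zero_add,
    ← lieIA_eq_derivEnd]

theorem length_splice (w : List (Fin n)) {k s : ℕ} (hk : k + s ≤ w.length) (j : Fin n) :
    (w.take k ++ j :: w.drop (k + s)).length = w.length - s + 1 := by
  simp; omega

theorem maurerCartanForm_eq (i : Fin n) (w : List (Fin n)) (hw : 2 ≤ w.length) :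
    maurerCartanForm i w = coordForm (i, ⟨w, hw⟩) + (-1 : ℝ) •
      ∑ k ∈ Finset.range w.length, ∑ s ∈ Finset.range (w.length - k + 1), ∑ j,
        if h : 2 ≤ (w.take k ++ j :: w.drop (k + s)).length then
          coordMul (i, ⟨w.take k ++ j :: w.drop (k + s), h⟩)
            (maurerCartanForm j ((w.drop k).take s))
        else 0 := by
  ext θ v
  have h1 := congrArg (fun f : Series n => f w) (maurerCartan_X_add θ (v 0) i)
  simp only [Series.add_apply, derivEnd_apply] at h1
  have h2 : tangentSeries (v 0) i w = v 0 (i, ⟨w, hw⟩) := by simp [tangentSeries, hw]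
  rw [Pi.add_apply, AlternatingMap.add_apply, Pi.smul_apply, AlternatingMap.smul_apply,
    Finset.sum_apply, sum_alternating_apply, maurerCartanForm_apply, eq_sub_of_add_eq h1, h2,
    sub_eq_add_neg, neg_one_smul]
  congr 2
  refine Finset.sum_congr rfl fun k _ => ?_
  rw [Finset.sum_apply, sum_alternating_apply]
  refine Finset.sum_congr rfl fun s _ => ?_
  rw [Finset.sum_apply, sum_alternating_apply]
  refine Finset.sum_congr rfl fun j _ => ?_
  split_ifs with h
  · rw [coordMul, AlternatingMap.smul_apply, maurerCartanForm_apply, smul_eq_mul, mul_comm]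
    congr 1
    exact dif_pos h
  · rw [Pi.zero_apply, AlternatingMap.zero_apply]
    exact mul_eq_zero_of_right _ (dif_neg h)

theorem isSmooth_maurerCartanForm (i : Fin n) (w : List (Fin n)) :
    IsSmooth (maurerCartanForm i w) := by
  induction hl : w.length using Nat.strong_induction_on generalizing i w with
  | _ l ih =>
  by_cases hw : 2 ≤ w.length
  · rw [maurerCartanForm_eq i w hw]
    refine (isSmooth_coordForm _).add (IsSmooth.const_smul _ ?_)
    refine IsSmooth.sum fun k hk => IsSmooth.sum fun s hs => IsSmooth.sum fun j _ => ?_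
    rw [Finset.mem_range] at hk hs
    split_ifs with h
    · refine IsSmooth.coordMul _ (ih _ ?_ j _ rfl)
      -- The spliced word has `w.length - s + 1` letters, so `h` forces `s < w.length`: only shorter
      -- words occur in the recursion.
      rw [length_splice w (by omega)] at h
      simp; omega
    · exact isSmooth_zero
  · rw [maurerCartanForm_eq_zero i w (by omega)]
    exact isSmooth_zero

theorem isSmooth_eta (p : ℕ) (i : Fin n) (w : List (Fin n)) : IsSmooth (eta n p i w) := by
  rw [eta_eq]
  split_ifs
  · exact isSmooth_maurerCartanForm i w
  · exact isSmooth_zero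

/-- Each coefficient of `derivEnd h z` is a finite sum of products of a coefficient of `h` and one
of `z`, so the product rule applies. -/
theorem hasDerivAt_derivEnd {h : ℝ → Fin n → Series n} {z : ℝ → Series n} {g : Fin n → Series n}
    {y : Series n} (hh : ∀ j w, HasDerivAt (fun t => h t j w) (g j w) 0)
    (hz : ∀ w, HasDerivAt (fun t => z t w) (y w) 0) (w : List (Fin n)) :
    HasDerivAt (fun t => derivEnd (h t) (z t) w)
      (derivEnd g (z 0) w + derivEnd (h 0) y w) 0 := by
  simp only [derivEnd_apply, ← Finset.sum_add_distrib]
  exact HasDerivAt.fun_sum fun k _ => HasDerivAt.fun_sum fun s _ => HasDerivAt.fun_sum fun j _ =>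
    (hh _ _).mul (hz _)

theorem hasDerivAt_tangentSeries (x v : Tangent n) (i : Fin n) (w : List (Fin n)) :
    HasDerivAt (fun t : ℝ => tangentSeries (x + t • v) i w) (tangentSeries v i w) 0 := by
  by_cases hw : 2 ≤ w.length
  · simp only [tangentSeries, hw, dite_true]
    have := ((hasDerivAt_id (0 : ℝ)).mul_const (v (i, ⟨w, hw⟩))).const_add (x (i, ⟨w, hw⟩))
    simpa using! this
  · simpa [tangentSeries, hw] using! hasDerivAt_const (0 : ℝ) (0 : ℝ)

/-- The Maurer–Cartan equation `dη = η ∧ η`. -/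
theorem maurerCartan_equation (θ : MagnusExpansion n)
    (L : Fin n → List (Fin n) → Tangent n →ₗ[ℝ] Tangent n [⋀^Fin 1]→ₗ[ℝ] ℝ)
    (hL : ∀ i w, HasFormDeriv (maurerCartanForm i w) θ (L i w)) (v u : Tangent n) (i : Fin n)
    (w : List (Fin n)) :
    L i w v (fun _ => u) - L i w u (fun _ => v) =
      (maurerCartan θ v).1 ((maurerCartan θ u).1 (Series.X i)) w -
      (maurerCartan θ u).1 ((maurerCartan θ v).1 (Series.X i)) w := by
  let g : Tangent n → Tangent n → Fin n → Series n := fun v u i w => L i w v (fun _ => u)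
  have hg2 : ∀ v u i, g v u i ∈ Series.filt n 2 := by
    intro v u i w hw
    have h1 := hL i w v (fun _ => u)
    rw [maurerCartanForm_eq_zero i w hw] at h1
    exact HasDerivAt.unique h1 (by simpa using! hasDerivAt_const (0 : ℝ) (0 : ℝ))
  -- Differentiate `η(u)(θ(x_i)) = u_i` along `v`. The right side is constant in the chart, while
  -- `θ(x_i)` itself moves by `v_i = η(v)(θ(x_i))`.
  have key : ∀ v u i, derivEnd (g v u) (θ (FreeGroup.of i)) =
      -(maurerCartan θ u).1 ((maurerCartan θ v).1 (θ (FreeGroup.of i))) := by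
    intro v u i
    ext w
    have hh : ∀ j w, HasDerivAt
        (fun t : ℝ => (maurerCartan ((chart n).symm (chart n θ + t • v)) u).1 (Series.X j) w)
        (g v u j w) 0 := fun j w => hL j w v (fun _ => u)
    have h2 := (hh i w).add
      (hasDerivAt_derivEnd hh (fun w => hasDerivAt_tangentSeries (chart n θ) v i w) w)
    have h3 : (fun t : ℝ => (maurerCartan ((chart n).symm (chart n θ + t • v)) u).1 (Series.X i) w) +
        (fun t : ℝ => derivEnd (fun j =>
          (maurerCartan ((chart n).symm (chart n θ + t • v)) u).1 (Series.X j))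
          (tangentSeries (chart n θ + t • v) i) w) = fun _ => tangentSeries u i w := by
      funext t
      have := maurerCartan_X_add ((chart n).symm (chart n θ + t • v)) u i
      rw [Equiv.apply_symm_apply] at this
      rw [← this]
      rfl
    rw [h3] at h2
    have h4 := h2.unique (hasDerivAt_const _ _)
    simp only [zero_smul, add_zero, Equiv.symm_apply_apply] at h4
    rw [← lieIA_eq_derivEnd, ← maurerCartan_apply_of θ v i] at h4
    rw [θ.of_eq i, map_add, map_add, derivEnd_one, zero_add,
      derivEnd_X fun j => hg2 v u j [] (by simp), Series.add_apply, Series.neg_apply, ← θ.of_eq i]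
    linarith
  have hmem : ∀ v u, derivEnd (g v u) ∈ lieIA n := fun v u => derivEnd_mem_lieIA (hg2 v u)
  -- By `key` both derivations have the same coordinates on all `θ(x_i)`, and an element of the Lie
  -- algebra is determined by these.
  have heq : (⟨_, hmem v u⟩ - ⟨_, hmem u v⟩ : lieIA n) =
      ⟨_, commutator_mem_lieIA (maurerCartan θ v) (maurerCartan θ u)⟩ := by
    apply infinitesimalAction_injective θ
    funext c
    rw [infinitesimalAction_apply, infinitesimalAction_apply]
    simp only [Submodule.coe_sub, LinearMap.sub_apply, Module.End.mul_apply, key,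
      Series.sub_apply, Series.neg_apply]
    ring
  have h5 := congrArg (fun D : lieIA n => D.1 (Series.X i) w) heq
  simp only [Submodule.coe_sub, LinearMap.sub_apply, Module.End.mul_apply, Series.sub_apply,
    derivEnd_X fun j => hg2 v u j [] (by simp), derivEnd_X fun j => hg2 u v j [] (by simp)] at h5
  exact h5

end

/-! ### The components of the structure equation and the insertion operators. -/

section

open MagnusExpansion (Index Tangent chart)

variable {n : ℕ}

/-- The facets of `K_{q + 1}`: the pair `(k, s)` encloses the `s + 1` letters after the first `k`. -/
def facets (q : ℕ) : Finset (ℕ × ℕ) :=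
  (Finset.range q ×ˢ Finset.range q).filter fun x => 1 ≤ x.2 ∧ x.1 + x.2 ≤ q

theorem mem_facets {q : ℕ} {x : ℕ × ℕ} : x ∈ facets q ↔ 1 ≤ x.2 ∧ x.2 < q ∧ x.1 + x.2 ≤ q := by
  simp only [facets, Finset.mem_filter, Finset.mem_product, Finset.mem_range]
  omega

/-- Passes from the cuts of a word in `derivEnd_apply` to facets. A segment of `s` letters belongs
to the index `s - 1`, and only `2 ≤ s ≤ q` survives. -/
theorem sum_facets {A : Type*} [AddCommMonoid A] (q : ℕ) (f : ℕ → ℕ → A)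
    (hf : ∀ k s, k + s ≤ q + 1 → (s < 2 ∨ q < s) → f k s = 0) :
    ∑ k ∈ Finset.range (q + 1), ∑ s ∈ Finset.range (q + 1 - k + 1), f k s =
      ∑ x ∈ facets q, f x.1 (x.2 + 1) := by
  rw [Finset.sum_sigma']
  symm
  refine Finset.sum_of_injOn (fun x => ⟨x.1, x.2 + 1⟩) ?_ ?_ ?_ ?_
  · rintro ⟨k, s⟩ _ ⟨k', s'⟩ _ h
    simpa using h
  · rintro ⟨k, s⟩ h
    have := mem_facets.mp h
    simp only [Finset.coe_sigma, Set.mem_sigma_iff, Finset.mem_coe, Finset.mem_range] at this ⊢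
    omega
  · rintro ⟨k, s⟩ h h'
    simp only [Finset.mem_sigma, Finset.mem_range] at h
    refine hf k s (by omega) ?_
    by_contra hc
    refine h' ⟨(k, s - 1), mem_facets.mpr (by simp only; omega), ?_⟩
    have : s - 1 + 1 = s := by omega
    simp [this]
  · intros; rfl

/-- Since `η` has no coefficients at words of length below `2`, both the segment and the word with
the segment contracted have at least two letters; such segments are the facets of `K_{q+1}`. -/
theorem maurerCartan_comp_apply (θ : MagnusExpansion n) (v u : Tangent n) (i : Fin n) (q : ℕ)
    (w : List (Fin n)) (hw : w.length = q + 1) :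
    (maurerCartan θ v).1 ((maurerCartan θ u).1 (Series.X i)) w =
      ∑ x ∈ facets q, ∑ j, eta n x.2 j ((w.drop x.1).take (x.2 + 1)) θ (fun _ => v) *
        eta n (q - x.2) i (w.take x.1 ++ j :: w.drop (x.1 + (x.2 + 1))) θ (fun _ => u) := by
  have h0 : ∀ (v : Tangent n) (i : Fin n) (w : List (Fin n)), w.length < 2 →
      (maurerCartan θ v).1 (Series.X i) w = 0 :=
    fun v i w hw => (maurerCartan θ v).2.2.1 _ (Series.X_mem_filt i) w hw
  rw [lieIA_eq_derivEnd (maurerCartan θ v), derivEnd_apply, hw, sum_facets]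
  · refine Finset.sum_congr rfl fun x hx => Finset.sum_congr rfl fun j _ => ?_
    have hx := mem_facets.mp hx
    rw [eta_eq, if_pos (by simp; omega), eta_eq,
      if_pos (by rw [length_splice w (by omega)]; omega)]
    rfl
  · intro k s hks h
    refine Finset.sum_eq_zero fun j _ => ?_
    rcases h with h | h
    · rw [h0 _ _ _ (by simp; omega), zero_mul]
    · rw [h0 u i _ (by rw [length_splice w (by omega)]; omega), mul_zero]

/-- The Maurer–Cartan equation for `η_q`, in terms of the derivative in the global chart. -/
theorem exists_hasFormDeriv_eta (θ : MagnusExpansion n) (q : ℕ) (i : Fin n) (w : List (Fin n))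
    (hw : w.length = q + 1) : ∃ A, HasFormDeriv (eta n q i w) θ A ∧ ∀ v u,
      A v (fun _ => u) - A u (fun _ => v) = ∑ x ∈ facets q ×ˢ (Finset.univ : Finset (Fin n)),
        (eta n x.1.2 x.2 ((w.drop x.1.1).take (x.1.2 + 1)) θ (fun _ => v) *
          eta n (q - x.1.2) i (w.take x.1.1 ++ x.2 :: w.drop (x.1.1 + (x.1.2 + 1))) θ (fun _ => u) -
        eta n x.1.2 x.2 ((w.drop x.1.1).take (x.1.2 + 1)) θ (fun _ => u) *
          eta n (q - x.1.2) i (w.take x.1.1 ++ x.2 :: w.drop (x.1.1 + (x.1.2 + 1))) θ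
            (fun _ => v)) := by
  choose L hL using fun i w => (isSmooth_maurerCartanForm (n := n) i w).exists_hasFormDeriv θ
  refine ⟨L i w, ?_, fun v u => ?_⟩
  · rw [eta_eq, if_pos hw]
    exact hL i w
  · rw [maurerCartan_equation θ L hL, maurerCartan_comp_apply θ v u i q w hw,
      maurerCartan_comp_apply θ u v i q w hw, Finset.sum_sub_distrib, Finset.sum_product,
      Finset.sum_product]

theorem formD_eta (q : ℕ) (i : Fin n) (w : List (Fin n)) (hw : w.length = q + 1) :
    formD (eta n q i w) = ∑ x ∈ facets q, ∑ j, wedge (eta n x.2 j ((w.drop x.1).take (x.2 + 1)))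
      (eta n (q - x.2) i (w.take x.1 ++ j :: w.drop (x.1 + (x.2 + 1)))) := by
  ext θ v
  obtain ⟨A, hA, hd⟩ := exists_hasFormDeriv_eta θ q i w hw
  have hv : ∀ k : Fin 2, k.removeNth v = fun _ => v (1 - k) := by
    intro k
    funext j
    fin_cases k <;> fin_cases j <;> rfl
  have h2 : ∀ (α β : Form n 1), wedge α β θ v =
      α θ (fun _ => v 0) * β θ (fun _ => v 1) - α θ (fun _ => v 1) * β θ (fun _ => v 0) := by
    intro α β
    rw [wedge_apply, Fin.sum_univ_two, hv, hv]
    simp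
    ring
  have h1 : formD (eta n q i w) θ v = A (v 0) (fun _ => v 1) - A (v 1) (fun _ => v 0) := by
    rw [hA.formD, AlternatingMap.alternatizeUncurryFin_apply, Fin.sum_univ_two, hv, hv]
    simp
    abel
  rw [h1, hd, Finset.sum_product]
  simp only [Finset.sum_apply, sum_alternating_apply, h2]

theorem insertEta_zero (a p b : ℕ) (ω : TensorForm n) (i : Fin n) (w : List (Fin n)) :
    insertEta a p b ω i w 0 = 0 := rfl

theorem insertEta_succ (a p b : ℕ) (ω : TensorForm n) (i : Fin n) (w : List (Fin n)) (q : ℕ) :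
    insertEta a p b ω i w (q + 1) = if w.length = a + (p + 1) + b then
      ∑ j, wedge (eta n p j ((w.drop a).take (p + 1)))
        (ω i (w.take a ++ j :: w.drop (a + (p + 1))) q)
    else 0 := rfl

theorem insertEta_smul (a p b : ℕ) (c : ℝ) (ω : TensorForm n) :
    insertEta a p b (c • ω) = c • insertEta a p b ω := by
  funext i w q
  cases q with
  | zero => simp [insertEta_zero]
  | succ q =>
    simp only [Pi.smul_apply, insertEta_succ]
    split_ifs
    · rw [Finset.smul_sum]
      exact Finset.sum_congr rfl fun j _ => wedge_smul_right _ _ _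
    · rw [smul_zero]

theorem insertEta_add (a p b : ℕ) (ω ψ : TensorForm n) :
    insertEta a p b (ω + ψ) = insertEta a p b ω + insertEta a p b ψ := by
  funext i w q
  cases q with
  | zero => simp [insertEta_zero]
  | succ q =>
    simp only [Pi.add_apply, insertEta_succ]
    split_ifs
    · rw [← Finset.sum_add_distrib]
      exact Finset.sum_congr rfl fun j _ => wedge_add_right _ _ _
    · rw [add_zero]

theorem insertEta_sum {ι : Type*} (s : Finset ι) (a p b : ℕ) (ω : ι → TensorForm n) :
    insertEta a p b (∑ i ∈ s, ω i) = ∑ i ∈ s, insertEta a p b (ω i) := by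
  classical
  induction s using Finset.induction_on with
  | empty => simpa using insertEta_smul a p b 0 0
  | insert i s hi ih => rw [Finset.sum_insert hi, Finset.sum_insert hi, insertEta_add, ih]

theorem exists_eq_append_of_le {α : Type*} (w : List α) (a : ℕ) (h : a ≤ w.length) :
    ∃ u v : List α, w = u ++ v ∧ u.length = a ∧ v.length = w.length - a :=
  ⟨w.take a, w.drop a, (List.take_append_drop a w).symm, by simp [h], by simp⟩

theorem take_append_cons_drop {α : Type*} (u v w : List α) (j : α) {k s : ℕ} (hk : u.length = k)
    (hs : v.length = s) :
    (u ++ (v ++ w)).take k ++ j :: (u ++ (v ++ w)).drop (k + s) = u ++ j :: w := by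
  subst hk hs
  simp [List.drop_append]

theorem take_drop_append {α : Type*} (u v w : List α) {k s : ℕ} (hk : u.length = k)
    (hs : v.length = s) : ((u ++ (v ++ w)).drop k).take s = v := by
  subst hk hs
  simp

/-- Graded commutativity of the insertion of Maurer–Cartan components at distinct letters. -/
theorem insertEta_comm (a q c r b : ℕ) (ω : TensorForm n) :
    insertEta (a + (q + 1) + c) r b (insertEta a q (c + 1 + b) ω) =
      -insertEta a q (c + (r + 1) + b) (insertEta (a + 1 + c) r b ω) := by
  funext i w d
  match d with
  | 0 => simp [insertEta_zero]
  | 1 => simp [insertEta_succ, insertEta_zero, wedge_zero_right]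
  | d + 2 =>
    simp only [Pi.neg_apply, insertEta_succ]
    by_cases hw : w.length = a + (q + 1) + c + (r + 1) + b
    -- Cut the word into pieces of lengths `a`, `q + 1`, `c`, `r + 1`, `b`. The insertions act on
    -- the second and fourth piece independently, so only the order of the two 1-forms differs.
    · obtain ⟨A, w, rfl, rfl, h1⟩ := exists_eq_append_of_le w a (by omega)
      obtain ⟨B, w, rfl, hB, h2⟩ := exists_eq_append_of_le w (q + 1) (by omega)
      obtain ⟨C, w, rfl, rfl, h3⟩ := exists_eq_append_of_le w c (by omega)
      obtain ⟨D, E, rfl, hD, h4⟩ := exists_eq_append_of_le w (r + 1) (by omega)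
      have e1 : ∀ j : Fin n, _ = _ := fun j => take_append_cons_drop (A ++ (B ++ C)) D E j
        (k := A.length + (q + 1) + C.length) (s := r + 1) (by simp; omega) hD
      have e2 := take_drop_append (A ++ (B ++ C)) D E
        (k := A.length + (q + 1) + C.length) (s := r + 1) (by simp; omega) hD
      have e3 : ∀ j : Fin n, _ = _ := fun j => take_append_cons_drop A B (C ++ (D ++ E)) j rfl hB
      have e4 := take_drop_append A B (C ++ (D ++ E)) rfl hB
      have e5 : ∀ j l : Fin n, _ = _ := fun j l =>
        take_append_cons_drop A B (C ++ (j :: E)) l rfl hB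
      have e6 : ∀ j : Fin n, _ = _ := fun j => take_drop_append A B (C ++ (j :: E)) rfl hB
      have e7 : ∀ j l : Fin n, _ = _ := fun j l => take_append_cons_drop (A ++ (l :: C)) D E j
        (k := A.length + 1 + C.length) (s := r + 1) (by simp; omega) hD
      have e8 : ∀ l : Fin n, _ = _ := fun l => take_drop_append (A ++ (l :: C)) D E
        (k := A.length + 1 + C.length) (s := r + 1) (by simp; omega) hD
      simp only [List.append_assoc, List.cons_append] at e1 e2 e3 e4 e5 e6 e7 e8
      simp only [e1, e2, e3, e4, e5, e6, e7, e8]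
      have hE : E.length = b := by simp at hw; omega
      have c1 : ∀ j : Fin n, (A ++ (B ++ (C ++ j :: E))).length =
        A.length + (q + 1) + (C.length + 1 + b) := by intro j; simp; omega
      have c2 : ∀ j : Fin n, (A ++ j :: (C ++ (D ++ E))).length =
        A.length + 1 + C.length + (r + 1) + b := by intro j; simp; omega
      have c3 : (A ++ (B ++ (C ++ (D ++ E)))).length =
        A.length + (q + 1) + (C.length + (r + 1) + b) := by simp; omega
      have c4 : (A ++ (B ++ (C ++ (D ++ E)))).length =
        A.length + (q + 1) + C.length + (r + 1) + b := by simp; omega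
      simp only [c1, c2, if_true]
      rw [if_pos c4, if_pos c3]
      simp only [wedge_sum_right]
      rw [Finset.sum_comm, ← Finset.sum_neg_distrib]
      refine Finset.sum_congr rfl fun l _ => ?_
      rw [← Finset.sum_neg_distrib]
      exact Finset.sum_congr rfl fun j _ => wedge_anticomm _ _ _
    · rw [if_neg (by omega), if_neg (by omega), neg_zero]

theorem tensorD_etaTensor (q : ℕ) : tensorD (etaTensor n q) =
    ∑ x ∈ facets q, insertEta x.1 x.2 (q - x.1 - x.2) (etaTensor n (q - x.2)) := by
  funext i w d
  simp only [Finset.sum_apply]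
  match d with
  | 0 => simp [tensorD, insertEta_zero]
  | 1 =>
    simp only [insertEta_succ, etaTensor, wedge_zero_right, Finset.sum_const_zero, ite_self]
    exact formD_zero
  | d + 3 =>
    simp only [insertEta_succ, etaTensor, wedge_zero_right, Finset.sum_const_zero, ite_self]
    exact formD_zero
  | 2 =>
    by_cases hw : w.length = q + 1
    · refine (formD_eta q i w hw).trans (Finset.sum_congr rfl fun x hx => ?_)
      have := mem_facets.mp hx
      rw [insertEta_succ, if_pos (by omega)]
      rfl
    · have h1 : eta n q i w = 0 := by rw [eta_eq, if_neg hw]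
      have h2 : tensorD (etaTensor n q) i w 2 = formD (eta n q i w) := rfl
      rw [h2, h1, formD_zero]
      symm
      refine Finset.sum_eq_zero fun x hx => ?_
      have := mem_facets.mp hx
      rw [insertEta_succ, if_neg (by omega)]

/-- Here the outer insertion replaces one of the `k + t + 1` letters created by the inner one. Such
nested insertions are the terms of the structure equation for `η_{k+s+t}`, inserted into `ω`. -/
theorem insertEta_insertEta_apply (a k s t b : ℕ) (ω : TensorForm n) (i : Fin n)
    (w : List (Fin n)) (d : ℕ) (hw : w.length = a + (k + s + t + 1) + b) :
    insertEta (a + k) s (t + b) (insertEta a (k + t) b ω) i w (d + 2) =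
      ∑ l, ∑ j, wedge (eta n s l ((((w.drop a).take (k + s + t + 1)).drop k).take (s + 1)))
        (wedge (eta n (k + t) j (((w.drop a).take (k + s + t + 1)).take k ++
            l :: ((w.drop a).take (k + s + t + 1)).drop (k + (s + 1))))
          (ω i (w.take a ++ j :: w.drop (a + (k + s + t + 1))) d)) := by
  obtain ⟨A, w, rfl, rfl, h1⟩ := exists_eq_append_of_le w a (by omega)
  obtain ⟨B, w, rfl, rfl, h2⟩ := exists_eq_append_of_le w k (by omega)
  obtain ⟨C, w, rfl, hC, h3⟩ := exists_eq_append_of_le w (s + 1) (by omega)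
  obtain ⟨D, E, rfl, rfl, h4⟩ := exists_eq_append_of_le w t (by omega)
  have hE : E.length = b := by simp at hw; omega
  have e1 := take_drop_append A (B ++ (C ++ D)) E (k := A.length)
    (s := B.length + s + D.length + 1) rfl (by simp; omega)
  have e2 := take_drop_append B C D rfl hC
  have e3 : ∀ l : Fin n, _ = _ := fun l => take_append_cons_drop B C D l rfl hC
  have e4 : ∀ j : Fin n, _ = _ := fun j => take_append_cons_drop A (B ++ (C ++ D)) E j
    (k := A.length) (s := B.length + s + D.length + 1) rfl (by simp; omega)
  have e5 := take_drop_append (A ++ B) C (D ++ E) (k := A.length + B.length) (by simp) hC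
  have e6 : ∀ l : Fin n, _ = _ := fun l => take_append_cons_drop (A ++ B) C (D ++ E) l
    (k := A.length + B.length) (by simp) hC
  have e7 : ∀ l : Fin n, _ = _ := fun l => take_drop_append A (B ++ (l :: D)) E (k := A.length)
    (s := B.length + D.length + 1) rfl (by simp; omega)
  have e8 : ∀ l j : Fin n, _ = _ := fun l j => take_append_cons_drop A (B ++ (l :: D)) E j
    (k := A.length) (s := B.length + D.length + 1) rfl (by simp; omega)
  simp only [List.append_assoc, List.cons_append] at e1 e2 e3 e4 e5 e6 e7 e8
  have c1 : ∀ l : Fin n, (A ++ (B ++ l :: (D ++ E))).length =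
    A.length + (B.length + D.length + 1) + b := by intro l; simp; omega
  rw [insertEta_succ, if_pos (by simp; omega)]
  simp only [e1, e2, e3, e4, e5, e6, e7, e8, insertEta_succ, c1, if_true, wedge_sum_right]

theorem formD_wedge_eta {r : ℕ} (q : ℕ) (i : Fin n) (w : List (Fin n)) (hw : w.length = q + 1)
    {ω : Form n r} (hω : IsSmooth ω) : formD (wedge (eta n q i w) ω) =
      (∑ x ∈ facets q, ∑ j, wedge (eta n x.2 j ((w.drop x.1).take (x.2 + 1)))
        (wedge (eta n (q - x.2) i (w.take x.1 ++ j :: w.drop (x.1 + (x.2 + 1)))) ω)) +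
      (-1 : ℝ) • wedge (eta n q i w) (formD ω) := by
  funext θ
  obtain ⟨A, hA, hd⟩ := exists_hasFormDeriv_eta θ q i w hw
  obtain ⟨L, hL⟩ := hω.exists_hasFormDeriv θ
  have := formD_wedge hA hL (facets q ×ˢ (Finset.univ : Finset (Fin n)))
    (fun x => eta n x.1.2 x.2 ((w.drop x.1.1).take (x.1.2 + 1)))
    (fun x => eta n (q - x.1.2) i (w.take x.1.1 ++ x.2 :: w.drop (x.1.1 + (x.1.2 + 1)))) hd
  rw [this, Finset.sum_product, sub_eq_add_neg, ← neg_one_smul ℝ (wedge (eta n q i w) (formD ω) θ)]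
  simp only [Pi.add_apply, Finset.sum_apply, Pi.smul_apply]

/-- The Leibniz rule for the insertion of a Maurer–Cartan component. -/
theorem tensorD_insertEta (a q b : ℕ) (ω : TensorForm n) (hω : ∀ i w d, IsSmooth (ω i w d)) :
    tensorD (insertEta a q b ω) =
      ∑ x ∈ facets q, insertEta (a + x.1) x.2 (q - x.1 - x.2 + b) (insertEta a (q - x.2) b ω) +
        (-1 : ℝ) • insertEta a q b (tensorD ω) := by
  funext i w d
  simp only [Finset.sum_apply, Pi.add_apply, Pi.smul_apply]
  match d with
  | 0 => simp [tensorD, insertEta_zero]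
  | 1 =>
    simp only [insertEta_succ, insertEta_zero, tensorD, wedge_zero_right, Finset.sum_const_zero,
      ite_self, smul_zero, add_zero]
    exact formD_zero
  | d + 2 =>
    by_cases hw : w.length = a + (q + 1) + b
    · have h1 : tensorD (insertEta a q b ω) i w (d + 2) = formD (∑ j, wedge
          (eta n q j ((w.drop a).take (q + 1))) (ω i (w.take a ++ j :: w.drop (a + (q + 1))) d)) := by
        change formD (insertEta a q b ω i w (d + 1)) = _
        rw [insertEta_succ, if_pos hw]
      rw [h1, formD_sum fun j _ => (isSmooth_eta _ _ _).wedge (hω _ _ _), insertEta_succ _ _ _ (tensorD ω),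
        if_pos hw]
      have hm : ((w.drop a).take (q + 1)).length = q + 1 := by simp; omega
      rw [Finset.sum_congr rfl fun j _ => formD_wedge_eta q j _ hm (hω _ _ _), Finset.sum_add_distrib, ← Finset.smul_sum]
      congr 1
      -- The facet becomes the outer summation index, so that each summand can be identified with a
      -- nested insertion.
      rw [Finset.sum_comm]
      refine Finset.sum_congr rfl fun x hx => ?_
      obtain ⟨k, s⟩ := x
      have hx := mem_facets.mp hx
      simp only at hx
      obtain ⟨t, rfl⟩ : ∃ t, q = k + s + t := ⟨q - k - s, by omega⟩
      have c1 : k + s + t - s = k + t := by omega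
      have c2 : k + s + t - k - s = t := by omega
      simp only [c1, c2]
      rw [insertEta_insertEta_apply a k s t b ω i w d hw, Finset.sum_comm]
    · have h1 : tensorD (insertEta a q b ω) i w (d + 2) = 0 := by
        change formD (insertEta a q b ω i w (d + 1)) = _
        rw [insertEta_succ, if_neg hw, formD_zero]
      rw [h1, insertEta_succ _ _ _ (tensorD ω), if_neg hw, smul_zero, add_zero]
      symm
      refine Finset.sum_eq_zero fun x hx => ?_
      have := mem_facets.mp hx
      rw [insertEta_succ, if_neg (by omega)]

end

/-! ### Invariance under the automorphism group of the free group. -/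

section

open MagnusExpansion (Index Tangent chart tangentSeries)

variable {n : ℕ}

/-- The hypothesis on `g` is limited to words no longer than `w` so that the lemma can be used in an
induction on word length in which `g` is not yet known to be differentiable. -/
theorem hasDerivAt_mul_apply {f g : ℝ → Series n} {f' g' : Series n} (w : List (Fin n))
    (hf : ∀ u, HasDerivAt (fun t => f t u) (f' u) 0)
    (hg : ∀ u, u.length ≤ w.length → HasDerivAt (fun t => g t u) (g' u) 0) :
    HasDerivAt (fun t => (f t * g t) w) ((f' * g 0 + f 0 * g') w) 0 := by
  simp only [Series.mul_apply, Series.add_apply, ← Finset.sum_add_distrib]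
  exact HasDerivAt.fun_sum fun k _ => (hf _).mul (hg _ (by simp))

/-- The derivative of `θ(γ)` is given by the Maurer–Cartan form. -/
theorem hasDerivAt_magnus (θ : MagnusExpansion n) (v : Tangent n) (γ : FreeGroup (Fin n))
    (w : List (Fin n)) :
    HasDerivAt (fun t : ℝ => ((chart n).symm (chart n θ + t • v)) γ w)
      ((maurerCartan θ v).1 (θ γ) w) 0 := by
  have h0 : (chart n).symm (chart n θ + (0 : ℝ) • v) = θ := by simp
  induction γ using FreeGroup.induction_on generalizing w with
  | C1 => simpa [lieIA_apply_one] using hasDerivAt_const (0 : ℝ) ((1 : Series n) w)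
  | of i =>
    rw [maurerCartan_apply_of]
    have := (hasDerivAt_tangentSeries (chart n θ) v i w).const_add ((1 + Series.X i : Series n) w)
    refine this.congr_of_eventuallyEq (Filter.Eventually.of_forall fun t => ?_)
    simp only [MagnusExpansion.of_eq, Equiv.apply_symm_apply, Series.add_apply]
  | mul γ δ hγ hδ =>
    have := hasDerivAt_mul_apply w hγ fun u _ => hδ u
    rw [h0] at this
    simpa only [map_mul, (maurerCartan θ v).2.2.2] using this
  | inv_of i ih =>
    set f : ℝ → Series n := fun t => ((chart n).symm (chart n θ + t • v)) (FreeGroup.of i) with hf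
    set g : ℝ → Series n := fun t => ((chart n).symm (chart n θ + t • v)) (FreeGroup.of i)⁻¹ with hg
    set u := (maurerCartan θ v).1
    have hfg : ∀ t, f t * g t = 1 := fun t => by simp only [hf, hg, ← map_mul]; simp
    have hgf : ∀ t, g t * f t = 1 := fun t => by simp only [hf, hg, ← map_mul]; simp
    have hf0 : f 0 = θ (FreeGroup.of i) := by simp only [hf, h0]
    have hg0 : g 0 = θ (FreeGroup.of i)⁻¹ := by simp only [hg, h0]
    -- Differentiability of the inverse comes first. As `f` has constant term `1`, the equation `f *
    -- g = 1` expresses the coefficient of `g` at `a :: w` by coefficients at words no longer than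
    -- `w`.
    have hex : ∀ w, ∃ d, HasDerivAt (fun t => g t w) d 0 := by
      intro w
      induction hl : w.length using Nat.strong_induction_on generalizing w with
      | _ l ihl =>
      cases w with
      | nil =>
        exact ⟨0, by simpa only [hg, MagnusExpansion.apply_nil] using
          hasDerivAt_const (0 : ℝ) (1 : ℝ)⟩
      | cons a w =>
        have hsplit : (fun t => g t (a :: w)) = fun t => -(Series.tail a (f t) * g t) w := by
          funext t
          have h1 := congrArg (fun z : Series n => z (a :: w)) (hfg t)
          simp only [Series.mul_cons, Series.one_cons] at h1
          have h2 : f t [] = 1 := MagnusExpansion.apply_nil _ _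
          rw [h2] at h1
          linarith
        have hd : ∀ x : List (Fin n), ∃ d, x.length ≤ w.length → HasDerivAt (fun t => g t x) d 0 := by
          intro x
          by_cases hx : x.length ≤ w.length
          · obtain ⟨d, hd⟩ := ihl x.length (by simp at hl; omega) x rfl
            exact ⟨d, fun _ => hd⟩
          · exact ⟨0, fun h => absurd h hx⟩
        choose d hd using hd
        rw [hsplit]
        exact ⟨_, (hasDerivAt_mul_apply (f' := Series.tail a (u (θ (FreeGroup.of i)))) (g' := d) w
          (fun x => ih (a :: x)) hd).neg⟩
    obtain ⟨d, hd⟩ : ∃ d : Series n, ∀ w, HasDerivAt (fun t => g t w) (d w) 0 :=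
      ⟨fun w => (hex w).choose, fun w => (hex w).choose_spec⟩
    have h1 : u (θ (FreeGroup.of i)) * g 0 + f 0 * d = 0 := by
      ext w
      have h2 : HasDerivAt (fun t => (f t * g t) w)
          ((u (θ (FreeGroup.of i)) * g 0 + f 0 * d) w) 0 :=
        hasDerivAt_mul_apply w ih fun x _ => hd x
      have h3 : (fun t => (f t * g t) w) = fun _ => (1 : Series n) w :=
        funext fun t => congrArg (fun z : Series n => z w) (hfg t)
      rw [h3] at h2
      exact h2.unique (hasDerivAt_const _ _)
    have h3 : u (f 0) * g 0 + f 0 * u (g 0) = 0 := by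
      rw [← (maurerCartan θ v).2.2.2, hfg]
      exact lieIA_apply_one _
    -- The derivative and the derivation `u` both kill `f * g = 1`, and they agree on `f`;
    -- cancelling `f 0` on the left shows that they agree on `g`.
    have h4 : d = u (g 0) := by
      rw [← hf0] at h1
      have h5 : f 0 * d = f 0 * u (g 0) := by
        rw [eq_neg_of_add_eq_zero_right h1, eq_neg_of_add_eq_zero_right h3]
      calc d = g 0 * (f 0 * d) := by rw [← mul_assoc, hgf, one_mul]
        _ = u (g 0) := by rw [h5, ← mul_assoc, hgf, one_mul]
    rw [← hg0, ← h4]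
    exact hd w

section subst

variable (M N : Matrix (Fin n) (Fin n) ℝ)

/-- The substitution belonging to a matrix, as a linear endomorphism. -/
noncomputable def substLin : Module.End ℝ (Series n) where
  toFun := subst M
  map_add' := subst_add M
  map_smul' := subst_smul M

theorem substLin_apply (z : Series n) : substLin M z = subst M z := rfl

theorem subst_sum {ι : Type*} (s : Finset ι) (z : ι → Series n) :
    subst M (∑ i ∈ s, z i) = ∑ i ∈ s, subst M (z i) := map_sum (substLin M) z s

theorem subst_fun_sum {ι : Type*} (s : Finset ι) (c : ι → ℝ) (z : ι → Series n)
    (w : List (Fin n)) : subst M (fun u => ∑ i ∈ s, c i * z i u) w = ∑ i ∈ s, c i * subst M (z i) w := by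
  have : (fun u => ∑ i ∈ s, c i * z i u : Series n) = ∑ i ∈ s, c i • z i := by
    ext u; simp [Series.sum_apply]
  rw [this, subst_sum, Series.sum_apply]
  simp [subst_smul]

/-- A linear substitution preserves the length of words, so only coefficients at words of the same
length contribute. -/
theorem subst_congr {y z : Series n} (w : List (Fin n))
    (h : ∀ u : List (Fin n), u.length = w.length → y u = z u) : subst M y w = subst M z w := by
  induction w generalizing y z with
  | nil => exact h [] rfl
  | cons a w ih =>
    simp only [subst_cons]
    exact Finset.sum_congr rfl fun b _ => congrArg (M a b * ·)
      (ih (y := Series.tail b y) (z := Series.tail b z) fun u hu => h (b :: u) (by simp [hu]))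

/-- The substitution acts on each tensor factor separately, hence on the two parts of a word one
after the other. -/
theorem subst_append (z : Series n) (u w : List (Fin n)) :
    subst M z (u ++ w) = subst M (fun u' => subst M (fun w' => z (u' ++ w')) w) u := by
  induction u generalizing z with
  | nil => rfl
  | cons a u ih =>
    exact (subst_cons M z a (u ++ w)).trans ((Finset.sum_congr rfl fun b _ =>
      congrArg (M a b * ·) (ih (Series.tail b z))).trans
      (subst_cons M (fun u' => subst M (fun w' => z (u' ++ w')) w) a u).symm)

theorem tail_subst (a : Fin n) (z : Series n) :
    Series.tail a (subst M z) = ∑ b, M a b • subst M (Series.tail b z) := by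
  ext w
  simp [Series.sum_apply]

theorem subst_subst (z : Series n) : subst M (subst N z) = subst (M * N) z := by
  ext w
  induction w generalizing z with
  | nil => rfl
  | cons a w ih =>
    simp only [subst_cons, tail_subst, subst_sum, subst_smul, Series.sum_apply, Series.smul_apply,
      ih, Matrix.mul_apply, Finset.mul_sum, Finset.sum_mul]
    rw [Finset.sum_comm]
    exact Finset.sum_congr rfl fun _ _ => Finset.sum_congr rfl fun _ _ => by ring

theorem subst_matrix_one (z : Series n) : subst 1 z = z := by
  ext w
  induction w generalizing z with
  | nil => rfl
  | cons a w ih => simp [ih, Matrix.one_apply]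

theorem subst_X (i : Fin n) : subst M (Series.X i) = ∑ j, M j i • Series.X j := by
  ext w
  cases w with
  | nil => simp [Series.sum_apply, Series.X]
  | cons a w =>
    simp only [subst_cons, Series.sum_apply, Series.tail_X, subst_smul, subst_one,
      Series.smul_apply]
    have h1 : ∀ j, M j i * Series.X j (a :: w) = if j = a then M a i * (1 : Series n) w else 0 := by
      intro j
      by_cases hj : j = a
      · subst hj; by_cases hw : w = [] <;> simp [Series.X, Series.one_apply, hw]
      · simp [Series.X, hj, Ne.symm hj]
    simp only [h1]
    simp

theorem subst_mem_filt {m : ℕ} {z : Series n} (hz : z ∈ Series.filt n m) :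
    subst M z ∈ Series.filt n m := by
  intro w hw
  rw [subst_congr M (z := 0) w fun u hu => hz u (by omega)]
  exact congrArg (fun f : Series n => f w) (map_zero (substLin M))

theorem hasDerivAt_subst {z : ℝ → Series n} {y : Series n}
    (h : ∀ w, HasDerivAt (fun t => z t w) (y w) 0) (w : List (Fin n)) :
    HasDerivAt (fun t => subst M (z t) w) (subst M y w) 0 := by
  induction w generalizing z y with
  | nil => exact h []
  | cons a w ih =>
    simp only [subst_cons]
    exact HasDerivAt.fun_sum fun b _ => (ih fun u => h (b :: u)).const_mul _

end subst

theorem homologyMatrix_mul_inv (φ : MulAut (FreeGroup (Fin n))) :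
    homologyMatrix φ * homologyMatrix φ⁻¹ = 1 := by
  ext a b
  have := homologyClass_map φ (φ⁻¹ (FreeGroup.of b)) a
  rw [MulAut.apply_inv_self, homologyClass_of, Pi.single_apply] at this
  rw [Matrix.mul_apply, Matrix.one_apply]
  exact this.symm

theorem homologyMatrix_inv_mul (φ : MulAut (FreeGroup (Fin n))) :
    homologyMatrix φ⁻¹ * homologyMatrix φ = 1 := by
  simpa using homologyMatrix_mul_inv φ⁻¹

/-- The conjugate `|φ| ∘ u ∘ |φ|⁻¹`. -/
noncomputable def lieConj (φ : MulAut (FreeGroup (Fin n))) (u : lieIA n) : lieIA n :=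
  ⟨substLin (homologyMatrix φ) * u.1 * substLin (homologyMatrix φ⁻¹), by
    obtain ⟨u, h1, h2, h3⟩ := u
    refine ⟨fun m hm z hz => ?_, fun z hz => ?_, fun y z => ?_⟩
    · exact subst_mem_filt _ (h1 m hm _ (subst_mem_filt _ hz))
    · exact subst_mem_filt _ (h2 _ (subst_mem_filt _ hz))
    · simp only [Module.End.mul_apply, substLin_apply, subst_mul, h3, subst_add, subst_subst,
        homologyMatrix_mul_inv, subst_matrix_one]⟩

theorem lieConj_apply (φ : MulAut (FreeGroup (Fin n))) (u : lieIA n) (z : Series n) :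
    (lieConj φ u).1 z = subst (homologyMatrix φ) (u.1 (subst (homologyMatrix φ⁻¹) z)) := rfl

/-- The coordinates of `φ · θ` are those of `|φ|(θ(φ⁻¹(x_i)))`. Here `φ⁻¹(x_i)` is an arbitrary
element of the free group, so the derivative of `θ(γ)` is needed for all `γ` and not only for
generators. -/
theorem maurerCartan_actDeriv (φ : MulAut (FreeGroup (Fin n))) (θ : MagnusExpansion n)
    (v : Tangent n) : maurerCartan (MagnusExpansion.act φ θ) (actDeriv φ θ v) =
      lieConj φ (maurerCartan θ v) := by
  have : actDeriv φ θ v = infinitesimalAction (MagnusExpansion.act φ θ)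
      (lieConj φ (maurerCartan θ v)) := by
    funext c
    have hact : ∀ θ : MagnusExpansion n, MagnusExpansion.act φ θ (FreeGroup.of c.1) =
        subst (homologyMatrix φ) (θ ((φ⁻¹ : MulAut _) (FreeGroup.of c.1))) := fun θ => rfl
    rw [infinitesimalAction_apply, lieConj_apply, hact, subst_subst, homologyMatrix_inv_mul,
      subst_matrix_one]
    exact HasLineDerivAt.lineDeriv (hasDerivAt_subst (homologyMatrix φ)
      (hasDerivAt_magnus θ v ((φ⁻¹ : MulAut _) (FreeGroup.of c.1))) c.2.1)
  rw [this, maurerCartan_infinitesimalAction]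

theorem isInvariant_etaTensor (p : ℕ) : IsInvariant (etaTensor n p) := by
  intro φ θ q v i w
  have hz : subst (homologyMatrix φ) (fun _ => 0) w = 0 :=
    congrArg (fun f : Series n => f w) (map_zero (substLin (homologyMatrix φ)))
  match q with
  | 0 | q + 2 =>
    symm
    exact Finset.sum_eq_zero fun j _ => mul_eq_zero_of_right _ hz
  | 1 =>
    simp only [etaTensor, eta_eq]
    by_cases hw : w.length = p + 1
    · rw [if_pos hw, maurerCartanForm_apply, maurerCartan_actDeriv, lieConj_apply, subst_X,
        map_sum, subst_sum, Series.sum_apply]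
      refine Finset.sum_congr rfl fun j _ => ?_
      rw [map_smul, subst_smul, Series.smul_apply]
      congr 1
      refine subst_congr _ _ fun u hu => ?_
      rw [if_pos (hu.trans hw)]
      rfl
    · rw [if_neg hw, Pi.zero_apply, AlternatingMap.zero_apply]
      symm
      refine Finset.sum_eq_zero fun j _ => ?_
      refine mul_eq_zero_of_right _ ((subst_congr _ (z := 0) _ fun u hu => ?_).trans hz)
      rw [if_neg (by omega)]
      rfl

/-- Naturality of composition: the contracted letter `j` is transformed by `N` as the argument of
`e` and by `M` as a letter of `f`, and the two cancel. -/
theorem sum_subst_mul_subst_append {M N : Matrix (Fin n) (Fin n) ℝ} (hNM : N * M = 1)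
    (e : Fin n → Series n) (f : Series n) (u x y : List (Fin n)) :
    ∑ j, (∑ l, N l j * subst M (e l) x) * subst M f (u ++ j :: y) =
      subst M (fun w => ∑ j, e j ((w.drop u.length).take x.length) *
        f (w.take u.length ++ j :: w.drop (u.length + x.length))) (u ++ (x ++ y)) := by
  have h1 : ∀ j, subst M f (u ++ j :: y) = subst M (fun u' => ∑ k, M j k *
      subst M (fun y' => f (u' ++ k :: y')) y) u := fun j => by
    rw [subst_append]; rfl
  have h2 : ∑ j, (∑ l, N l j * subst M (e l) x) * subst M f (u ++ j :: y) =
      subst M (fun u' => ∑ l, subst M (e l) x * subst M (fun y' => f (u' ++ l :: y')) y) u := by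
    simp only [h1]
    have h3 := subst_fun_sum M Finset.univ (fun j => ∑ l, N l j * subst M (e l) x)
      (fun j u' => ∑ k, M j k * subst M (fun y' => f (u' ++ k :: y')) y) u
    rw [← h3]
    refine subst_congr _ _ fun u' _ => ?_
    have h4 : ∀ l k, ∑ j, N l j * M j k = if l = k then 1 else 0 := fun l k => by
      rw [← Matrix.mul_apply, hNM, Matrix.one_apply]
    calc ∑ j, (∑ l, N l j * subst M (e l) x) * ∑ k, M j k * subst M (fun y' => f (u' ++ k :: y')) y
        = ∑ l, ∑ k, (∑ j, N l j * M j k) *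
            (subst M (e l) x * subst M (fun y' => f (u' ++ k :: y')) y) := by
          simp only [Finset.sum_mul, Finset.mul_sum]
          rw [Finset.sum_comm]
          rw [Finset.sum_congr rfl fun k _ => Finset.sum_comm, Finset.sum_comm]
          exact Finset.sum_congr rfl fun l _ => Finset.sum_congr rfl fun k _ =>
            Finset.sum_congr rfl fun j _ => by ring
      _ = _ := by simp [h4]
  refine h2.trans (Eq.trans ?_ (subst_append M _ _ _).symm)
  refine subst_congr _ _ fun u' hu => Eq.trans ?_ (subst_append M _ _ _).symm
  have h5 : ∀ x' : List (Fin n), x'.length = x.length → subst M (fun y' =>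
      ∑ j, e j (((u' ++ (x' ++ y')).drop u.length).take x.length) *
        f ((u' ++ (x' ++ y')).take u.length ++ j :: (u' ++ (x' ++ y')).drop (u.length + x.length))) y
      = ∑ j, subst M (fun y' => f (u' ++ j :: y')) y * e j x' := by
    intro x' hx
    simp only [take_drop_append _ _ _ hu hx, take_append_cons_drop _ _ _ _ hu hx]
    rw [subst_fun_sum M Finset.univ (fun j => e j x') fun j y' => f (u' ++ j :: y')]
    exact Finset.sum_congr rfl fun _ _ => mul_comm _ _
  have h6 : subst M (fun x' => ∑ j, subst M (fun y' => f (u' ++ j :: y')) y * e j x') x =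
      ∑ j, subst M (fun y' => f (u' ++ j :: y')) y * subst M (e j) x :=
    subst_fun_sum M Finset.univ _ e x
  refine Eq.trans ?_ ((subst_congr M x h5).trans h6).symm
  exact Finset.sum_congr rfl fun _ _ => mul_comm _ _

theorem IsInvariant.insertEta (a p b : ℕ) {ω : TensorForm n} (hω : IsInvariant ω) :
    IsInvariant (insertEta a p b ω) := by
  intro φ θ q v i w
  have hz : subst (homologyMatrix φ) 0 w = 0 :=
    congrArg (fun f : Series n => f w) (map_zero (substLin (homologyMatrix φ)))
  match q with
  | 0 =>
    symm
    exact Finset.sum_eq_zero fun j _ => mul_eq_zero_of_right _ hz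
  | q + 1 =>
    simp only [insertEta_succ]
    by_cases hw : w.length = a + (p + 1) + b
    · have hη : ∀ (v : Tangent n) j u, eta n p j u (MagnusExpansion.act φ θ)
          (fun _ => actDeriv φ θ v) = ∑ l, homologyMatrix φ⁻¹ l j *
            subst (homologyMatrix φ) (fun x => eta n p l x θ (fun _ => v)) u :=
        fun v j u => isInvariant_etaTensor p φ θ 1 (fun _ => v) j u
      rw [if_pos hw, Finset.sum_apply, sum_alternating_apply]
      have h1 : ∀ l, subst (homologyMatrix φ) (fun u => (if u.length = a + (p + 1) + b then
            ∑ j, wedge (eta n p j ((u.drop a).take (p + 1)))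
              (ω l (u.take a ++ j :: u.drop (a + (p + 1))) q)
            else 0) θ v) w =
          subst (homologyMatrix φ) (fun u => ∑ k : Fin (q + 1), (-1) ^ (k : ℕ) * ∑ j,
            eta n p j ((u.drop a).take (p + 1)) θ (fun _ => v k) *
              ω l (u.take a ++ j :: u.drop (a + (p + 1))) q θ (k.removeNth v)) w := by
        intro l
        refine subst_congr _ _ fun u hu => ?_
        rw [if_pos (hu.trans hw), Finset.sum_apply, sum_alternating_apply]
        simp only [wedge_apply, Finset.mul_sum]
        exact Finset.sum_comm
      have h2 : ∀ l, subst (homologyMatrix φ) (fun u => ∑ k : Fin (q + 1), (-1) ^ (k : ℕ) * ∑ j,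
            eta n p j ((u.drop a).take (p + 1)) θ (fun _ => v k) *
              ω l (u.take a ++ j :: u.drop (a + (p + 1))) q θ (k.removeNth v)) w =
          ∑ k : Fin (q + 1), (-1) ^ (k : ℕ) * subst (homologyMatrix φ) (fun u => ∑ j,
            eta n p j ((u.drop a).take (p + 1)) θ (fun _ => v k) *
              ω l (u.take a ++ j :: u.drop (a + (p + 1))) q θ (k.removeNth v)) w := fun l =>
        subst_fun_sum _ _ _ _ _
      have h0 : ∀ l, _ = _ := fun l => (h1 l).trans (h2 l)
      refine Eq.trans ?_ (Finset.sum_congr rfl fun l _ =>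
        (congrArg (homologyMatrix φ⁻¹ l i * ·) (h0 l)).symm)
      simp only [wedge_apply, Finset.mul_sum (s := (Finset.univ : Finset (Fin (q + 1))))]
      rw [Finset.sum_comm, Finset.sum_comm (s := (Finset.univ : Finset (Fin n)))]
      -- For a fixed vector `v k` fed to the 1-form, the claim no longer involves wedge products; it
      -- is naturality of composition.
      refine Finset.sum_congr rfl fun k _ => ?_
      have hrem : (k.removeNth fun k => actDeriv φ θ (v k)) =
          fun m => actDeriv φ θ (k.removeNth v m) := rfl
      rw [hrem]
      simp only [hη, hω φ θ q (k.removeNth v)]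
      obtain ⟨A, w, rfl, rfl, -⟩ := exists_eq_append_of_le w a (by omega)
      obtain ⟨B, C, rfl, hB, -⟩ := exists_eq_append_of_le w (p + 1) (by simp at hw; omega)
      rw [← hB]
      have h3 : ∀ l, _ = _ := fun l => sum_subst_mul_subst_append (homologyMatrix_inv_mul φ)
        (fun j x => eta n p j x θ (fun _ => v k)) (fun x => ω l x q θ (k.removeNth v)) A B C
      simp only [← h3]
      simp only [take_drop_append A B C rfl rfl, take_append_cons_drop A B C _ rfl rfl,
        Finset.mul_sum, Finset.sum_mul]
      rw [Finset.sum_comm]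
      refine Finset.sum_congr rfl fun l _ => Finset.sum_congr rfl fun j _ =>
        Finset.sum_congr rfl fun m _ => by ring
    · rw [if_neg hw, Pi.zero_apply, AlternatingMap.zero_apply]
      symm
      refine Finset.sum_eq_zero fun j _ => ?_
      refine mul_eq_zero_of_right _ ((subst_congr _ (z := 0) _ fun u hu => ?_).trans hz)
      rw [if_neg (by omega)]
      rfl

theorem isInvariantForm_etaTensor (p : ℕ) : IsInvariantForm p (etaTensor n p) where
  length_eq i w q hw := by
    match q with
    | 0 => rfl
    | 1 =>
      change eta n p i w = 0
      rw [eta_eq, if_neg hw]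
    | q + 2 => rfl
  smooth i w q := by
    match q with
    | 0 => exact isSmooth_zero
    | 1 => exact isSmooth_eta p i w
    | q + 2 => exact isSmooth_zero
  invariant := isInvariant_etaTensor p

theorem IsInvariantForm.insertEta (a p b : ℕ) {m : ℕ} {ω : TensorForm n}
    (hω : IsInvariantForm m ω) : IsInvariantForm (a + b + p) (insertEta a p b ω) where
  length_eq i w q hw := by
    cases q with
    | zero => rfl
    | succ q => rw [insertEta_succ, if_neg (by omega)]
  smooth i w q := by
    cases q with
    | zero => exact isSmooth_zero
    | succ q =>
      rw [insertEta_succ]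
      split_ifs
      · exact IsSmooth.sum fun j _ => (isSmooth_eta _ _ _).wedge (hω.smooth _ _ _)
      · exact isSmooth_zero
  invariant := hω.invariant.insertEta a p b

theorem IsInvariantForm.const_smul (c : ℝ) {m : ℕ} {ω : TensorForm n}
    (hω : IsInvariantForm m ω) : IsInvariantForm m (c • ω) where
  length_eq i w q hw := by
    rw [Pi.smul_apply, Pi.smul_apply, Pi.smul_apply, hω.length_eq i w q hw, smul_zero]
  smooth i w q := (hω.smooth i w q).const_smul c
  invariant φ θ q v i w := by
    have h1 : ∀ j, subst (homologyMatrix φ) (fun u => (c • ω) j u q θ v) w =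
        c * subst (homologyMatrix φ) (fun u => ω j u q θ v) w := fun j =>
      congrArg (fun f : Series n => f w)
        (subst_smul (homologyMatrix φ) c fun u => ω j u q θ v)
    have h2 := congrArg (fun x => c * x) (hω.invariant φ θ q v i w)
    simp only [h1]
    refine h2.trans ?_
    rw [Finset.mul_sum]
    exact Finset.sum_congr rfl fun j _ => by ring

end

/-! ### Combinatorics of replacing a letter by a parenthesized word. -/

section

section shift

variable {a b q : ℕ} {B : Finset (ℕ × ℕ)} {I J L : ℕ × ℕ}

theorem shiftPair_fst (a q : ℕ) (I : ℕ × ℕ) :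
    (shiftPair a q I).1 = if I.1 ≤ a then I.1 else I.1 + q := rfl

theorem shiftPair_snd (a q : ℕ) (I : ℕ × ℕ) :
    (shiftPair a q I).2 = if I.2 < a then I.2 else I.2 + q := rfl

theorem shiftPair_fst_le_iff : (shiftPair a q I).1 ≤ (shiftPair a q J).1 ↔ I.1 ≤ J.1 := by
  simp only [shiftPair_fst]; split_ifs <;> omega

theorem shiftPair_snd_le_iff : (shiftPair a q I).2 ≤ (shiftPair a q J).2 ↔ I.2 ≤ J.2 := by
  simp only [shiftPair_snd]; split_ifs <;> omega

theorem shiftPair_snd_lt_fst_iff : (shiftPair a q I).2 < (shiftPair a q J).1 ↔ I.2 < J.1 := by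
  simp only [shiftPair_fst, shiftPair_snd]; split_ifs <;> omega

theorem shiftPair_injective (a q : ℕ) : Function.Injective (shiftPair a q) := by
  intro I J h
  have h1 := congrArg Prod.fst h
  have h2 := congrArg Prod.snd h
  simp only [shiftPair_fst, shiftPair_snd] at h1 h2
  ext
  · split_ifs at h1 <;> omega
  · split_ifs at h2 <;> omega

theorem shiftPair_inj : shiftPair a q I = shiftPair a q J ↔ I = J :=
  (shiftPair_injective a q).eq_iff

theorem before_shiftPair_iff : Before (shiftPair a q I) (shiftPair a q J) ↔ Before I J := by
  simp only [Before, shiftPair_fst, shiftPair_snd]; split_ifs <;> omega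

theorem before_new_shiftPair_iff (hI : I.1 < I.2) :
    Before (a, a + q) (shiftPair a q I) ↔ a < I.1 := by
  simp only [Before, shiftPair_fst, shiftPair_snd]; split_ifs <;> omega

theorem before_shiftPair_new_iff (hI : I.1 < I.2) :
    Before (shiftPair a q I) (a, a + q) ↔ I.1 ≤ a := by
  simp only [Before, shiftPair_fst, shiftPair_snd]; split_ifs <;> omega

/-- An old pair encloses at least two letters, so it cannot end up inside the replacement of a
single letter. This is what makes the new pair innermost. -/
theorem shiftPair_not_inside (hI : I.1 < I.2) :
    ¬(a ≤ (shiftPair a q I).1 ∧ (shiftPair a q I).2 ≤ a + q) := by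
  simp only [shiftPair_fst, shiftPair_snd]; split_ifs <;> omega

theorem shiftPair_ne (hI : I.1 < I.2) : shiftPair a q I ≠ (a, a + q) := by
  intro h
  refine shiftPair_not_inside (a := a) (q := q) hI ?_
  rw [h]
  exact ⟨le_rfl, le_rfl⟩

theorem not_before_self : ¬Before I I := by
  unfold Before; omega

theorem before_or_before (h : I ≠ J) : Before I J ∨ Before J I := by
  by_contra hc
  unfold Before at hc
  exact h (Prod.ext (by omega) (by omega))

/-- The position of the gap `x` after the letter `a` was replaced by `q + 1` letters. -/
def shiftGap (a q x : ℕ) : ℕ := if x < a then x else x + q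

theorem shiftGap_injective (a q : ℕ) : Function.Injective (shiftGap a q) := by
  intro x y h
  simp only [shiftGap] at h
  split_ifs at h <;> omega

theorem shiftPair_fst_le_shiftGap_iff {x : ℕ} : (shiftPair a q I).1 ≤ shiftGap a q x ↔ I.1 ≤ x := by
  simp only [shiftGap, shiftPair_fst]; split_ifs <;> omega

theorem shiftGap_lt_shiftPair_snd_iff {x : ℕ} : shiftGap a q x < (shiftPair a q I).2 ↔ x < I.2 := by
  simp only [shiftGap, shiftPair_snd]; split_ifs <;> omega

theorem shiftGap_lt_shiftPair_fst_iff {x : ℕ} : shiftGap a q x < (shiftPair a q I).1 ↔ x < I.1 := by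
  simp only [shiftGap, shiftPair_fst]; split_ifs <;> omega

theorem exists_shiftGap_eq {x : ℕ} (hx : ¬(a ≤ x ∧ x < a + q)) : ∃ y, shiftGap a q y = x := by
  by_cases h : x < a
  · exact ⟨x, if_pos h⟩
  · exact ⟨x - q, by rw [shiftGap, if_neg (by omega)]; omega⟩

theorem mem_insertPair : I ∈ insertPair a q B ↔ I = (a, a + q) ∨ ∃ J ∈ B, shiftPair a q J = I := by
  simp [insertPair]

theorem new_mem_insertPair : (a, a + q) ∈ insertPair a q B := mem_insertPair.mpr (Or.inl rfl)

theorem shiftPair_mem_insertPair (h : I ∈ B) : shiftPair a q I ∈ insertPair a q B :=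
  mem_insertPair.mpr (Or.inr ⟨I, h, rfl⟩)

theorem new_notMem_image (hB : ∀ I ∈ B, I.1 < I.2) : (a, a + q) ∉ B.image (shiftPair a q) := by
  intro h
  obtain ⟨J, hJ, h⟩ := Finset.mem_image.mp h
  exact shiftPair_ne (hB J hJ) h

theorem shiftPair_mem_insertPair_iff (hI : I.1 < I.2) :
    shiftPair a q I ∈ insertPair a q B ↔ I ∈ B := by
  refine ⟨fun h => ?_, shiftPair_mem_insertPair⟩
  rcases mem_insertPair.mp h with h | ⟨J, hJ, h⟩
  · exact absurd h (shiftPair_ne hI)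
  · rwa [← shiftPair_inj.mp h]

theorem card_insertPair (hB : ∀ I ∈ B, I.1 < I.2) : (insertPair a q B).card = B.card + 1 := by
  rw [insertPair, Finset.card_insert_of_notMem (new_notMem_image hB),
    Finset.card_image_of_injective _ (shiftPair_injective a q)]

theorem sum_insertPair {A : Type*} [AddCommMonoid A] (hB : ∀ I ∈ B, I.1 < I.2) (f : ℕ × ℕ → A) :
    ∑ L ∈ insertPair a q B, f L = f (a, a + q) + ∑ L ∈ B, f (shiftPair a q L) := by
  rw [insertPair, Finset.sum_insert (new_notMem_image hB),
    Finset.sum_image fun _ _ _ _ h => shiftPair_injective a q h]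

theorem insertPair_injective {C : Finset (ℕ × ℕ)} (hB : ∀ I ∈ B, I.1 < I.2)
    (hC : ∀ I ∈ C, I.1 < I.2) (h : insertPair a q B = insertPair a q C) : B = C := by
  ext I
  by_cases hI : I.1 < I.2
  · rw [← shiftPair_mem_insertPair_iff (a := a) (q := q) hI, h, shiftPair_mem_insertPair_iff hI]
  · exact ⟨fun h => absurd (hB I h) hI, fun h => absurd (hC I h) hI⟩

theorem insertPair_insert : insertPair a q (insert I B) = insert (shiftPair a q I) (insertPair a q B) := by
  rw [insertPair, insertPair, Finset.image_insert, Finset.insert_comm]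

theorem mem_gaps {x : ℕ} : x ∈ gaps B I ↔ (I.1 ≤ x ∧ x < I.2) ∧
    ∀ J ∈ B, J ≠ I → I.1 ≤ J.1 → J.2 ≤ I.2 → ¬(J.1 ≤ x ∧ x < J.2) := by
  simp [gaps]

/-- The gaps missed by `shiftGap` are exactly the `q` gaps inside the new pair. They belong to that
pair only, so the factors of the old pairs keep their dimensions. -/
theorem gaps_insertPair_shiftPair (hL : L.1 < L.2) :
    gaps (insertPair a q B) (shiftPair a q L) = (gaps B L).image (shiftGap a q) := by
  ext x
  rw [Finset.mem_image]
  constructor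
  · intro hx
    obtain ⟨h1, h2⟩ := mem_gaps.mp hx
    have h3 := h2 _ new_mem_insertPair (shiftPair_ne hL).symm
    have h4 : ¬(a ≤ x ∧ x < a + q) := by
      intro hc
      refine h3 ?_ ?_ hc
      · simp only [shiftPair_fst] at h1 ⊢; split_ifs at h1 ⊢ <;> omega
      · simp only [shiftPair_snd] at h1 ⊢; split_ifs at h1 ⊢ <;> omega
    obtain ⟨y, rfl⟩ := exists_shiftGap_eq h4
    refine ⟨y, mem_gaps.mpr ⟨?_, fun J hJ hJL h5 h6 h7 => ?_⟩, rfl⟩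
    · rwa [shiftPair_fst_le_shiftGap_iff, shiftGap_lt_shiftPair_snd_iff] at h1
    · refine h2 _ (shiftPair_mem_insertPair hJ) (fun h => hJL (shiftPair_inj.mp h))
        (shiftPair_fst_le_iff.mpr h5) (shiftPair_snd_le_iff.mpr h6) ?_
      rwa [shiftPair_fst_le_shiftGap_iff, shiftGap_lt_shiftPair_snd_iff]
  · rintro ⟨y, hy, rfl⟩
    obtain ⟨h1, h2⟩ := mem_gaps.mp hy
    refine mem_gaps.mpr ⟨?_, fun J hJ hJL h5 h6 h7 => ?_⟩
    · rwa [shiftPair_fst_le_shiftGap_iff, shiftGap_lt_shiftPair_snd_iff]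
    · rcases mem_insertPair.mp hJ with rfl | ⟨J, hJ', rfl⟩
      · simp only [shiftGap] at h7; split_ifs at h7 <;> omega
      · rw [shiftPair_fst_le_shiftGap_iff, shiftGap_lt_shiftPair_snd_iff] at h7
        exact h2 J hJ' (fun h => hJL (h ▸ rfl)) (shiftPair_fst_le_iff.mp h5)
          (shiftPair_snd_le_iff.mp h6) h7

theorem gaps_eq_Ico (h : ∀ J ∈ B, J ≠ I → ¬(I.1 ≤ J.1 ∧ J.2 ≤ I.2)) : gaps B I = Finset.Ico I.1 I.2 := by
  ext x
  rw [mem_gaps, Finset.mem_Ico]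
  exact ⟨fun h => h.1, fun hx => ⟨hx, fun J hJ hne h1 h2 => absurd ⟨h1, h2⟩ (h J hJ hne)⟩⟩

theorem gaps_insertPair_new (hB : ∀ I ∈ B, I.1 < I.2) :
    gaps (insertPair a q B) (a, a + q) = Finset.Ico a (a + q) := by
  refine gaps_eq_Ico fun J hJ hne => ?_
  rcases mem_insertPair.mp hJ with rfl | ⟨J, hJ', rfl⟩
  · exact absurd rfl hne
  · exact shiftPair_not_inside (hB J hJ')

theorem factorDim_insertPair_shiftPair (hL : L.1 < L.2) :
    factorDim (insertPair a q B) (shiftPair a q L) = factorDim B L := by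
  rw [factorDim, gaps_insertPair_shiftPair hL,
    Finset.card_image_of_injective _ (shiftGap_injective a q), factorDim]

theorem factorDim_insertPair_new (hB : ∀ I ∈ B, I.1 < I.2) :
    factorDim (insertPair a q B) (a, a + q) = q - 1 := by
  rw [factorDim, gaps_insertPair_new hB]; simp

theorem IsCell.lt {p : ℕ} (hB : IsCell p B) : ∀ I ∈ B, I.1 < I.2 := fun I hI => (hB.2.1 I hI).1

/-- The sum of the dimensions of the factors after a new pair of parentheses. -/
def dimAfter (B : Finset (ℕ × ℕ)) (a : ℕ) : ℕ := ∑ L ∈ B.filter (fun L => a < L.1), factorDim B L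

theorem sum_filter_before_new (hB : ∀ I ∈ B, I.1 < I.2) :
    ∑ L ∈ (insertPair a q B).filter (fun L => Before (a, a + q) L), factorDim (insertPair a q B) L =
      dimAfter B a := by
  rw [Finset.sum_filter, sum_insertPair hB, if_neg not_before_self, zero_add, dimAfter,
    Finset.sum_filter]
  refine Finset.sum_congr rfl fun L hL => ?_
  rw [factorDim_insertPair_shiftPair (hB L hL)]
  simp only [before_new_shiftPair_iff (hB L hL)]

theorem dimAfter_insertPair (hB : ∀ I ∈ B, I.1 < I.2) {c : ℕ} (hc : c < a) :
    dimAfter (insertPair a q B) c = (q - 1) + dimAfter B c := by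
  rw [dimAfter, Finset.sum_filter, sum_insertPair hB, if_pos hc, factorDim_insertPair_new hB, dimAfter,
    Finset.sum_filter]
  congr 1
  refine Finset.sum_congr rfl fun L hL => ?_
  rw [factorDim_insertPair_shiftPair (hB L hL)]
  have : c < (shiftPair a q L).1 ↔ c < L.1 := by
    simp only [shiftPair_fst]; split_ifs <;> omega
  simp only [this]

theorem dimAfter_eq_zero (h : ∀ L ∈ B, L.1 ≤ a) : dimAfter B a = 0 := by
  refine Finset.sum_eq_zero fun L hL => ?_
  have := Finset.mem_filter.mp hL
  exact absurd this.2 (not_lt.mpr (h L this.1))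

theorem shiftPair_comm (e r : ℕ) (I : ℕ × ℕ) : shiftPair a q (shiftPair (a + 1 + e) r I) =
    shiftPair (a + q + 1 + e) r (shiftPair a q I) := by
  ext
  · simp only [shiftPair_fst]; split_ifs <;> omega
  · simp only [shiftPair_snd]; split_ifs <;> omega

/-- Replacements at distinct letters commute, except that the one further right moves by `q`. -/
theorem insertPair_comm (e r : ℕ) : insertPair a q (insertPair (a + 1 + e) r B) =
    insertPair (a + q + 1 + e) r (insertPair a q B) := by
  have h1 : shiftPair a q (a + 1 + e, a + 1 + e + r) = (a + q + 1 + e, a + q + 1 + e + r) := by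
    ext
    · simp only [shiftPair_fst]; split_ifs <;> omega
    · simp only [shiftPair_snd]; split_ifs <;> omega
  have h2 : shiftPair (a + q + 1 + e) r (a, a + q) = (a, a + q) := by
    ext
    · simp only [shiftPair_fst]; split_ifs <;> omega
    · simp only [shiftPair_snd]; split_ifs <;> omega
  rw [insertPair, insertPair, insertPair, insertPair, Finset.image_insert, Finset.image_insert, h1,
    h2, Finset.image_image, Finset.image_image, Finset.insert_comm]
  congr 2
  exact Finset.image_congr fun I _ => shiftPair_comm e r I

/-- A facet of the newest factor arises by inserting fewer letters first and then replacing one of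
them. This is the combinatorial counterpart of `insertEta_insertEta_apply`. -/
theorem insertPair_insertPair_inside (hB : ∀ I ∈ B, I.1 < I.2) (k s t : ℕ) :
    insertPair (a + k) s (insertPair a (k + t) B) =
      insert (a + k, a + k + s) (insertPair a (k + s + t) B) := by
  rw [insertPair, insertPair, insertPair, Finset.image_insert, Finset.image_image]
  congr 1
  have h1 : shiftPair (a + k) s (a, a + (k + t)) = (a, a + (k + s + t)) := by
    ext
    · simp only [shiftPair_fst]; split_ifs <;> omega
    · simp only [shiftPair_snd]; split_ifs <;> omega
  rw [h1]
  congr 1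
  refine Finset.image_congr fun I hI => ?_
  have := hB I hI
  ext
  · simp only [Function.comp_apply, shiftPair_fst]; split_ifs <;> omega
  · simp only [Function.comp_apply, shiftPair_snd]; split_ifs <;> omega

end shift

/-! ### Induction over cells by removal of the last pair, and their boundaries. -/

section cells

/-- The pair of parentheses `(a, a + q)` of the cell `B` is the last one in the order `Before`, and
replacing its content by one letter yields the cell `C` of `K_{a + b + 1}`. -/
structure IsLastFace (p : ℕ) (B : Finset (ℕ × ℕ)) (a q b : ℕ) (C : Finset (ℕ × ℕ)) : Prop where
  pos : 1 ≤ q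
  isCell : IsCell (a + b) C
  eq : p = a + b + q
  eq_insertPair : B = insertPair a q C
  last : ∀ L ∈ C, L.1 ≤ a

variable {p a q b : ℕ} {B C : Finset (ℕ × ℕ)}

theorem IsLastFace.not_before (h : IsLastFace p B a q b C) : ∀ L ∈ B, ¬Before (a, a + q) L := by
  intro L hL
  rw [h.eq_insertPair] at hL
  rcases mem_insertPair.mp hL with rfl | ⟨J, hJ, rfl⟩
  · exact not_before_self
  · rw [before_new_shiftPair_iff (h.isCell.lt J hJ)]
    exact not_lt.mpr (h.last J hJ)

/-- Any two distinct pairs are comparable under `Before`, so there is only one last pair; the rest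
is recovered by injectivity of `insertPair`. -/
theorem IsLastFace.unique {a' q' b' : ℕ} {C' : Finset (ℕ × ℕ)} (h : IsLastFace p B a q b C)
    (h' : IsLastFace p B a' q' b' C') : a = a' ∧ q = q' ∧ b = b' ∧ C = C' := by
  have h1 : (a, a + q) ∈ B := h.eq_insertPair ▸ new_mem_insertPair
  have h2 : (a', a' + q') ∈ B := h'.eq_insertPair ▸ new_mem_insertPair
  have h3 : (a, a + q) = (a', a' + q') := by
    by_contra hne
    rcases before_or_before hne with hb | hb
    · exact h.not_before _ h2 hb
    · exact h'.not_before _ h1 hb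
  obtain rfl : a = a' := congrArg Prod.fst h3
  obtain rfl : q = q' := by have := congrArg Prod.snd h3; simpa using this
  refine ⟨rfl, rfl, ?_, ?_⟩
  · have := h.eq; have := h'.eq; omega
  · exact insertPair_injective h.isCell.lt h'.isCell.lt
      (h.eq_insertPair.symm.trans h'.eq_insertPair)

theorem IsCell.pos (hB : IsCell p B) : 1 ≤ p := by
  have := hB.2.1 _ hB.1
  simp only at this
  omega

theorem IsCell.exists_isLastFace (hB : IsCell p B) (hne : B ≠ {(0, p)}) :
    ∃ a q b C, IsLastFace p B a q b C := by
  obtain ⟨h0, h1, h2⟩ := hB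
  -- This number encodes `Before` lexicographically: the opening position counts first, then the
  -- closing position in reverse.
  obtain ⟨M, hM, hmax⟩ := Finset.exists_max_image B (fun I => I.1 * (p + 1) + (p - I.2)) ⟨_, h0⟩
  have hlast : ∀ L ∈ B, ¬Before M L := by
    intro L hL hbef
    have h3 := hmax L hL
    have h4 := h1 L hL
    have h5 := h1 M hM
    rcases hbef with h | ⟨h, h'⟩
    · have : (M.1 + 1) * (p + 1) ≤ L.1 * (p + 1) := Nat.mul_le_mul_right _ h
      rw [Nat.add_mul] at this
      omega
    · rw [h] at h3
      omega
  obtain ⟨a, r⟩ := M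
  have hM1 := h1 _ hM
  simp only at hM1
  obtain ⟨q, rfl⟩ : ∃ q, r = a + q := ⟨r - a, by omega⟩
  have hM0 : (a, a + q) ≠ (0, p) := by
    intro h
    refine hne (Finset.eq_singleton_iff_unique_mem.mpr ⟨h0, fun L hL => ?_⟩)
    by_contra hL'
    have h3 := hlast L hL
    rw [h] at h3
    have := h1 L hL
    refine hL' (Prod.ext ?_ ?_) <;> simp only [Before] at h3 ⊢ <;> omega
  have hM0' : 0 < a ∨ a + q < p := by
    by_contra hc
    exact hM0 (Prod.ext (by simp only; omega) (by simp only; omega))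
  have hrel : ∀ L ∈ B, L ≠ (a, a + q) → L.1 ≤ a ∧ (L.2 < a ∨ (a + q ≤ L.2 ∧ (L.1 < a ∨ a + q < L.2))) := by
    intro L hL hne
    have h3 := h2 L hL _ hM
    have h4 := hlast L hL
    have h5 := h1 L hL
    have h6 : ¬(L.1 = a ∧ L.2 = a + q) := fun h => hne (Prod.ext h.1 h.2)
    simp only [Before] at h3 h4
    omega
  -- Inverse of `shiftPair` on the remaining pairs. They all open at or before `a`, so only the
  -- closing position has to be moved back.
  let un : ℕ × ℕ → ℕ × ℕ := fun I => (I.1, if I.2 < a then I.2 else I.2 - q)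
  have hun1 : ∀ I, (un I).1 = I.1 := fun _ => rfl
  have hun2 : ∀ I, (un I).2 = if I.2 < a then I.2 else I.2 - q := fun _ => rfl
  refine ⟨a, q, p - q - a, (B.erase (a, a + q)).image un, by omega, ⟨?_, ?_, ?_⟩, by omega, ?_, ?_⟩
  · refine Finset.mem_image.mpr ⟨(0, p), Finset.mem_erase.mpr ⟨hM0.symm, h0⟩, Prod.ext rfl ?_⟩
    rw [hun2]
    simp only
    split_ifs <;> omega
  · intro I hI
    obtain ⟨L, hL, rfl⟩ := Finset.mem_image.mp hI
    obtain ⟨hL1, hL2⟩ := Finset.mem_erase.mp hL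
    have h3 := hrel L hL2 hL1
    have h4 := h1 L hL2
    rw [hun1, hun2]
    split_ifs <;> omega
  · intro I hI J hJ
    obtain ⟨L, hL, rfl⟩ := Finset.mem_image.mp hI
    obtain ⟨hL1, hL2⟩ := Finset.mem_erase.mp hL
    obtain ⟨K, hK, rfl⟩ := Finset.mem_image.mp hJ
    obtain ⟨hK1, hK2⟩ := Finset.mem_erase.mp hK
    have h3 := hrel L hL2 hL1
    have h4 := h1 L hL2
    have h5 := hrel K hK2 hK1
    have h6 := h1 K hK2
    have h7 := h2 L hL2 K hK2
    simp only [hun1, hun2]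
    split_ifs <;> omega
  · rw [insertPair, Finset.image_image]
    have : (B.erase (a, a + q)).image (shiftPair a q ∘ un) = B.erase (a, a + q) := by
      conv_rhs => rw [← Finset.image_id (s := B.erase (a, a + q))]
      refine Finset.image_congr fun L hL => ?_
      obtain ⟨hL1, hL2⟩ := Finset.mem_erase.mp hL
      have h3 := hrel L hL2 hL1
      refine Prod.ext ?_ ?_
      · simp only [Function.comp_apply, shiftPair_fst, hun1, id]; split_ifs <;> omega
      · simp only [Function.comp_apply, shiftPair_snd, hun2, id]; split_ifs <;> omega
    rw [this, Finset.insert_erase hM]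
  · intro I hI
    obtain ⟨L, hL, rfl⟩ := Finset.mem_image.mp hI
    obtain ⟨hL1, hL2⟩ := Finset.mem_erase.mp hL
    exact (hrel L hL2 hL1).1

theorem IsCell.induction {motive : ℕ → Finset (ℕ × ℕ) → Prop}
    (top : ∀ p, 1 ≤ p → motive p {(0, p)})
    (face : ∀ p B a q b C, IsLastFace p B a q b C → motive (a + b) C → motive p B)
    (hB : IsCell p B) : motive p B := by
  induction hN : B.card using Nat.strong_induction_on generalizing p B with
  | _ N ih =>
  by_cases h : B = {(0, p)}
  · exact h ▸ top p hB.pos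
  · obtain ⟨a, q, b, C, hf⟩ := hB.exists_isLastFace h
    refine face p B a q b C hf (ih C.card ?_ hf.isCell rfl)
    rw [← hN, hf.eq_insertPair, card_insertPair hf.isCell.lt]
    exact Nat.lt_succ_self _

theorem gaps_singleton (I : ℕ × ℕ) : gaps {I} I = Finset.Ico I.1 I.2 :=
  gaps_eq_Ico fun _ hJ hne => absurd (Finset.mem_singleton.mp hJ) hne

/-- The dimension of a cell. -/
theorem IsCell.sum_factorDim (hB : IsCell p B) : ∑ L ∈ B, factorDim B L + B.card = p := by
  refine IsCell.induction (motive := fun p B => ∑ L ∈ B, factorDim B L + B.card = p) ?_ ?_ hB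
  · intro p hp
    simp [factorDim, gaps_singleton]
    omega
  · intro p B a q b C hf ih
    obtain ⟨hq, hC, rfl, rfl, hlast⟩ := hf
    rw [sum_insertPair hC.lt, card_insertPair hC.lt, factorDim_insertPair_new hC.lt,
      Finset.sum_congr rfl fun L hL => factorDim_insertPair_shiftPair (hC.lt L hL)]
    omega

theorem mem_newPairs {J I : ℕ × ℕ} : I ∈ newPairs p B J ↔
    ((J.1 ≤ I.1 ∧ I.1 ≤ J.2) ∧ (J.1 ≤ I.2 ∧ I.2 ≤ J.2)) ∧
    I ∉ B ∧ IsCell p (insert I B) ∧ ∀ L ∈ B, L.1 ≤ I.1 → I.2 ≤ L.2 → L.1 ≤ J.1 ∧ J.2 ≤ L.2 := by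
  simp [newPairs]

theorem mem_newPairs_lt {J I : ℕ × ℕ} (h : I ∈ newPairs p B J) : I.1 < I.2 :=
  (mem_newPairs.mp h).2.2.1.lt I (Finset.mem_insert_self _ _)

/-- A pair added directly inside an old pair is not contained in `(a, a + q)`, and being disjoint
from it or containing it, it never cuts the new block; so it is a shifted pair. -/
theorem newPairs_insertPair_shiftPair (hq : 1 ≤ q) (hC : IsCell (a + b) C) {J : ℕ × ℕ} (hJ : J ∈ C) :
    newPairs (a + b + q) (insertPair a q C) (shiftPair a q J) =
      (newPairs (a + b) C J).image (shiftPair a q) := by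
  ext I
  rw [Finset.mem_image]
  constructor
  · intro hI
    have hlt := mem_newPairs_lt hI
    obtain ⟨h1, h2, h3, h4⟩ := mem_newPairs.mp hI
    have h5 := h4 _ new_mem_insertPair
    have h6 := shiftPair_not_inside (a := a) (q := q) (hC.lt J hJ)
    have h7 := h3.2.2 I (Finset.mem_insert_self _ _) _
      (Finset.mem_insert_of_mem new_mem_insertPair)
    have h8 : I ≠ (a, a + q) := fun h => h2 (h ▸ new_mem_insertPair)
    have h9 : ¬(I.1 = a ∧ I.2 = a + q) := fun h => h8 (Prod.ext h.1 h.2)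
    simp only at h5 h6 h7
    obtain ⟨K, rfl⟩ : ∃ K, shiftPair a q K = I := by
      refine ⟨(if I.1 ≤ a then I.1 else I.1 - q, if I.2 < a then I.2 else I.2 - q), Prod.ext ?_ ?_⟩
      · simp only [shiftPair_fst]; split_ifs <;> omega
      · simp only [shiftPair_snd]; split_ifs <;> omega
    have hK : K.1 < K.2 := by
      simp only [shiftPair_fst, shiftPair_snd] at hlt h9
      split_ifs at hlt h9 <;> omega
    refine ⟨K, mem_newPairs.mpr ⟨?_, fun h => h2 (shiftPair_mem_insertPair h), ⟨?_, ?_, ?_⟩, ?_⟩, rfl⟩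
    · rw [shiftPair_fst_le_iff, shiftPair_snd_le_iff] at h1
      have := hC.lt J hJ
      omega
    · exact Finset.mem_insert_of_mem hC.1
    · intro L hL
      rcases Finset.mem_insert.mp hL with rfl | hL
      · refine ⟨hK, ?_⟩
        have := (h3.2.1 _ (Finset.mem_insert_self _ _)).2
        simp only [shiftPair_snd] at this
        split_ifs at this <;> omega
      · exact hC.2.1 L hL
    · rw [← insertPair_insert] at h3
      intro L hL L' hL'
      have := h3.2.2 _ (shiftPair_mem_insertPair hL) _ (shiftPair_mem_insertPair hL')
      simpa only [shiftPair_fst_le_iff, shiftPair_snd_le_iff, shiftPair_snd_lt_fst_iff] using this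
    · intro L hL hL1 hL2
      have := h4 _ (shiftPair_mem_insertPair hL) (shiftPair_fst_le_iff.mpr hL1)
        (shiftPair_snd_le_iff.mpr hL2)
      rwa [shiftPair_fst_le_iff, shiftPair_snd_le_iff] at this
  · rintro ⟨K, hK, rfl⟩
    have hlt := mem_newPairs_lt hK
    obtain ⟨h1, h2, h3, h4⟩ := mem_newPairs.mp hK
    refine mem_newPairs.mpr ⟨?_, fun h => h2 ((shiftPair_mem_insertPair_iff hlt).mp h), ?_, ?_⟩
    · have h5 := shiftPair_fst_le_iff (a := a) (q := q) (I := J) (J := K)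
      have h6 := shiftPair_snd_le_iff (a := a) (q := q) (I := K) (J := J)
      have h7 := (isCell_insertPair hq h3).lt _
        (shiftPair_mem_insertPair (a := a) (q := q) (Finset.mem_insert_self _ _))
      omega
    · rw [← insertPair_insert]
      exact isCell_insertPair hq h3
    · intro L hL hL1 hL2
      rcases mem_insertPair.mp hL with rfl | ⟨L, hL', rfl⟩
      · exact absurd ⟨hL1, hL2⟩ (shiftPair_not_inside hlt)
      · rw [shiftPair_fst_le_iff] at hL1 ⊢
        rw [shiftPair_snd_le_iff] at hL2 ⊢
        exact h4 L hL' hL1 hL2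

/-- As `J` is the smallest pair of `B` around `I`, no other pair of `B` inside `J` contains `I`; the
pairs that obstruct a place within `I` are thus the same for `I` and for `J`. -/
theorem gaps_insert {J I : ℕ × ℕ} (hJ : J ∈ B) (hI : I ∈ newPairs p B J) :
    gaps (insert I B) I = (gaps B J).filter fun x => I.1 ≤ x ∧ x < I.2 := by
  obtain ⟨h1, h2, h3, h4⟩ := mem_newPairs.mp hI
  ext x
  rw [Finset.mem_filter, mem_gaps, mem_gaps]
  constructor
  · rintro ⟨hx, hx'⟩
    refine ⟨⟨by omega, fun L hL hne hL1 hL2 hL3 => ?_⟩, hx⟩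
    have h5 := hx' L (Finset.mem_insert_of_mem hL) (fun h => h2 (h ▸ hL))
    have h6 := h3.2.2 L (Finset.mem_insert_of_mem hL) I (Finset.mem_insert_self _ _)
    have h7 := h4 L hL
    refine hne (Prod.ext ?_ ?_) <;> omega
  · rintro ⟨⟨hx, hx'⟩, hx2⟩
    refine ⟨hx2, fun L hL hne hL1 hL2 hL3 => ?_⟩
    rcases Finset.mem_insert.mp hL with rfl | hL
    · exact hne rfl
    · refine hx' L hL (fun h => h2 ?_) (by omega) (by omega) hL3
      subst h
      have : I = L := Prod.ext (by omega) (by omega)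
      rwa [this]

/-- The new pairs inside the last pair of parentheses of a cell. -/
theorem newPairs_last (hB : IsCell p B) (hmem : (a, a + q) ∈ B)
    (hlast : ∀ L ∈ B, ¬Before (a, a + q) L) :
    newPairs p B (a, a + q) = (facets q).image fun x => (a + x.1, a + x.1 + x.2) := by
  ext I
  rw [Finset.mem_image]
  have hp := hB.2.1 _ hmem
  simp only at hp
  constructor
  · intro hI
    have hlt := mem_newPairs_lt hI
    obtain ⟨h1, h2, h3, h4⟩ := mem_newPairs.mp hI
    have h5 : ¬(I.1 = a ∧ I.2 = a + q) := fun h =>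
      h2 ((Prod.ext h.1 h.2 : I = (a, a + q)) ▸ hmem)
    simp only at h1
    refine ⟨(I.1 - a, I.2 - I.1), mem_facets.mpr ?_, Prod.ext ?_ ?_⟩ <;> simp only <;> omega
  · rintro ⟨⟨k, s⟩, hx, rfl⟩
    have hx := mem_facets.mp hx
    simp only at hx
    -- No pair lies strictly inside the last one, hence every proper segment of at least two letters
    -- in it may be parenthesized.
    have hrel : ∀ L ∈ B, L.2 < a ∨ (a + q < L.1) ∨ (L.1 ≤ a ∧ a + q ≤ L.2) := by
      intro L hL
      have h1 := hlast L hL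
      have h2 := hB.2.2 L hL _ hmem
      simp only [Before] at h1 h2
      omega
    refine mem_newPairs.mpr ⟨by simp only; omega, fun h => hlast _ h ?_, ⟨?_, ?_, ?_⟩, ?_⟩
    · simp only [Before]; omega
    · exact Finset.mem_insert_of_mem hB.1
    · intro L hL
      rcases Finset.mem_insert.mp hL with rfl | hL
      · simp only; omega
      · exact hB.2.1 L hL
    · intro L hL L' hL'
      rcases Finset.mem_insert.mp hL with rfl | hL <;> rcases Finset.mem_insert.mp hL' with rfl | hL'
      · simp
      · have := hrel L' hL'; simp only; omega
      · have := hrel L hL; simp only; omega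
      · exact hB.2.2 L hL L' hL'
    · intro L hL hL1 hL2
      have := hrel L hL
      simp only at hL1 hL2 ⊢
      omega

end cells

end

/-! ### The cochain, independence of choices, and the cocycle equation. -/

section

open MagnusExpansion (Index Tangent chart)

variable {n p a q b : ℕ} {B C : Finset (ℕ × ℕ)}

open Classical in
/-- The assembly along the last pairs of parentheses; the first argument bounds the recursion. -/
noncomputable def assembleAux (n : ℕ) : ℕ → ℕ → Finset (ℕ × ℕ) → TensorForm n
  -- Default value, not reached from `assemble` on a cell: a cell contains its outermost pair, and
  -- the bound drops together with the number of pairs.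
  | 0, p, _ => etaTensor n p
  | N + 1, p, B =>
    if h : ∃ x : ℕ × ℕ × ℕ × Finset (ℕ × ℕ), IsLastFace p B x.1 x.2.1 x.2.2.1 x.2.2.2 then
      (-1 : ℝ) ^ (h.choose.1 + (h.choose.2.1 + 1) * h.choose.2.2.1 + h.choose.2.2.2.card) •
        insertEta h.choose.1 h.choose.2.1 h.choose.2.2.1
          (assembleAux n N (h.choose.1 + h.choose.2.2.1) h.choose.2.2.2)
    else etaTensor n p

/-- The value of the cochain `Y_p` at the cell `B` with its standard orientation. -/
noncomputable def assemble (n p : ℕ) (B : Finset (ℕ × ℕ)) : TensorForm n :=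
  assembleAux n B.card p B

theorem assemble_top (p : ℕ) : assemble n p {(0, p)} = etaTensor n p := by
  rw [assemble, Finset.card_singleton, assembleAux, dif_neg]
  rintro ⟨⟨a, q, b, C⟩, h⟩
  simp only at h
  have h1 := congrArg Finset.card h.eq_insertPair
  rw [card_insertPair h.isCell.lt, Finset.card_singleton] at h1
  exact Finset.notMem_empty _ (Finset.card_eq_zero.mp (by omega : C.card = 0) ▸ h.isCell.1)

theorem IsLastFace.assemble_eq (h : IsLastFace p B a q b C) :
    assemble n p B =
      (-1 : ℝ) ^ (a + (q + 1) * b + C.card) • insertEta a q b (assemble n (a + b) C) := by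
  have hex : ∃ x : ℕ × ℕ × ℕ × Finset (ℕ × ℕ), IsLastFace p B x.1 x.2.1 x.2.2.1 x.2.2.2 :=
    ⟨(a, q, b, C), h⟩
  obtain ⟨h1, h2, h3, h4⟩ := hex.choose_spec.unique h
  have hcard : B.card = C.card + 1 := by rw [h.eq_insertPair, card_insertPair h.isCell.lt]
  rw [assemble, hcard, assembleAux, dif_pos hex, h1, h2, h3, h4, assemble]

theorem neg_one_pow_eq_of_eq_add {x y : ℕ} (k : ℕ) (h : y = x + 2 * k) :
    (-1 : ℝ) ^ x = (-1) ^ y := by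
  rw [h, pow_add, pow_mul, neg_one_sq, one_pow, mul_one]

theorem neg_one_pow_succ (x : ℕ) : (-1 : ℝ) ^ (x + 1) = -(-1) ^ x := by ring

/-- The assembly rule for an arbitrary innermost pair of parentheses. -/
theorem assemble_insertPair (hq : 1 ≤ q) (hC : IsCell (a + b) C) :
    assemble n (a + b + q) (insertPair a q C) =
      (-1 : ℝ) ^ (a + (q + 1) * b + C.card + (q - 1) * dimAfter C a) •
        insertEta a q b (assemble n (a + b) C) := by
  induction hN : C.card generalizing b C with
  | zero => exact absurd hC.1 (Finset.card_eq_zero.mp hN ▸ Finset.notMem_empty _)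
  | succ N ih =>
  by_cases hlast : ∀ L ∈ C, L.1 ≤ a
  · rw [dimAfter_eq_zero hlast, mul_zero, add_zero, ← hN]
    exact IsLastFace.assemble_eq ⟨hq, hC, rfl, rfl, hlast⟩
  have hne : C ≠ {(0, a + b)} := by
    rintro rfl
    exact hlast (by simp)
  obtain ⟨c, r, d, D, hD⟩ := hC.exists_isLastFace hne
  -- The last pair has the largest opening position, so `c ≤ a` would contradict `hlast`.
  have hc : a < c := by
    by_contra hc
    refine hlast fun L hL => ?_
    have h1 := hD.not_before L hL
    simp only [Before] at h1
    omega
  obtain ⟨e, rfl⟩ : ∃ e, c = a + 1 + e := ⟨c - (a + 1), by omega⟩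
  have hb : b = e + 1 + d + r := by have := hD.eq; omega
  subst hb
  have hDcell : IsCell (a + (e + 1 + d)) D := by
    have := hD.isCell
    rwa [show a + 1 + e + d = a + (e + 1 + d) by omega] at this
  have hr := hD.pos
  have hcard : D.card = N := by
    have h1 := congrArg Finset.card hD.eq_insertPair
    rw [card_insertPair hDcell.lt] at h1
    omega
  -- Replacing the letter `a` moves the last pair of `C` by `q` but leaves it last. The large cell
  -- can therefore be peeled at that pair, and the two insertions are at distinct letters.
  have hface : IsLastFace (a + (e + 1 + d + r) + q) (insertPair a q C) (a + (q + 1) + e) r d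
      (insertPair a q D) := by
    refine ⟨hr, ?_, by omega, ?_, fun L hL => ?_⟩
    · have := isCell_insertPair hq hDcell
      rwa [show a + (e + 1 + d) + q = a + (q + 1) + e + d by omega] at this
    · rw [hD.eq_insertPair, insertPair_comm, Nat.add_assoc a q 1]
    · rcases mem_insertPair.mp hL with rfl | ⟨K, hK, rfl⟩
      · simp only; omega
      · have := hD.last K hK
        simp only [shiftPair_fst]; split_ifs <;> omega
  have ih' := ih hDcell hcard
  rw [hface.assemble_eq, hD.assemble_eq, card_insertPair hDcell.lt, hcard,
    show a + (q + 1) + e + d = a + (e + 1 + d) + q by omega, ih', insertEta_smul, insertEta_smul,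
    insertEta_comm, hD.eq_insertPair, dimAfter_insertPair hDcell.lt hc,
    show a + 1 + e + d = a + (e + 1 + d) by omega, show e + (r + 1) + d = e + 1 + d + r by omega,
    smul_neg, smul_neg, ← neg_smul, smul_smul, smul_smul]
  congr 1
  -- Passing to predecessors removes the truncated subtractions `q - 1` and `r - 1`; the two
  -- exponents then differ by `2(qr + r)`.
  obtain ⟨q, rfl⟩ : ∃ q', q = q' + 1 := ⟨q - 1, by omega⟩
  obtain ⟨r, rfl⟩ : ∃ r', r = r' + 1 := ⟨r - 1, by omega⟩
  simp only [Nat.add_sub_cancel]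
  rw [neg_mul, ← pow_add, ← pow_add, ← neg_one_pow_succ]
  exact neg_one_pow_eq_of_eq_add (q * r + r) (by ring)

theorem isInvariantForm_assemble (hB : IsCell p B) : IsInvariantForm p (assemble n p B) := by
  refine IsCell.induction (motive := fun p B => IsInvariantForm p (assemble n p B)) ?_ ?_ hB
  · intro p _
    rw [assemble_top]
    exact isInvariantForm_etaTensor p
  · intro p B a q b C hf ih
    rw [hf.assemble_eq, hf.eq]
    exact (ih.insertEta a q b).const_smul _

/-- Every pair of parentheses contributes exactly one factor of form degree `1`. -/
theorem assemble_degree (hB : IsCell p B) :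
    ∀ d, d ≠ B.card → ∀ i w, assemble n p B i w d = 0 := by
  refine IsCell.induction
    (motive := fun p B => ∀ d, d ≠ B.card → ∀ i w, assemble n p B i w d = 0) ?_ ?_ hB
  · intro p _ d hd i w
    rw [assemble_top]
    rw [Finset.card_singleton] at hd
    match d, hd with
    | 0, _ => rfl
    | d + 2, _ => rfl
  · intro p B a q b C hf ih d hd i w
    rw [hf.eq_insertPair, card_insertPair hf.isCell.lt] at hd
    rw [hf.assemble_eq, Pi.smul_apply, Pi.smul_apply, Pi.smul_apply]
    cases d with
    | zero => rw [insertEta_zero, smul_zero]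
    | succ d =>
      rw [insertEta_succ]
      split_ifs
      · rw [Finset.sum_eq_zero fun j _ => ?_, smul_zero]
        rw [ih d (by omega), wedge_zero_right]
      · rw [smul_zero]

theorem tensorD_smul (c : ℝ) {ω : TensorForm n} (hω : ∀ i w d, IsSmooth (ω i w d)) :
    tensorD (c • ω) = c • tensorD ω := by
  funext i w d
  cases d with
  | zero => simp [tensorD]
  | succ d => exact formD_const_smul c (hω i w d)

/-- The sign `±1` as a real number. -/
noncomputable def signReal (ε : ℤˣ) : ℝ := ((ε : ℤ) : ℝ)

theorem signReal_mul (ε δ : ℤˣ) : signReal (ε * δ) = signReal ε * signReal δ := by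
  simp [signReal]

theorem signReal_neg_one_pow (k : ℕ) : signReal ((-1) ^ k) = (-1) ^ k := by
  simp [signReal]

theorem sum_filter_before_last (hlast : ∀ L ∈ B, ¬Before (a, a + q) L) (hmem : (a, a + q) ∈ B)
    (f : ℕ × ℕ → ℕ) :
    ∑ L ∈ B.filter (fun L => Before L (a, a + q)), f L + f (a, a + q) = ∑ L ∈ B, f L := by
  have : B.filter (fun L => Before L (a, a + q)) = B.erase (a, a + q) := by
    ext L
    rw [Finset.mem_filter, Finset.mem_erase]
    constructor
    · rintro ⟨h1, h2⟩
      exact ⟨fun h => not_before_self (h ▸ h2), h1⟩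
    · rintro ⟨h1, h2⟩
      exact ⟨h2, (before_or_before h1).resolve_right (hlast L h2)⟩
  rw [this, Finset.sum_erase_add _ _ hmem]

theorem incidence_last (hgaps : gaps B (a, a + q) = Finset.Ico a (a + q))
    (hlast : ∀ L ∈ B, ¬Before (a, a + q) L) {x : ℕ × ℕ} (hx : x ∈ facets q) :
    incidence B (a, a + q) (a + x.1, a + x.1 + x.2) =
      (-1) ^ (∑ L ∈ B.filter (fun L => Before L (a, a + q)), factorDim B L +
        ((x.2 + 1) * (q + x.1) + x.1 + 1)) := by
  have hx := mem_facets.mp hx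
  have h1 : B.filter (fun L => Before (a, a + q) L ∧ Before L (a + x.1, a + x.1 + x.2)) = ∅ :=
    Finset.filter_eq_empty_iff.mpr fun L hL h => hlast L hL h.1
  have h2 : (Finset.Ico a (a + q)).filter (fun y => y < a + x.1) = Finset.Ico a (a + x.1) := by
    ext y; simp only [Finset.mem_filter, Finset.mem_Ico]; omega
  have h3 : (Finset.Ico a (a + q)).filter (fun y => a + x.1 ≤ y ∧ y < a + x.1 + x.2) =
      Finset.Ico (a + x.1) (a + x.1 + x.2) := by
    ext y; simp only [Finset.mem_filter, Finset.mem_Ico]; omega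
  simp only [incidence, h1, hgaps, h2, h3, Finset.sum_empty, mul_zero, add_zero, Nat.card_Ico,
    Nat.add_sub_cancel_left]

/-- The factor `K_{q+1}` comes after the factor of `J`, so it affects only the move of the new
factor to its place. It is passed exactly when `I` opens after `a`, and then `I` is the only pair
counted by `dimAfter (insert I C) a`. -/
theorem incidence_shiftPair (hf : IsLastFace p B a q b C) {J I : ℕ × ℕ} (hJ : J ∈ C)
    (hI : I ∈ newPairs (a + b) C J) :
    incidence B (shiftPair a q J) (shiftPair a q I) =
      incidence C J I * (-1) ^ ((q - 1) * dimAfter (insert I C) a) := by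
  obtain ⟨hq, hC, rfl, rfl, hlast⟩ := hf
  have hJlt := hC.lt J hJ
  have hIlt := mem_newPairs_lt hI
  have e1 : (gaps (insertPair a q C) (shiftPair a q J)).card = (gaps C J).card := by
    rw [gaps_insertPair_shiftPair hJlt, Finset.card_image_of_injective _ (shiftGap_injective a q)]
  have e2 : ((gaps (insertPair a q C) (shiftPair a q J)).filter
      fun x => x < (shiftPair a q I).1).card = ((gaps C J).filter fun x => x < I.1).card := by
    rw [gaps_insertPair_shiftPair hJlt, Finset.filter_image,
      Finset.card_image_of_injective _ (shiftGap_injective a q)]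
    simp only [shiftGap_lt_shiftPair_fst_iff]
  have e3 : ((gaps (insertPair a q C) (shiftPair a q J)).filter
      fun x => (shiftPair a q I).1 ≤ x ∧ x < (shiftPair a q I).2).card =
      ((gaps C J).filter fun x => I.1 ≤ x ∧ x < I.2).card := by
    rw [gaps_insertPair_shiftPair hJlt, Finset.filter_image,
      Finset.card_image_of_injective _ (shiftGap_injective a q)]
    simp only [shiftGap_lt_shiftPair_snd_iff, shiftPair_fst_le_shiftGap_iff]
  have hnb : ¬Before (a, a + q) (shiftPair a q J) := by
    rw [before_new_shiftPair_iff hJlt]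
    exact not_lt.mpr (hlast J hJ)
  have e4 : ∑ L ∈ (insertPair a q C).filter (fun L => Before L (shiftPair a q J)),
      factorDim (insertPair a q C) L = ∑ L ∈ C.filter (fun L => Before L J), factorDim C L := by
    rw [Finset.sum_filter, sum_insertPair hC.lt, if_neg hnb, zero_add, Finset.sum_filter]
    refine Finset.sum_congr rfl fun L hL => ?_
    rw [factorDim_insertPair_shiftPair (hC.lt L hL)]
    simp only [before_shiftPair_iff]
  have e5 : ∑ L ∈ (insertPair a q C).filter
      (fun L => Before (shiftPair a q J) L ∧ Before L (shiftPair a q I)),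
      factorDim (insertPair a q C) L = (if a < I.1 then q - 1 else 0) +
        ∑ L ∈ C.filter (fun L => Before J L ∧ Before L I), factorDim C L := by
    rw [Finset.sum_filter, sum_insertPair hC.lt, factorDim_insertPair_new hC.lt, Finset.sum_filter]
    congr 1
    · simp only [before_shiftPair_new_iff hJlt, before_new_shiftPair_iff hIlt, hlast J hJ,
        true_and]
    · refine Finset.sum_congr rfl fun L hL => ?_
      rw [factorDim_insertPair_shiftPair (hC.lt L hL)]
      simp only [before_shiftPair_iff]
  have e6 : dimAfter (insert I C) a =
      if a < I.1 then ((gaps C J).filter fun x => I.1 ≤ x ∧ x < I.2).card - 1 else 0 := by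
    have h1 : ∀ L ∈ C, ¬a < L.1 := fun L hL => not_lt.mpr (hlast L hL)
    rw [dimAfter, Finset.filter_insert, Finset.filter_eq_empty_iff.mpr h1]
    split_ifs
    · rw [insert_empty_eq, Finset.sum_singleton, factorDim, gaps_insert hJ hI]
    · rfl
  simp only [incidence, e1, e2, e3, e4, e5, e6, ← pow_add]
  congr 1
  split_ifs <;> ring

/-- `dY = δY` at the cell `B`. -/
theorem tensorD_assemble (hB : IsCell p B) : tensorD (assemble n p B) =
    ∑ J ∈ B, ∑ I ∈ newPairs p B J, signReal (incidence B J I) • assemble n p (insert I B) := by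
  refine IsCell.induction (motive := fun p B => tensorD (assemble n p B) =
    ∑ J ∈ B, ∑ I ∈ newPairs p B J, signReal (incidence B J I) • assemble n p (insert I B)) ?_ ?_ hB
  · intro p hp
    have hcell : IsCell p {(0, p)} := (topCell p hp 1).1.2
    have hlast : ∀ L ∈ ({(0, p)} : Finset (ℕ × ℕ)), ¬Before (0, 0 + p) L := by
      intro L hL
      rw [Finset.mem_singleton.mp hL, zero_add]
      exact not_before_self
    have hnew := newPairs_last (a := 0) (q := p) hcell (by simp) hlast
    rw [assemble_top, tensorD_etaTensor, Finset.sum_singleton]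
    simp only [zero_add] at hnew
    rw [hnew, Finset.sum_image (by rintro ⟨k, s⟩ _ ⟨k', s'⟩ _ h; simp at h ⊢; omega)]
    refine Finset.sum_congr rfl fun x hx => ?_
    obtain ⟨k, s⟩ := x
    have hinc := incidence_last (B := {(0, p)}) (a := 0) (by simp [gaps_singleton]) hlast hx
    have hx := mem_facets.mp hx
    simp only [zero_add] at hx hinc ⊢
    obtain ⟨t, rfl⟩ : ∃ t, p = k + s + t := ⟨p - k - s, by omega⟩
    have hface : IsLastFace (k + s + t) {(k, k + s), (0, k + s + t)} k s t {(0, k + t)} := by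
      refine ⟨by omega, (topCell (k + t) (by omega) 1).1.2, by omega, ?_, by simp⟩
      rw [insertPair, Finset.image_singleton]
      congr 2
      ext
      · simp [shiftPair_fst]
      · simp only [shiftPair_snd]; split_ifs <;> omega
    rw [hinc, hface.assemble_eq, assemble_top, show k + s + t - k - s = t by omega,
      show k + s + t - s = k + t by omega, signReal_neg_one_pow, smul_smul, ← pow_add,
      Even.neg_one_pow, one_smul]
    have h0 : ({(0, k + s + t)} : Finset (ℕ × ℕ)).filter (fun L => Before L (0, k + s + t)) = ∅ :=
      Finset.filter_eq_empty_iff.mpr fun L hL h => not_before_self (Finset.mem_singleton.mp hL ▸ h)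
    rw [h0, Finset.sum_empty, Finset.card_singleton]
    simp only [Nat.even_add, Nat.even_mul, Nat.not_even_one, iff_false, zero_add]
    tauto
  · intro p B a q b C hf ih
    have hf' := hf
    obtain ⟨hq, hC, rfl, rfl, hlast⟩ := hf'
    have hB := isCell_insertPair hq hC
    have hsm := isInvariantForm_assemble (n := n) hC
    rw [hf.assemble_eq, tensorD_smul _ (hsm.insertEta a q b).smooth,
      -- Both sides split alike: the derivative of the inserted `η_q` against the facets of the new
      -- factor, the derivative of the rest against the facets of the old factors.
      tensorD_insertEta a q b _ hsm.smooth, ih, sum_insertPair hC.lt, smul_add]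
    congr 1
    · rw [newPairs_last hB new_mem_insertPair hf.not_before,
        Finset.sum_image (by rintro ⟨k, s⟩ _ ⟨k', s'⟩ _ h; simp at h ⊢; omega), Finset.smul_sum]
      refine Finset.sum_congr rfl fun x hx => ?_
      rw [incidence_last (gaps_insertPair_new hC.lt) hf.not_before hx]
      have hx := mem_facets.mp hx
      obtain ⟨k, s⟩ := x
      simp only at hx ⊢
      obtain ⟨t, rfl⟩ : ∃ t, q = k + s + t := ⟨q - k - s, by omega⟩
      have hdim := hC.sum_factorDim
      have hdim2 := sum_filter_before_last hf.not_before new_mem_insertPair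
        (factorDim (insertPair a (k + s + t) C))
      rw [sum_insertPair hC.lt,
        Finset.sum_congr rfl fun L hL => factorDim_insertPair_shiftPair (hC.lt L hL)] at hdim2
      have hface1 : IsLastFace (a + b + (k + t)) (insertPair a (k + t) C) a (k + t) b C :=
        ⟨by omega, hC, rfl, rfl, hlast⟩
      have hface2 : IsLastFace (a + b + (k + s + t))
          (insert (a + k, a + k + s) (insertPair a (k + s + t) C)) (a + k) s (t + b)
          (insertPair a (k + t) C) := by
        refine ⟨by omega, ?_, by omega, (insertPair_insertPair_inside hC.lt k s t).symm,
          fun L hL => ?_⟩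
        · have := isCell_insertPair (q := k + t) (by omega) hC
          rwa [show a + b + (k + t) = a + k + (t + b) by omega] at this
        · rcases mem_insertPair.mp hL with rfl | ⟨K, hK, rfl⟩
          · simp only; omega
          · have := hlast K hK
            simp only [shiftPair_fst]; split_ifs; omega
      rw [hface2.assemble_eq, show a + k + (t + b) = a + b + (k + t) by omega, hface1.assemble_eq,
        insertEta_smul, show k + s + t - s = k + t by omega, show k + s + t - k - s = t by omega,
        signReal_neg_one_pow, smul_smul, smul_smul, card_insertPair hC.lt]
      congr 1
      -- The sign comparison rests on two facts: `s(s + 1)` is even, and the factors before the last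
      -- one have total dimension `a + b - C.card`.
      obtain ⟨m, hm⟩ := Nat.even_mul_succ_self s
      have hF : ∑ L ∈ (insertPair a (k + s + t) C).filter
          (fun L => Before L (a, a + (k + s + t))), factorDim (insertPair a (k + s + t) C) L =
          ∑ L ∈ C, factorDim C L := by omega
      rw [hF, ← pow_add, ← pow_add]
      refine neg_one_pow_eq_of_eq_add (a + b + m + (s + 1) * (k + t) + k + 1) ?_
      linarith
    · rw [insertEta_sum, Finset.smul_sum, Finset.smul_sum]
      refine Finset.sum_congr rfl fun J hJ => ?_
      rw [insertEta_sum, Finset.smul_sum, Finset.smul_sum, newPairs_insertPair_shiftPair hq hC hJ,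
        Finset.sum_image fun _ _ _ _ h => shiftPair_injective a q h]
      refine Finset.sum_congr rfl fun I hI => ?_
      obtain ⟨-, h2, h3, -⟩ := mem_newPairs.mp hI
      -- If `I` opens after `a`, the pair `(a, a + q)` is no longer last in the new cell, so the
      -- rule for an arbitrary innermost pair is required.
      rw [← insertPair_insert, assemble_insertPair hq h3, insertEta_smul,
        incidence_shiftPair hf hJ hI, signReal_mul, signReal_neg_one_pow,
        Finset.card_insert_of_notMem h2, smul_smul, smul_smul, smul_smul]
      congr 1
      generalize signReal (incidence C J I) = x
      generalize (q - 1) * dimAfter (insert I C) a = y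
      -- The reordering sign occurs in the incidence number and in the assembly rule, so it cancels.
      -- The extra pair in `insert I C` accounts for the Leibniz minus sign.
      have hy : (-1 : ℝ) ^ y * (-1) ^ y = 1 := by rw [← pow_add, Even.neg_one_pow ⟨y, rfl⟩]
      rw [pow_add _ _ y, ← Nat.add_assoc, neg_one_pow_succ]
      linear_combination (x * (-1) ^ (a + (q + 1) * b + C.card)) * hy

/-- The cochains `Y_p`. -/
noncomputable def assembly (n : ℕ) (p : ℕ) (w : OrientedCell p) : TensorForm n :=
  signReal w.2 • assemble n p w.1.1

theorem neg_smul_tensorForm (c : ℝ) (ω : TensorForm n) : -c • ω = -(c • ω) := by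
  funext i w q θ
  ext v
  simp

theorem signReal_neg (ε : ℤˣ) : signReal (-ε) = -signReal ε := by simp [signReal]

theorem isAssembly_assembly : IsAssembly (assembly n) where
  top p hp := by
    constructor
    · change signReal 1 • assemble n p {(0, p)} = _
      rw [assemble_top]
      simp [signReal]
    · change signReal (-1) • assemble n p {(0, p)} = _
      rw [assemble_top, signReal_neg, neg_smul_tensorForm]
      simp [signReal]
  face a q b hq w := by
    obtain ⟨⟨C, hC⟩, ε⟩ := w
    simp only [assembly, faceCell, OrientedCell.degree]
    rw [assemble_insertPair hq hC, sum_filter_before_new hC.lt, signReal_mul, signReal_neg_one_pow,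
      insertEta_smul, smul_smul, smul_smul]
    congr 1
    generalize (q - 1) * dimAfter C a = y
    -- The sign in `faceCell` that restores the standard order cancels the one in
    -- `assemble_insertPair`.
    have hy : (-1 : ℝ) ^ y * (-1) ^ y = 1 := by rw [← pow_add, Even.neg_one_pow ⟨y, rfl⟩]
    rw [pow_add _ _ y]
    linear_combination (signReal ε * (-1) ^ (a + (q + 1) * b + C.card)) * hy

/-- The rule for last pairs alone determines the family: for these the reordering sign in `faceCell`
is trivial, and peeling ends at the top cells. -/
theorem IsAssembly.unique {Y : (p : ℕ) → OrientedCell p → TensorForm n} (hY : IsAssembly Y) :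
    Y = assembly n := by
  have key : ∀ p B, IsCell p B → ∀ (hB : IsCell p B) (ε : ℤˣ),
      Y p (⟨B, hB⟩, ε) = signReal ε • assemble n p B := by
    intro p B hB
    refine IsCell.induction (motive := fun p B => ∀ (hB : IsCell p B) (ε : ℤˣ),
      Y p (⟨B, hB⟩, ε) = signReal ε • assemble n p B) ?_ ?_ hB
    · intro p hp hB ε
      rw [assemble_top]
      rcases Int.units_eq_one_or ε with rfl | rfl
      · exact (hY.top p hp).1.trans (by simp [signReal])
      · exact (hY.top p hp).2.trans (by rw [signReal_neg, neg_smul_tensorForm]; simp [signReal])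
    · intro p B a q b C hf ih hB ε
      have hf' := hf
      obtain ⟨hq, hC, rfl, rfl, hlast⟩ := hf'
      have h1 := hY.face a q b hq (⟨C, hC⟩, ε)
      have h2 : faceCell a q b hq (⟨C, hC⟩, ε) = (⟨insertPair a q C, hB⟩, ε) := by
        simp only [faceCell]
        rw [sum_filter_before_new hC.lt, dimAfter_eq_zero hlast]
        simp
      rw [h2] at h1
      rw [h1, ih, insertEta_smul, hf.assemble_eq, smul_comm]
      rfl
  funext p w
  exact key p w.1.1 w.1.2 w.1.2 w.2

theorem coboundary_assembly (w : OrientedCell p) :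
    coboundary (assembly n p) w = signReal w.2 • ∑ J ∈ w.1.1, ∑ I ∈ newPairs p w.1.1 J,
      signReal (incidence w.1.1 J I) • assemble n p (insert I w.1.1) := by
  rw [coboundary, Finset.smul_sum]
  refine Finset.sum_congr rfl fun J _ => ?_
  rw [Finset.smul_sum, ← Finset.sum_attach (newPairs p w.1.1 J)]
  refine Finset.sum_congr rfl fun I _ => ?_
  rw [assembly, signReal_mul, smul_smul]

theorem tensorD_assembly (w : OrientedCell p) :
    tensorD (assembly n p w) = coboundary (assembly n p) w := by
  rw [coboundary_assembly, ← tensorD_assemble w.1.2, assembly,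
    tensorD_smul _ (isInvariantForm_assemble w.1.2).smooth]

theorem isTotalCochain_assembly : IsTotalCochain p p (assembly n p) where
  opposite w := by
    rw [assembly, assembly, OrientedCell.opposite, signReal_neg, neg_smul_tensorForm]
  degree w i u q hq := by
    rw [assembly, Pi.smul_apply, Pi.smul_apply, Pi.smul_apply,
      assemble_degree w.1.2 q (fun h => hq (by rw [h]; rfl)), smul_zero]
  mem w := (isInvariantForm_assemble w.1.2).const_smul _

/-- In a fixed target degree `q`, the `d`-part starts in degree `q - 1` and so has the opposite sign
to the `δ`-part; the cocycle condition is thus `dY = δY`. -/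
theorem totalD_assembly : totalD (assembly n p) = 0 := by
  funext w i u q
  rw [totalD, tensorD_assembly, sub_self, smul_zero]
  rfl

end

end MagnusForms

theorem proposition3p1 (n : ℕ) (hn : 2 ≤ n) :
    ∃ Y : (p : ℕ) → MagnusForms.OrientedCell p → MagnusForms.TensorForm n,
      MagnusForms.IsAssembly Y ∧
      (∀ Y' : (p : ℕ) → MagnusForms.OrientedCell p → MagnusForms.TensorForm n,
        MagnusForms.IsAssembly Y' → Y' = Y) ∧
      ∀ p : ℕ, 1 ≤ p →
        MagnusForms.IsTotalCochain p p (Y p) ∧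
        (∀ w : MagnusForms.OrientedCell p,
          MagnusForms.tensorD (Y p w) = MagnusForms.coboundary (Y p) w) ∧
        MagnusForms.totalD (Y p) = 0 :=
  ⟨MagnusForms.assembly n, MagnusForms.isAssembly_assembly, fun _ h => h.unique, fun _ _ =>
    ⟨MagnusForms.isTotalCochain_assembly, MagnusForms.tensorD_assembly,
      MagnusForms.totalD_assembly⟩⟩
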